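/- Let $\mathcal G$ be a connected metric graph with finitely many vertices and finitely many edges (at least one); each edge $e$ has a length $\ell_e\in(0,+\infty]$ and is identified with $[0,\ell_e]$ if $\ell_e<\infty$ and with the half-line $[0,+\infty)$ if $\ell_e=\infty$. Loops and multiple edges are allowed. Let $\operatorname{dist}$ be the shortest path distance on $\mathcal G$ and $B(x,r)=\{y:\operatorname{dist}(y,x)<r\}$. Let $H^1(\mathcal G)$ be the set of continuous $u:\mathcal G\to\mathbb R$ with $u_e:=u|_e\in H^1(0,\ell_e)$ for every edge $e$, and let $C_c(\mathcal G)$ be the set of continuous functions with compact support. Let $p>2$, let $(\lambda_n)\subset\mathbb R$, and let $W_n,\rho_n:\mathcal G\to\mathbb R$ $(n\in\mathbb N)$ be measurable functions satisfying (H) (i) there is $\bar W\in\mathbb R$ with $|W_n|\le\bar W$ a.e. on $\mathcal G$ for all $n$; (ii) there is $b>0$ with $0\le\rho_n\le b$ a.e. on $\mathcal G$ for all $n$; (iii) there is $a\in(0,b)$ such that for every edge $e$, either $\rho_n\ge a$ a.e. on $e$ for all $n$, or $\rho_n=0$ a.e. on $e$ for all $n$. A solution of $$-u''+W_nu+\lambda_nu=\rho_n|u|^{p-2}u\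 \text{ on every edge},\qquad \sum_{e\succ v}\frac{du_e}{dx}(v)=0\ \text{ at every vertex } v\qquad(*)_n$$ (the derivatives being taken away from $v$) is a function $u\in H^1(\mathcal G)$ satisfying it in the weak sense: $\int_{\mathcal G}\big(u'\varphi'+(W_n+\lambda_n)u\varphi\big)\,dx=\int_{\mathcal G}\rho_n|u|^{p-2}u\varphi\,dx$ for all $\varphi\in H^1(\mathcal G)\cap C_c(\mathcal G)$. Its Morse index is the largest dimension (possibly $+\infty$) of a subspace of $H^1(\mathcal G)\cap C_c(\mathcal G)$ on which $$\varphi\mapsto\int_{\mathcal G}\big(|\varphi'|^2+(W_n+\lambda_n)\varphi^2-(p-1)\rho_n|u|^{p-2}\varphi^2\big)\,dx$$ is negative for all $\varphi\neq0$. **Theorem.** Let $u_n\in H^1(\mathcal G)\setminus\{0\}$ be solutions of $(*)_n$ with $\lambda_n\to+\infty$, and suppose that for some $m^*\in\mathbb N$ the Morse index of $u_n$ is at most $m^*$ for all $n$. Then, after passing to a subsequence (still indexed by $n$, and along which $\lambda_n>0$), there exist $m\in\{1,\dots,m^*\}$, sequences of points $(x_n^1),\dots,(x_n^m)$ in $\mathcal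 G$ and sequences of positive numbers $(R_n^1),\dots,(R_n^m)$ with $R_n^i\to+\infty$ such that $$\lambda_n^{1/2}\operatorname{dist}(x_n^i,x_n^j)\to+\infty\quad\text{for all } i\neq j,$$ $$|u_n(x_n^i)|=\max_{B(x_n^i,\,R_n^i\lambda_n^{-1/2})}|u_n|\ \text{ for all } n,\qquad |u_n(x_n^i)|\to+\infty,\qquad\text{for all } i.$$ Moreover, there is a constant $C>0$ such that, for all $n$ and all $x\in\mathcal G$, $$|u_n(x)|\le C\lambda_n^{1/(p-2)}\exp\Big(-\tfrac12\lambda_n^{1/2}\min_{1\le i\le m}\operatorname{dist}(x,x_n^i)\Big).$$ Finally, for every $q\ge1$, the function $|u_n|^q$ is integrable on $\mathcal G$ for all $n$, and $$\lim_{n\to\infty}\lambda_n^{\frac12-\frac q{p-2}}\int_{\mathcal G}|u_n|^q\,dx\quad\text{exists and belongs to }(0,+\infty).$$ -/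

import Mathlib

open Filter Topology MeasureTheory
open scoped ENNReal ContDiff

noncomputable section

/-- A metric graph with vertex set `V` and edge set `E`: every edge `e` has a length `len e` in
`(0, ∞]`.  It is identified with the closed interval `[0, len e]` if `len e` is finite and with the
half-line `[0, ∞)` otherwise.  The endpoint with coordinate `0` is glued to the vertex `init e`; if
`len e` is finite, the endpoint with coordinate `len e` is glued to the vertex `term e _`.
Loops and multiple edges are allowed. -/
structure MetricGraph (V E : Type*) where
  len : E → ℝ≥0∞
  len_pos : ∀ e, 0 < len e
  init : E → V
  term : ∀ e, len e ≠ ⊤ → V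

namespace MetricGraph

variable {V E : Type*} (G : MetricGraph V E)

/-- The points of the metric graph: the vertices, and the interior points of the edges. -/
inductive Point (G : MetricGraph V E) : Type _
  | vertex (v : V) : Point G
  | interior (e : E) (t : ℝ) (pos : 0 < t) (lt : ENNReal.ofReal t < G.len e) : Point G

/-- The closed interval `[0, len e]`, or `[0, ∞)` if `len e = ∞`. -/
def closedEdge (e : E) : Set ℝ := {t | 0 ≤ t ∧ ENNReal.ofReal t ≤ G.len e}

/-- The open interval `(0, len e)`. -/
def openEdge (e : E) : Set ℝ := {t | 0 < t ∧ ENNReal.ofReal t < G.len e}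

open scoped Classical in
/-- The point of the graph with coordinate `t` on the edge `e`.  For convenience it is defined for
all real `t`, by projecting `t` onto the interval of `e`. -/
def coord (e : E) (t : ℝ) : G.Point :=
  if h0 : 0 < t then
    if h1 : ENNReal.ofReal t < G.len e then .interior e t h0 h1
    else .vertex (G.term e (ne_top_of_le_ne_top ENNReal.ofReal_ne_top (not_lt.mp h1)))
  else .vertex (G.init e)

/-- The restriction `u_e` of a function on the graph to the edge `e`, in the coordinate of `e`. -/
def restr (u : G.Point → ℝ) (e : E) : ℝ → ℝ := fun t => u (G.coord e t)

/-- The topology of the graph: the quotient topology, i.e. the finest one making all the edge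
parametrizations continuous. -/
instance : TopologicalSpace G.Point :=
  ⨆ e, TopologicalSpace.coinduced (G.coord e) inferInstance

/-- `G.IsPath x y L`: there is a path of length `L` from `x` to `y`, made of finitely many segments,
each contained in one edge. -/
inductive IsPath : G.Point → G.Point → ℝ → Prop
  | nil (x : G.Point) : IsPath x x 0
  | cons {e : E} {s t : ℝ} {y : G.Point} {L : ℝ}
      (hs : s ∈ G.closedEdge e) (ht : t ∈ G.closedEdge e) (h : IsPath (G.coord e t) y L) :
      IsPath (G.coord e s) y (|s - t| + L)

/-- The graph is connected: any two points are joined by a path. -/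
def Connected : Prop := ∀ x y : G.Point, ∃ L, G.IsPath x y L

/-- The shortest path distance. -/
instance : Dist G.Point := ⟨fun x y => sInf {L | G.IsPath x y L}⟩

/-- `g` is a weak derivative of `f` on the open set `Ω ⊆ ℝ`. -/
def HasWeakDeriv (Ω : Set ℝ) (f g : ℝ → ℝ) : Prop :=
  ∀ φ : ℝ → ℝ, ContDiff ℝ ∞ φ → HasCompactSupport φ → tsupport φ ⊆ Ω →
    ∫ t in Ω, f t * deriv φ t = - ∫ t in Ω, g t * φ t

/-- `g` is an `L²` weak derivative of `u` on the edge `e`. -/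
def IsEdgeDeriv (u : G.Point → ℝ) (e : E) (g : ℝ → ℝ) : Prop :=
  MemLp g 2 (volume.restrict (G.openEdge e)) ∧ HasWeakDeriv (G.openEdge e) (G.restr u e) g

/-- `u ∈ H¹(G)` (for a graph with finitely many edges): `u` is continuous on the graph and
`u_e ∈ H¹(0, len e)` for every edge `e`. -/
def MemH1 (u : G.Point → ℝ) : Prop :=
  Continuous u ∧ ∀ e, MemLp (G.restr u e) 2 (volume.restrict (G.openEdge e)) ∧
    ∃ g, G.IsEdgeDeriv u e g

/-- `u ∈ H¹(G) ∩ C_c(G)`. -/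
def MemH1c (u : G.Point → ℝ) : Prop := G.MemH1 u ∧ HasCompactSupport u

open scoped Classical in
/-- The `L²` weak derivative `u'` on the edge `e`; it is unique up to null sets.  (The value is `0`
if there is no such derivative.) -/
def weakDeriv (u : G.Point → ℝ) (e : E) : ℝ → ℝ :=
  if h : ∃ g, G.IsEdgeDeriv u e g then h.choose else 0

/-- The integral over the graph of a function given edge by edge. -/
def integral [Fintype E] (f : E → ℝ → ℝ) : ℝ := ∑ e, ∫ t in G.openEdge e, f e t

/-- `u ∈ H¹(G)` is a (weak) solution of `-u'' + W u = ρ |u|^(p-2) u` on every edge, with the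
Kirchhoff condition at every vertex. -/
def IsSolution [Fintype E] (p : ℝ) (W ρ u : G.Point → ℝ) : Prop :=
  G.MemH1 u ∧ ∀ φ, G.MemH1c φ →
    G.integral (fun e t => G.weakDeriv u e t * G.weakDeriv φ e t
      + G.restr W e t * G.restr u e t * G.restr φ e t)
    = G.integral (fun e t =>
        G.restr ρ e t * |G.restr u e t| ^ (p - 2) * G.restr u e t * G.restr φ e t)

/-- The quadratic form of the linearization of the equation at `u`. -/
def quadForm [Fintype E] (p : ℝ) (W ρ u φ : G.Point → ℝ) : ℝ :=
  G.integral (fun e t => (G.weakDeriv φ e t) ^ 2 + G.restr W e t * (G.restr φ e t) ^ 2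
    - (p - 1) * G.restr ρ e t * |G.restr u e t| ^ (p - 2) * (G.restr φ e t) ^ 2)

/-- The Morse index of `u`: the largest dimension of a subspace of `H¹(G) ∩ C_c(G)` on which the
quadratic form is negative definite, or `∞` if there is no largest one. -/
def morseIndex [Fintype E] (p : ℝ) (W ρ u : G.Point → ℝ) : ℕ∞ :=
  ⨆ (X : Submodule ℝ (G.Point → ℝ)) (_ : FiniteDimensional ℝ X ∧
      (∀ φ ∈ X, G.MemH1c φ) ∧ ∀ φ ∈ X, φ ≠ 0 → G.quadForm p W ρ u φ < 0),
    (Module.finrank ℝ X : ℕ∞)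

/-- Hypothesis (H) on the measurable potentials `W n` and `ρ n`. -/
def HypH (W ρ : ℕ → G.Point → ℝ) : Prop :=
  (∀ n e, AEMeasurable (G.restr (W n) e) (volume.restrict (G.openEdge e))) ∧
  (∀ n e, AEMeasurable (G.restr (ρ n) e) (volume.restrict (G.openEdge e))) ∧
  (∃ Wbar : ℝ, ∀ n e, ∀ᵐ t ∂volume.restrict (G.openEdge e), |G.restr (W n) e t| ≤ Wbar) ∧
  ∃ b : ℝ, 0 < b ∧
    (∀ n e, ∀ᵐ t ∂volume.restrict (G.openEdge e),
      0 ≤ G.restr (ρ n) e t ∧ G.restr (ρ n) e t ≤ b) ∧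
    ∃ a : ℝ, 0 < a ∧ a < b ∧ ∀ e,
      (∀ n, ∀ᵐ t ∂volume.restrict (G.openEdge e), a ≤ G.restr (ρ n) e t) ∨
      (∀ n, ∀ᵐ t ∂volume.restrict (G.openEdge e), G.restr (ρ n) e t = 0)

end MetricGraph

end

/-! Put k = √λ and μ = λ^(1/(p-2)), so that μ^(p-2) = k²: 1/k and μ are the natural length and
amplitude of the equation. No limit profile is extracted; the proof is quantitative and rests on
three tools. Testing with `u η²`, for a Lipschitz cutoff η, gives ∫ |(uη)'|² + (W+λ)(uη)² = A + T
and Q(uη) = A - (p-2) T, where Q is the linearized form, A = ∫ u² η'² and T = ∫ ρ |u|^(p-2) (uη)²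
(`form_mul_cutoff`, `quadForm_mul_cutoff`). The inequality k φ(x)² ≤ 2 ∫ (|φ'|² + k² φ²) turns
energy into pointwise bounds as soon as all edges are longer than 1/k (`MemH1.sobolev`). Functions
with disjoint supports and negative Q add up in the Morse index (`le_morseIndex`).

Amplitude. On an edge with ρ ≥ a, the rescaled equation is v'' = θv - r|v|^(p-2)v with bounded
measurable θ, r. A very large maximum would make v oscillate many times within bounded time
(`Osc.exists_many_zeros`); u restricted to a nodal interval has Q < 0, so the Morse index bounds |u|
by Aμ there (`exists_bound_of_morseIndex_le`). On edges with ρ = 0 the nonlinearity is absent, and a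
slowly decaying cutoff propagates the bound, so |u| ≤ M₀ μ everywhere (`exists_amplitude_bound`).

Concentration. Fix δ₀ with b δ₀^(p-2) = 1/8. Around any point where |u| ≥ δ₀ μ, a truncated
exponential cutoff at scale 1/k gives Q(uη) < 0 (`exists_unstable`). Hence at most m* such points
can be far apart at scale 1/k, and the set {|u| ≥ δ₀ μ} is covered by m* balls of radius O(1/k). A
cover with the fewest balls along a subsequence has centers that drift apart (`exists_clusters`);
maximizing |u| in each ball produces the x_n^i (`exists_concentration_points`).

Decay. Off those balls the nonlinear coefficient is at most k²/8, so the Agmon weight exp(k dist/2)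
yields the exponential bound (`sq_mul_exp_le`). With no ball at all the same estimate would force u
= 0, which is why m ≥ 1.

Integrals. With v = |u|/(M₀ μ) ∈ [0,1], the quantities J_n(q) = k ∫ v^q are bounded and Lipschitz in
q ≥ 1 uniformly in n, so one subsequence converges for all q at once
(`exists_subseq_tendsto_of_lipschitz`). The limits are positive because a value δ₀ μ carries a
definite L^q mass (`exists_le_integral_rpow`). -/

noncomputable section

namespace MetricGraph

variable {V E : Type*} {G : MetricGraph V E}

/-! ### The shortest path distance -/

theorem IsPath.nonneg {x y : G.Point} {L : ℝ} (h : G.IsPath x y L) : 0 ≤ L := by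
  induction h with
  | nil => exact le_rfl
  | cons _ _ _ ih => positivity

theorem IsPath.trans {x y z : G.Point} {L L' : ℝ} (h : G.IsPath x y L) (h' : G.IsPath y z L') :
    G.IsPath x z (L + L') := by
  induction h with
  | nil => simpa using h'
  | cons hs ht _ ih =>
    rw [add_assoc]
    exact .cons hs ht (ih h')

theorem isPath_segment {e : E} {s t : ℝ} (hs : s ∈ G.closedEdge e) (ht : t ∈ G.closedEdge e) :
    G.IsPath (G.coord e s) (G.coord e t) |s - t| := by
  simpa using IsPath.cons hs ht (.nil _)

theorem IsPath.symm {x y : G.Point} {L : ℝ} (h : G.IsPath x y L) : G.IsPath y x L := by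
  induction h with
  | nil => exact .nil _
  | cons hs ht _ ih =>
    rw [add_comm, abs_sub_comm]
    exact ih.trans (isPath_segment ht hs)

theorem dist_def (x y : G.Point) : dist x y = sInf {L | G.IsPath x y L} := rfl

theorem dist_le_of_isPath {x y : G.Point} {L : ℝ} (h : G.IsPath x y L) : dist x y ≤ L :=
  csInf_le ⟨0, fun _ h => h.nonneg⟩ h

theorem pdist_nonneg (x y : G.Point) : 0 ≤ dist x y :=
  Real.sInf_nonneg fun _ h => IsPath.nonneg h

theorem pdist_self (x : G.Point) : dist x x = 0 :=
  le_antisymm (dist_le_of_isPath (.nil x)) (pdist_nonneg x x)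

theorem pdist_comm (x y : G.Point) : dist x y = dist y x := by
  simp only [dist_def]
  congr 1
  ext L
  exact ⟨IsPath.symm, IsPath.symm⟩

theorem exists_isPath_lt (hG : G.Connected) (x y : G.Point) {r : ℝ} (h : dist x y < r) :
    ∃ L, G.IsPath x y L ∧ L < r := by
  obtain ⟨L, hL, hlt⟩ := exists_lt_of_csInf_lt (hG x y) h
  exact ⟨L, hL, hlt⟩

theorem pdist_triangle (hG : G.Connected) (x y z : G.Point) :
    dist x z ≤ dist x y + dist y z := by
  refine le_of_forall_pos_le_add fun ε hε => ?_
  obtain ⟨L, hL, h1⟩ := exists_isPath_lt hG x y (lt_add_of_pos_right (dist x y) (half_pos hε))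
  obtain ⟨L', hL', h2⟩ := exists_isPath_lt hG y z (lt_add_of_pos_right (dist y z) (half_pos hε))
  linarith [dist_le_of_isPath (hL.trans hL')]

/-! ### The edge parametrizations -/

variable (G) in
open scoped Classical in
/-- The projection of `ℝ` onto the closed interval of an edge. -/
def clamp (e : E) (t : ℝ) : ℝ :=
  if G.len e = ⊤ then max t 0 else min (max t 0) (G.len e).toReal

theorem toReal_len_pos {e : E} (h : G.len e ≠ ⊤) : 0 < (G.len e).toReal :=
  ENNReal.toReal_pos (G.len_pos e).ne' h

theorem mem_closedEdge_iff {e : E} (h : G.len e ≠ ⊤) {t : ℝ} :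
    t ∈ G.closedEdge e ↔ 0 ≤ t ∧ t ≤ (G.len e).toReal := by
  simp only [closedEdge, Set.mem_ofPred_eq]
  rw [ENNReal.ofReal_le_iff_le_toReal h]

theorem mem_closedEdge_iff_of_top {e : E} (h : G.len e = ⊤) {t : ℝ} :
    t ∈ G.closedEdge e ↔ 0 ≤ t := by
  simp [closedEdge, h]

theorem mem_openEdge_iff {e : E} (h : G.len e ≠ ⊤) {t : ℝ} :
    t ∈ G.openEdge e ↔ 0 < t ∧ t < (G.len e).toReal := by
  simp only [openEdge, Set.mem_ofPred_eq]
  refine and_congr_right fun h0 => ?_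
  rw [← ENNReal.ofReal_lt_ofReal_iff_of_nonneg h0.le, ENNReal.ofReal_toReal h]

theorem mem_openEdge_iff_of_top {e : E} (h : G.len e = ⊤) {t : ℝ} :
    t ∈ G.openEdge e ↔ 0 < t := by
  simp [openEdge, h]

theorem openEdge_eq {e : E} (h : G.len e ≠ ⊤) : G.openEdge e = Set.Ioo 0 (G.len e).toReal := by
  ext t; rw [mem_openEdge_iff h]; rfl

theorem closedEdge_eq {e : E} (h : G.len e ≠ ⊤) : G.closedEdge e = Set.Icc 0 (G.len e).toReal := by
  ext t; rw [mem_closedEdge_iff h]; rfl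

theorem openEdge_eq_of_top {e : E} (h : G.len e = ⊤) : G.openEdge e = Set.Ioi 0 := by
  ext t; rw [mem_openEdge_iff_of_top h]; rfl

theorem closedEdge_eq_of_top {e : E} (h : G.len e = ⊤) : G.closedEdge e = Set.Ici 0 := by
  ext t; rw [mem_closedEdge_iff_of_top h]; rfl

theorem isOpen_openEdge (e : E) : IsOpen (G.openEdge e) := by
  by_cases h : G.len e = ⊤
  · rw [openEdge_eq_of_top h]; exact isOpen_Ioi
  · rw [openEdge_eq h]; exact isOpen_Ioo

theorem isClosed_closedEdge (e : E) : IsClosed (G.closedEdge e) := by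
  by_cases h : G.len e = ⊤
  · rw [closedEdge_eq_of_top h]; exact isClosed_Ici
  · rw [closedEdge_eq h]; exact isClosed_Icc

theorem measurableSet_openEdge (e : E) : MeasurableSet (G.openEdge e) :=
  (isOpen_openEdge e).measurableSet

theorem ordConnected_openEdge (e : E) : (G.openEdge e).OrdConnected := by
  by_cases h : G.len e = ⊤
  · rw [openEdge_eq_of_top h]; exact Set.ordConnected_Ioi
  · rw [openEdge_eq h]; exact Set.ordConnected_Ioo

theorem ordConnected_closedEdge (e : E) : (G.closedEdge e).OrdConnected := by
  by_cases h : G.len e = ⊤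
  · rw [closedEdge_eq_of_top h]; exact Set.ordConnected_Ici
  · rw [closedEdge_eq h]; exact Set.ordConnected_Icc

theorem openEdge_subset_closedEdge (e : E) : G.openEdge e ⊆ G.closedEdge e :=
  fun _ h => ⟨h.1.le, h.2.le⟩

theorem zero_mem_closedEdge (e : E) : (0 : ℝ) ∈ G.closedEdge e := by simp [closedEdge]

theorem Ioo_subset_openEdge {e : E} {s t : ℝ} (hs : s ∈ G.closedEdge e) (ht : t ∈ G.closedEdge e) :
    Set.Ioo s t ⊆ G.openEdge e := by
  intro r hr
  refine ⟨hs.1.trans_lt hr.1, lt_of_lt_of_le ?_ ht.2⟩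
  exact (ENNReal.ofReal_lt_ofReal_iff (hs.1.trans_lt (hr.1.trans hr.2))).2 hr.2

theorem clamp_mem (e : E) (t : ℝ) : G.clamp e t ∈ G.closedEdge e := by
  unfold clamp
  split_ifs with h
  · rw [mem_closedEdge_iff_of_top h]; exact le_max_right _ _
  · rw [mem_closedEdge_iff h]
    exact ⟨le_min (le_max_right _ _) ENNReal.toReal_nonneg, min_le_right _ _⟩

theorem clamp_of_mem {e : E} {t : ℝ} (ht : t ∈ G.closedEdge e) : G.clamp e t = t := by
  unfold clamp
  split_ifs with h
  · rw [mem_closedEdge_iff_of_top h] at ht; exact max_eq_left ht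
  · rw [mem_closedEdge_iff h] at ht; rw [max_eq_left ht.1, min_eq_left ht.2]

theorem abs_clamp_sub_le (e : E) (s t : ℝ) : |G.clamp e s - G.clamp e t| ≤ |s - t| := by
  have h1 : |max s 0 - max t 0| ≤ |s - t| := abs_max_sub_max_le_abs s t 0
  unfold clamp
  split_ifs with h
  · exact h1
  · refine le_trans ?_ h1
    simpa using abs_min_sub_min_le_max (max s 0) (G.len e).toReal (max t 0) (G.len e).toReal

theorem coord_of_nonpos {e : E} {t : ℝ} (h : t ≤ 0) : G.coord e t = .vertex (G.init e) := by
  simp [coord, not_lt.2 h]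

theorem coord_of_mem {e : E} {t : ℝ} (h : t ∈ G.openEdge e) :
    G.coord e t = .interior e t h.1 h.2 := by
  rw [coord, dif_pos h.1, dif_pos h.2]

theorem coord_of_le {e : E} (hl : G.len e ≠ ⊤) {t : ℝ} (h : (G.len e).toReal ≤ t) :
    G.coord e t = .vertex (G.term e hl) := by
  rw [coord, dif_pos ((toReal_len_pos hl).trans_le h), dif_neg]
  rw [not_lt]
  exact ENNReal.le_ofReal_iff_toReal_le hl ((toReal_len_pos hl).le.trans h) |>.2 h

theorem coord_clamp (e : E) (t : ℝ) : G.coord e (G.clamp e t) = G.coord e t := by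
  by_cases h : t ∈ G.closedEdge e
  · rw [clamp_of_mem h]
  by_cases h0 : t ≤ 0
  · have : G.clamp e t = 0 := by
      unfold clamp
      split_ifs
      · exact max_eq_right h0
      · rw [max_eq_right h0, min_eq_left ENNReal.toReal_nonneg]
    rw [this, coord_of_nonpos le_rfl, coord_of_nonpos h0]
  · push Not at h0
    have hl : G.len e ≠ ⊤ := fun hl => h ((mem_closedEdge_iff_of_top hl).2 h0.le)
    have h1 : (G.len e).toReal ≤ t := by
      by_contra hc
      exact h ((mem_closedEdge_iff hl).2 ⟨h0.le, (not_le.1 hc).le⟩)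
    have : G.clamp e t = (G.len e).toReal := by
      unfold clamp
      rw [if_neg hl, max_eq_left h0.le, min_eq_right h1]
    rw [this, coord_of_le hl le_rfl, coord_of_le hl h1]

theorem dist_coord_le (e : E) (s t : ℝ) : dist (G.coord e s) (G.coord e t) ≤ |s - t| := by
  rw [← coord_clamp e s, ← coord_clamp e t]
  exact (dist_le_of_isPath (isPath_segment (clamp_mem e s) (clamp_mem e t))).trans
    (abs_clamp_sub_le e s t)

theorem abs_dist_coord_sub_le (hG : G.Connected) (e : E) (x : G.Point) (s t : ℝ) :
    |dist (G.coord e s) x - dist (G.coord e t) x| ≤ |s - t| := by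
  have h := dist_coord_le (G := G) e s t
  rw [abs_le]
  constructor
  · linarith [pdist_triangle hG (G.coord e t) (G.coord e s) x,
      pdist_comm (G.coord e t) (G.coord e s)]
  · linarith [pdist_triangle hG (G.coord e s) (G.coord e t) x]

theorem exists_mem_openEdge (e : E) : ∃ t, t ∈ G.openEdge e := by
  by_cases h : G.len e = ⊤
  · exact ⟨1, (mem_openEdge_iff_of_top h).2 one_pos⟩
  · exact ⟨_, (mem_openEdge_iff h).2 ⟨half_pos (toReal_len_pos h), half_lt_self (toReal_len_pos h)⟩⟩

/-- Connectedness excludes isolated vertices: a path from a vertex to an interior point is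
nontrivial, so it begins on an edge. -/
theorem exists_coord_eq [Nonempty E] (hG : G.Connected) (x : G.Point) :
    ∃ e, ∃ t ∈ G.closedEdge e, G.coord e t = x := by
  cases x with
  | interior e t h0 h1 =>
    exact ⟨e, t, ⟨h0.le, h1.le⟩, coord_of_mem ⟨h0, h1⟩⟩
  | vertex v =>
    obtain ⟨e⟩ := ‹Nonempty E›
    obtain ⟨t, ht⟩ := exists_mem_openEdge (G := G) e
    obtain ⟨L, hL⟩ := hG (.vertex v) (G.coord e t)
    have key : ∀ {x y : G.Point} {L : ℝ}, G.IsPath x y L → x ≠ y →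
        ∃ e, ∃ t ∈ G.closedEdge e, G.coord e t = x := by
      intro x y L h hne
      cases h with
      | nil => exact absurd rfl hne
      | cons hs _ _ => exact ⟨_, _, hs, rfl⟩
    refine key hL ?_
    rw [coord_of_mem ht]
    simp

theorem coord_eq_coord {e e' : E} {s t : ℝ} (ht : t ∈ G.openEdge e)
    (h : G.coord e' s = G.coord e t) : e' = e ∧ s = t := by
  rw [coord_of_mem ht] at h
  unfold coord at h
  split_ifs at h with h0 h1
  simpa using h

/-- Along an edge the distance to a given point is bounded below by the distance of the coordinate
to one of three numbers (the endpoints, and the coordinate of the point if it is on the edge). -/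
theorem exists_centers_le_dist (hG : G.Connected) (e : E) (x : G.Point) :
    ∃ c : Fin 3 → ℝ, ∀ t ∈ G.openEdge e, ∃ i, |t - c i| ≤ dist (G.coord e t) x := by
  classical
  obtain ⟨c, hc⟩ : ∃ c : ℝ, ∀ t ∈ G.openEdge e, G.coord e t = x → t = c := by
    by_cases h : ∃ t ∈ G.openEdge e, G.coord e t = x
    · obtain ⟨c, hc, rfl⟩ := h
      exact ⟨c, fun t ht h => (coord_eq_coord hc h).2⟩
    · exact ⟨0, fun t ht h' => absurd ⟨t, ht, h'⟩ h⟩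
  -- Induction along the path. If its first segment ends inside the edge, the inductive bound and
  -- the triangle inequality on the line apply; if it ends at an endpoint, that segment alone is
  -- long enough.
  have key : ∀ {y z : G.Point} {L : ℝ}, G.IsPath y z L → z = x → ∀ t ∈ G.openEdge e,
      G.coord e t = y → min |t - 0| (min |t - (G.len e).toReal| |t - c|) ≤ L := by
    intro y z L h
    induction h with
    | nil x' =>
      rintro rfl t ht h
      rw [hc t ht h]
      simp
    | @cons e' s t' y L hs ht' hp ih =>
      rintro rfl t ht h
      obtain ⟨rfl, rfl⟩ := coord_eq_coord ht h.symm
      by_cases h' : t' ∈ G.openEdge e'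
      · have := ih rfl t' h' rfl
        have h0 := abs_sub_abs_le_abs_sub (s - 0) (t' - 0)
        have h1 := abs_sub_abs_le_abs_sub (s - (G.len e').toReal) (t' - (G.len e').toReal)
        have h2 := abs_sub_abs_le_abs_sub (s - c) (t' - c)
        simp only [sub_sub_sub_cancel_right] at h0 h1 h2
        rcases min_le_iff.1 this with h | h
        · exact min_le_iff.2 (Or.inl (by linarith))
        rcases min_le_iff.1 h with h | h
        · exact min_le_iff.2 (Or.inr (min_le_iff.2 (Or.inl (by linarith))))
        · exact min_le_iff.2 (Or.inr (min_le_iff.2 (Or.inr (by linarith))))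
      · have hL := hp.nonneg
        by_cases hl : G.len e' = ⊤
        · rw [mem_closedEdge_iff_of_top hl] at ht'
          rw [mem_openEdge_iff_of_top hl] at h'
          have : t' = 0 := by linarith
          subst this
          exact min_le_iff.2 (Or.inl (by linarith))
        · rw [mem_closedEdge_iff hl] at ht'
          rw [mem_openEdge_iff hl] at h'
          rcases ht'.1.eq_or_lt with h0 | h0
          · subst h0
            exact min_le_iff.2 (Or.inl (by linarith))
          · have : t' = (G.len e').toReal := by
              by_contra hne
              exact h' ⟨h0, lt_of_le_of_ne ht'.2 hne⟩
            subst this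
            exact min_le_iff.2 (Or.inr (min_le_iff.2 (Or.inl (by linarith))))
  -- On a half-line `toReal` of the length is 0, so the second center merely repeats the first.
  refine ⟨![0, (G.len e).toReal, c], fun t ht => ?_⟩
  have : min |t - 0| (min |t - (G.len e).toReal| |t - c|) ≤ dist (G.coord e t) x :=
    le_csInf (hG _ _) fun L hL => key hL rfl t ht rfl
  rcases min_le_iff.1 this with h | h
  · exact ⟨0, h⟩
  rcases min_le_iff.1 h with h | h
  · exact ⟨1, h⟩
  · exact ⟨2, h⟩

/-! ### Topology -/

theorem continuous_coord (e : E) : Continuous (G.coord e) :=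
  continuous_iff_coinduced_le.2 (le_iSup (fun e => TopologicalSpace.coinduced (G.coord e) _) e)

theorem continuous_iff_restr {u : G.Point → ℝ} : Continuous u ↔ ∀ e, Continuous (G.restr u e) := by
  rw [continuous_iSup_dom]
  exact forall_congr' fun e => continuous_coinduced_dom

theorem isClosed_iff_preimage_coord {K : Set G.Point} :
    IsClosed K ↔ ∀ e, IsClosed (G.coord e ⁻¹' K) := by
  rw [isClosed_iSup_iff]
  exact forall_congr' fun e => isClosed_coinduced

/-- The topology is the quotient one, so compactness comes edge by edge: the part of the ball on an
edge is closed and lies within bounded distance of finitely many numbers, and there are finitely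
many edges. This gives compact supports to cutoffs depending on the distance, even with half-lines.
-/
theorem isCompact_closedBall [Finite E] [Nonempty E] (hG : G.Connected) (x : G.Point) (r : ℝ) :
    IsCompact {y : G.Point | dist y x ≤ r} := by
  have hb : ∀ e, IsCompact (G.closedEdge e ∩ {t | dist (G.coord e t) x ≤ r}) := by
    intro e
    obtain ⟨c, hc⟩ := exists_centers_le_dist hG e x
    have hcont : Continuous fun t => dist (G.coord e t) x := by
      refine 
    (LipschitzWith.of_dist_le_mul (K := 1) fun s t => ?_).continuous
      simpa [Real.dist_eq] using abs_dist_coord_sub_le hG e x s t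
    refine Metric.isCompact_of_isClosed_isBounded
      ((isClosed_closedEdge e).inter (isClosed_le hcont continuous_const)) ?_
    have : G.closedEdge e ∩ {t | dist (G.coord e t) x ≤ r} ⊆
        {0, (G.len e).toReal} ∪ ⋃ i, Metric.closedBall (c i) r := by
      rintro t ⟨ht, htr⟩
      by_cases h : t ∈ G.openEdge e
      · obtain ⟨i, hi⟩ := hc t h
        exact Or.inr (Set.mem_iUnion.2 ⟨i, hi.trans htr⟩)
      · left
        by_cases hl : G.len e = ⊤
        · rw [mem_closedEdge_iff_of_top hl] at ht
          rw [mem_openEdge_iff_of_top hl] at h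
          left; linarith
        · rw [mem_closedEdge_iff hl] at ht
          rw [mem_openEdge_iff hl] at h
          rcases ht.1.eq_or_lt with h0 | h0
          · left; exact h0.symm
          · right
            by_contra hne
            exact h ⟨h0, lt_of_le_of_ne ht.2 hne⟩
    refine Bornology.IsBounded.subset ?_ this
    refine Bornology.IsBounded.union (Set.toFinite _).isBounded ?_
    exact Bornology.isBounded_iUnion.2 fun i => Metric.isBounded_closedBall
  have : {y : G.Point | dist y x ≤ r} =
      ⋃ e, G.coord e '' (G.closedEdge e ∩ {t | dist (G.coord e t) x ≤ r}) := by
    ext y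
    simp only [Set.mem_ofPred_eq, Set.mem_iUnion, Set.mem_image, Set.mem_inter_iff]
    constructor
    · intro hy
      obtain ⟨e, t, ht, rfl⟩ := exists_coord_eq hG y
      exact ⟨e, t, ⟨ht, hy⟩, rfl⟩
    · rintro ⟨e, t, ⟨_, h⟩, rfl⟩
      exact h
  rw [this]
  exact isCompact_iUnion fun e => (hb e).image (continuous_coord e)

theorem continuous_dist_left (hG : G.Connected) (x : G.Point) :
    Continuous fun y : G.Point => dist y x := by
  refine continuous_iff_restr.2 fun e =>
    (LipschitzWith.of_dist_le_mul (K := 1) fun s t => ?_).continuous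
  simpa [Real.dist_eq, restr] using abs_dist_coord_sub_le hG e x s t

theorem isClosed_closedBall (hG : G.Connected) (x : G.Point) (r : ℝ) :
    IsClosed {y : G.Point | dist y x ≤ r} :=
  isClosed_le (continuous_dist_left hG x) continuous_const

theorem hasCompactSupport_of_dist [Finite E] [Nonempty E] (hG : G.Connected) (x : G.Point) (r : ℝ)
    {φ : G.Point → ℝ} (h : ∀ y, r < dist y x → φ y = 0) : HasCompactSupport φ :=
  HasCompactSupport.intro' (isCompact_closedBall hG x r) (isClosed_closedBall hG x r)
    fun y hy => h y (not_le.1 hy)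

/-! ### Exponential weights -/

theorem integrable_exp_neg_abs_sub {κ : ℝ} (hκ : 0 < κ) (c : ℝ) :
    Integrable (fun t : ℝ => Real.exp (-κ * |t - c|)) ∧
      ∫ t : ℝ, Real.exp (-κ * |t - c|) = 2 / κ := by
  have h1 : IntegrableOn (fun t : ℝ => Real.exp (-κ * |t|)) (Set.Ioi 0) := by
    refine (integrableOn_exp_mul_Ioi (a := -κ) (by linarith) 0).congr_fun (fun t ht => ?_)
      measurableSet_Ioi
    simp only [abs_of_pos (Set.mem_Ioi.1 ht)]
  have h2 : Integrable fun t : ℝ => Real.exp (-κ * |t|) := by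
    rw [← integrableOn_univ, ← Set.Iic_union_Ioi (a := (0:ℝ))]
    refine IntegrableOn.union ?_ h1
    have := h1.comp_neg
    simpa [integrableOn_Iic_iff_integrableOn_Iio] using this
  have h3 : ∫ t : ℝ, Real.exp (-κ * |t|) = 2 / κ := by
    rw [integral_comp_abs (f := fun t => Real.exp (-κ * t)), integral_exp_mul_Ioi (by linarith)]
    simp; ring
  exact ⟨h2.comp_sub_right c, by rw [integral_sub_right_eq_self (fun t => Real.exp (-κ * |t|)), h3]⟩

/-- The distance dominates |t - c i| for one of three centers, so the weight is at most a sum of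
three exponentials on the line, each of integral 2/κ. -/
theorem exp_dist_bound (hG : G.Connected) (e : E) (x : G.Point) {κ : ℝ} (hκ : 0 < κ) :
    IntegrableOn (fun t => Real.exp (-κ * dist (G.coord e t) x)) (G.openEdge e) ∧
      ∫ t in G.openEdge e, Real.exp (-κ * dist (G.coord e t) x) ≤ 6 / κ := by
  obtain ⟨c, hc⟩ := exists_centers_le_dist hG e x
  have hint : Integrable fun t : ℝ => ∑ i, Real.exp (-κ * |t - c i|) :=
    integrable_finsetSum _ fun i _ => (integrable_exp_neg_abs_sub hκ (c i)).1
  have hle : ∀ t ∈ G.openEdge e,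
      Real.exp (-κ * dist (G.coord e t) x) ≤ ∑ i, Real.exp (-κ * |t - c i|) := by
    intro t ht
    obtain ⟨i, hi⟩ := hc t ht
    refine le_trans ?_ (Finset.single_le_sum (f := fun i => Real.exp (-κ * |t - c i|))
      (fun i _ => (Real.exp_pos _).le) (Finset.mem_univ i))
    exact Real.exp_le_exp.2 (by nlinarith)
  have hcont : Continuous fun t => Real.exp (-κ * dist (G.coord e t) x) := by
    have := (continuous_dist_left hG x).comp (continuous_coord (G := G) e)
    exact Real.continuous_exp.comp (continuous_const.mul this)
  have hI : IntegrableOn (fun t => Real.exp (-κ * dist (G.coord e t) x)) (G.openEdge e) := by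
    refine hint.integrableOn.mono' hcont.aestronglyMeasurable ?_
    filter_upwards [ae_restrict_mem (measurableSet_openEdge e)] with t ht
    rw [Real.norm_of_nonneg (Real.exp_pos _).le]
    exact hle t ht
  refine ⟨hI, ?_⟩
  calc ∫ t in G.openEdge e, Real.exp (-κ * dist (G.coord e t) x)
      ≤ ∫ t in G.openEdge e, ∑ i, Real.exp (-κ * |t - c i|) :=
        setIntegral_mono_on hI hint.integrableOn (measurableSet_openEdge e) hle
    _ ≤ ∫ t, ∑ i, Real.exp (-κ * |t - c i|) :=
        setIntegral_le_integral hint (Eventually.of_forall fun t =>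
          Finset.sum_nonneg fun i _ => (Real.exp_pos _).le)
    _ = ∑ i : Fin 3, 2 / κ := by
        rw [integral_finsetSum _ fun i _ => (integrable_exp_neg_abs_sub hκ (c i)).1]
        exact Finset.sum_congr rfl fun i _ => (integrable_exp_neg_abs_sub hκ (c i)).2
    _ = 6 / κ := by simp; ring

end MetricGraph

/-! ### Locally absolutely continuous functions on the line -/

/-- `f` is absolutely continuous on every compact interval. -/
def LocAC (f : ℝ → ℝ) : Prop := ∀ a b, AbsolutelyContinuousOnInterval f a b

namespace LocAC

variable {f g : ℝ → ℝ}

theorem continuous (hf : LocAC f) : Continuous f := by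
  refine continuous_iff_continuousAt.2 fun t => ?_
  refine ((hf (t - 1) (t + 1)).continuousOn.continuousAt ?_)
  rw [Set.uIcc_of_le (by linarith)]
  exact Icc_mem_nhds (by linarith) (by linarith)

theorem ae_differentiableAt (hf : LocAC f) : ∀ᵐ t : ℝ, DifferentiableAt ℝ f t := by
  have : ∀ n : ℕ, ∀ᵐ t : ℝ, t ∈ Set.uIcc (-(n : ℝ)) n → DifferentiableAt ℝ f t :=
    fun n => (hf _ _).ae_differentiableAt
  filter_upwards [ae_all_iff.2 this] with t ht
  obtain ⟨n, hn⟩ := exists_nat_ge |t|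
  refine ht n ?_
  rw [Set.uIcc_of_le (by linarith [abs_nonneg t])]
  exact abs_le.1 hn

theorem mul (hf : LocAC f) (hg : LocAC g) : LocAC fun t => f t * g t :=
  fun a b => (hf a b).fun_mul (hg a b)

theorem add (hf : LocAC f) (hg : LocAC g) : LocAC fun t => f t + g t :=
  fun a b => (hf a b).add (hg a b)

theorem const_mul (hf : LocAC f) (c : ℝ) : LocAC fun t => c * f t :=
  fun a b => (hf a b).const_mul c

theorem of_lipschitz {K : ℝ} (h : ∀ s t, |f s - f t| ≤ K * |s - t|) : LocAC f := by
  intro a b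
  have hK : LipschitzWith K.toNNReal f := by
    refine LipschitzWith.of_dist_le_mul fun s t => (h s t).trans ?_
    exact mul_le_mul_of_nonneg_right (Real.le_coe_toNNReal K) (abs_nonneg _)
  exact hK.lipschitzOnWith.absolutelyContinuousOnInterval

theorem of_contDiff (hf : ContDiff ℝ 1 f) : LocAC f :=
  fun _ _ => hf.contDiffOn.absolutelyContinuousOnInterval

theorem integral_deriv (hf : LocAC f) (a b : ℝ) : ∫ t in a..b, deriv f t = f b - f a :=
  (hf a b).integral_deriv_eq_sub

theorem intervalIntegrable_deriv (hf : LocAC f) (a b : ℝ) :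
    IntervalIntegrable (deriv f) volume a b :=
  (hf a b).intervalIntegrable_deriv

theorem primitive (hg : LocallyIntegrable g) (c : ℝ) : LocAC fun t => ∫ s in c..t, g s := by
  intro a b
  have hi : ∀ x y, IntervalIntegrable g volume x y := fun x y =>
    intervalIntegrable_iff.2 ((hg.integrableOn_isCompact isCompact_uIcc).mono_set
      Set.uIoc_subset_uIcc)
  have h := (hi (min c (min a b)) (max c (max a b))).absolutelyContinuousOnInterval_intervalIntegral
    (c := c) (Set.mem_uIcc_of_le (min_le_left _ _) (le_max_left _ _))
  refine h.mono ?_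
  rw [Set.uIcc_of_le ((min_le_left _ _).trans (le_max_left c (max a b)))]
  exact Set.Icc_subset_Icc (min_le_right _ _) (le_max_right _ _)

theorem deriv_primitive (hg : LocallyIntegrable g) (c : ℝ) :
    ∀ᵐ t : ℝ, deriv (fun t => ∫ s in c..t, g s) t = g t := by
  filter_upwards [LocallyIntegrable.ae_hasDerivAt_integral hg] with t ht
  exact (ht c).deriv

theorem deriv_mul (hf : LocAC f) (hg : LocAC g) :
    ∀ᵐ t : ℝ, deriv (fun t => f t * g t) t = deriv f t * g t + f t * deriv g t := by
  filter_upwards [hf.ae_differentiableAt, hg.ae_differentiableAt] with t h1 h2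
  exact (h1.hasDerivAt.mul h2.hasDerivAt).deriv

/-- Integration by parts against a compactly supported function. -/
theorem integral_mul_deriv (hf : LocAC f) (hg : LocAC g) (hc : HasCompactSupport g) :
    ∫ t, f t * deriv g t = - ∫ t, deriv f t * g t := by
  obtain ⟨r, hr⟩ := hc.isCompact.isBounded.subset_closedBall 0
  have hz : ∀ t, t ∉ Set.Ioc (-(|r| + 1)) (|r| + 1) → t ∉ tsupport g := by
    intro t ht h
    have := hr h
    rw [Metric.mem_closedBall, dist_zero_right, Real.norm_eq_abs] at this
    have h2 := abs_le.1 (this.trans (le_abs_self r))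
    exact ht ⟨by linarith, by linarith⟩
  have e1 : ∫ t, f t * deriv g t = ∫ t in -(|r| + 1)..(|r| + 1), f t * deriv g t := by
    rw [intervalIntegral.integral_of_le (by linarith [abs_nonneg r])]
    refine (setIntegral_eq_integral_of_forall_compl_eq_zero fun t ht => ?_).symm
    have : deriv g t = 0 := by
      by_contra h
      exact hz t ht (support_deriv_subset h)
    rw [this, mul_zero]
  have e2 : ∫ t, deriv f t * g t = ∫ t in -(|r| + 1)..(|r| + 1), deriv f t * g t := by
    rw [intervalIntegral.integral_of_le (by linarith [abs_nonneg r])]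
    refine (setIntegral_eq_integral_of_forall_compl_eq_zero fun t ht => ?_).symm
    rw [image_eq_zero_of_notMem_tsupport (hz t ht), mul_zero]
  have b1 : g (|r| + 1) = 0 := by
    refine image_eq_zero_of_notMem_tsupport fun h => ?_
    have := hr h
    rw [Metric.mem_closedBall, dist_zero_right, Real.norm_eq_abs] at this
    linarith [le_abs_self (|r| + 1), le_abs_self r]
  have b2 : g (-(|r| + 1)) = 0 :=
    image_eq_zero_of_notMem_tsupport (hz _ fun h => lt_irrefl _ h.1)
  rw [e1, e2, (hf _ _).integral_mul_deriv_eq_deriv_mul (hg _ _), b1, b2]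
  simp

end LocAC

/-- At every point the derivative is bounded by a continuous local Lipschitz bound. -/
theorem abs_deriv_le_of_local {f w : ℝ → ℝ} {t : ℝ} (hw : ContinuousAt w t) (h0 : 0 ≤ w t)
    (h : ∀ s, |f s - f t| ≤ w s * |s - t|) : |deriv f t| ≤ w t := by
  by_cases hd : DifferentiableAt ℝ f t
  · have h1 : Tendsto (fun s => |slope f t s|) (𝓝[≠] t) (𝓝 |deriv f t|) :=
      (hasDerivAt_iff_tendsto_slope.1 hd.hasDerivAt).abs
    have h2 : Tendsto w (𝓝[≠] t) (𝓝 (w t)) := hw.tendsto.mono_left nhdsWithin_le_nhds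
    refine le_of_tendsto_of_tendsto h1 h2 ?_
    filter_upwards [self_mem_nhdsWithin] with s hs
    have : 0 < |s - t| := abs_pos.2 (sub_ne_zero.2 hs)
    rw [slope_def_field, abs_div, div_le_iff₀ this]
    exact h s
  · rw [deriv_zero_of_not_differentiableAt hd, abs_zero]; exact h0

namespace MetricGraph

/-- A locally integrable function with a locally integrable weak derivative on an interval is
a.e. equal to a primitive of it. -/
theorem HasWeakDeriv.exists_primitive {Ω : Set ℝ} (hΩ : IsOpen Ω) (hc : Ω.OrdConnected) {t₀ : ℝ}
    (ht₀ : t₀ ∈ Ω) {f g : ℝ → ℝ} (hf : LocallyIntegrable (Ω.indicator f))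
    (hg : LocallyIntegrable (Ω.indicator g)) (h : HasWeakDeriv Ω f g) :
    ∃ c, ∀ᵐ t ∂volume.restrict Ω, f t = c + ∫ s in t₀..t, Ω.indicator g s := by
  set F : ℝ → ℝ := fun t => ∫ s in t₀..t, Ω.indicator g s with hF
  have hFac : LocAC F := LocAC.primitive hg t₀
  have hm := hΩ.measurableSet
  set d : ℝ → ℝ := fun t => Ω.indicator f t - F t with hd
  have hdl : LocallyIntegrable d := hf.sub hFac.continuous.locallyIntegrable
  have hdI : ∀ φ : ℝ → ℝ, Continuous φ → HasCompactSupport φ → Integrable fun t => d t * φ t := by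
    intro φ h1 h2
    simpa [mul_comm] using hdl.integrable_smul_left_of_hasCompactSupport h1 h2
  have key : ∀ φ : ℝ → ℝ, ContDiff ℝ ∞ φ → HasCompactSupport φ → tsupport φ ⊆ Ω →
      ∫ t, d t * deriv φ t = 0 := by
    intro φ h1 h2 h3
    have h4 := h φ h1 h2 h3
    have hdc : Continuous (deriv φ) := (h1.continuous_deriv (by simp))
    have e1 : ∫ t, Ω.indicator f t * deriv φ t = ∫ t in Ω, f t * deriv φ t := by
      rw [← integral_indicator hm]
      congr 1; ext t
      by_cases ht : t ∈ Ω <;> simp [ht]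
    have e2 : ∫ t, Ω.indicator g t * φ t = ∫ t in Ω, g t * φ t := by
      rw [← integral_indicator hm]
      congr 1; ext t
      by_cases ht : t ∈ Ω <;> simp [ht]
    have e3 : ∫ t, F t * deriv φ t = - ∫ t, Ω.indicator g t * φ t := by
      rw [hFac.integral_mul_deriv (LocAC.of_contDiff (h1.of_le (by simp))) h2]
      congr 1
      refine integral_congr_ae ?_
      filter_upwards [LocAC.deriv_primitive hg t₀] with t ht
      rw [hF, ht]
    have hi1 : Integrable fun t => Ω.indicator f t * deriv φ t := by
      simpa [mul_comm] using hf.integrable_smul_left_of_hasCompactSupport hdc h2.deriv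
    have hi2 : Integrable fun t => F t * deriv φ t := by
      simpa [mul_comm] using
        hFac.continuous.locallyIntegrable.integrable_smul_left_of_hasCompactSupport hdc h2.deriv
    simp only [hd, sub_mul]
    rw [integral_sub hi1 hi2, e1, e3, e2, h4]
    ring
  obtain ⟨ψ, hψ1, hψ2, hψ3, hψ4, hψ5⟩ :=
    exists_contDiff_tsupport_subset (n := ⊤) (hΩ.mem_nhds ht₀)
  have hψ3 : ContDiff ℝ ∞ ψ := hψ3
  have hψpos : 0 < ∫ t, ψ t := by
    refine hψ3.continuous.integral_pos_of_hasCompactSupport_nonneg_nonzero hψ2 (fun t => ?_)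
      (x := t₀) (by rw [hψ5]; exact one_ne_zero)
    exact (hψ4 ⟨t, rfl⟩).1
  have hψi : Integrable ψ := hψ3.continuous.integrable_of_hasCompactSupport hψ2
  set J := ∫ t, ψ t with hJ
  set c := (∫ t, d t * ψ t) / J with hcdef
  refine ⟨c, ?_⟩
  have hz : ∀ᵐ t, t ∈ Ω → d t - c = 0 := by
    refine hΩ.ae_eq_zero_of_integral_contDiff_smul_eq_zero
      ((hdl.sub continuous_const.locallyIntegrable).locallyIntegrableOn Ω) ?_
    intro φ h1 h2 h3
    have hφi : Integrable φ := h1.continuous.integrable_of_hasCompactSupport h2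
    set I := ∫ t, φ t with hI
    -- Du Bois-Reymond: subtracting a multiple of the fixed bump ψ makes the integral zero, so θ is
    -- the derivative of a compactly supported test function and `d` is orthogonal to it.
    set θ : ℝ → ℝ := fun t => φ t - I / J * ψ t with hθ
    have hθd : ContDiff ℝ ∞ θ := h1.sub (contDiff_const.mul hψ3)
    have hθc : HasCompactSupport θ := h2.sub (hψ2.mul_left)
    have hθ0 : ∫ t, θ t = 0 := by
      simp only [hθ]
      rw [integral_sub hφi (hψi.const_mul _), integral_const_mul, ← hI, ← hJ]
      field_simp; ring
    have hK : IsCompact (tsupport φ ∪ tsupport ψ) := h2.isCompact.union hψ2.isCompact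
    have hKΩ : tsupport φ ∪ tsupport ψ ⊆ Ω := Set.union_subset h3 hψ1
    have hKn : (tsupport φ ∪ tsupport ψ).Nonempty :=
      ⟨t₀, Or.inr (subset_tsupport _ (by rw [Function.mem_support, hψ5]; exact one_ne_zero))⟩
    set α := sInf (tsupport φ ∪ tsupport ψ)
    set β := sSup (tsupport φ ∪ tsupport ψ)
    -- The primitive of θ need not vanish between the supports of φ and ψ; convexity of Ω keeps the
    -- interval they span inside Ω.
    have hαβ : Set.Icc α β ⊆ Ω := hc.out (hKΩ (hK.sInf_mem hKn)) (hKΩ (hK.sSup_mem hKn))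
    have hθz : ∀ t, t ∉ Set.Icc α β → θ t = 0 := by
      intro t ht
      have hn : t ∉ tsupport φ ∪ tsupport ψ := fun hm' =>
        ht ⟨csInf_le hK.bddBelow hm', le_csSup hK.bddAbove hm'⟩
      rw [Set.mem_union, not_or] at hn
      simp [hθ, image_eq_zero_of_notMem_tsupport hn.1, image_eq_zero_of_notMem_tsupport hn.2]
    set Θ : ℝ → ℝ := fun t => ∫ s in α..t, θ s with hΘ
    have hΘd : ∀ t, HasDerivAt Θ (θ t) t := fun t =>
      intervalIntegral.integral_hasDerivAt_right
        (hθd.continuous.intervalIntegrable _ _)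
        (hθd.continuous.stronglyMeasurableAtFilter _ _) hθd.continuous.continuousAt
    have hΘderiv : deriv Θ = θ := funext fun t => (hΘd t).deriv
    have hΘs : ContDiff ℝ ∞ Θ := by
      rw [contDiff_infty_iff_deriv, hΘderiv]
      exact ⟨fun t => (hΘd t).differentiableAt, hθd⟩
    have hΘz : ∀ t, t ∉ Set.Icc α β → Θ t = 0 := by
      intro t ht
      rcases lt_or_ge t α with hlt | hge
      · simp only [hΘ]
        rw [intervalIntegral.integral_of_ge hlt.le]
        rw [setIntegral_congr_ae (g := fun _ => (0:ℝ)) measurableSet_Ioc]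
        · simp
        · have : ∀ᵐ s : ℝ, s ≠ α := by simp [ae_iff]
          filter_upwards [this] with s hs hs'
          exact hθz s fun h' => hs (le_antisymm hs'.2 h'.1)
      · have hlt : β < t := by
          by_contra hcon
          exact ht ⟨hge, not_lt.1 hcon⟩
        simp only [hΘ]
        rw [intervalIntegral.integral_of_le hge, ← hθ0]
        have : ∀ᵐ s : ℝ, s ≠ α := by simp [ae_iff]
        rw [← integral_indicator measurableSet_Ioc]
        refine integral_congr_ae ?_
        filter_upwards [this] with s hs
        by_cases hs' : s ∈ Set.Ioc α t
        · simp [hs']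
        · rw [Set.indicator_of_notMem hs', hθz s]
          intro h'
          exact hs' ⟨lt_of_le_of_ne h'.1 (Ne.symm hs), h'.2.trans hlt.le⟩
    have hΘt : tsupport Θ ⊆ Set.Icc α β := by
      refine closure_minimal (fun t ht => ?_) isClosed_Icc
      by_contra hcon
      exact ht (hΘz t hcon)
    have h5 := key Θ hΘs (HasCompactSupport.of_support_subset_isCompact isCompact_Icc
      ((subset_tsupport _).trans hΘt)) (hΘt.trans hαβ)
    rw [hΘderiv] at h5
    have h6 : ∫ t, d t * θ t = (∫ t, d t * φ t) - I / J * ∫ t, d t * ψ t := by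
      rw [← integral_const_mul, ← integral_sub (hdI φ h1.continuous h2)
        ((hdI ψ hψ3.continuous hψ2).const_mul _)]
      congr 1; ext t; simp only [hθ]; ring
    rw [h6] at h5
    have h7 : ∫ t, φ t • (d t - c) = (∫ t, d t * φ t) - c * I := by
      rw [hI, ← integral_const_mul, ← integral_sub (hdI φ h1.continuous h2) (hφi.const_mul _)]
      congr 1; ext t; simp only [smul_eq_mul]; ring
    simp only [smul_eq_mul] at h7 ⊢
    rw [h7, hcdef]
    linear_combination h5
  rw [ae_restrict_iff' hm]
  filter_upwards [hz] with t ht htΩ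
  have := ht htΩ
  simp only [hd, Set.indicator_of_mem htΩ] at this
  linarith

end MetricGraph

namespace MetricGraph

variable {V E : Type*} {G : MetricGraph V E}

/-! ### The space `H¹` in terms of absolutely continuous functions -/

theorem locallyIntegrable_indicator {e : E} {g : ℝ → ℝ}
    (hg : MemLp g 2 (volume.restrict (G.openEdge e))) :
    LocallyIntegrable ((G.openEdge e).indicator g) :=
  ((memLp_indicator_iff_restrict (measurableSet_openEdge e)).2 hg).locallyIntegrable (by norm_num)

theorem restr_clamp (u : G.Point → ℝ) (e : E) (t : ℝ) :
    G.restr u e (G.clamp e t) = G.restr u e t := by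
  simp only [restr, coord_clamp]

theorem clamp_notMem_openEdge_between {e : E} {t s : ℝ} (hs : s ∈ Set.uIoo (G.clamp e t) t) :
    s ∉ G.openEdge e := by
  intro hso
  have h1 := openEdge_subset_closedEdge e hso
  have h2 := abs_clamp_sub_le (G := G) e s t
  rw [clamp_of_mem h1] at h2
  rcases le_total (G.clamp e t) t with h | h
  · rw [Set.uIoo_of_le h] at hs
    by_cases ht : t ∈ G.closedEdge e
    · rw [clamp_of_mem ht] at hs; exact lt_irrefl _ (hs.1.trans hs.2)
    · have h0 : (0:ℝ) < s := hso.1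
      have hl : G.len e ≠ ⊤ := fun hl =>
        ht ((mem_closedEdge_iff_of_top hl).2 (h0.trans hs.2).le)
      rw [mem_closedEdge_iff hl] at ht h1
      have h3 : (G.len e).toReal < t := by
        by_contra hc; exact ht ⟨(h0.trans hs.2).le, not_lt.1 hc⟩
      have : G.clamp e t = (G.len e).toReal := by
        simp [clamp, hl, max_eq_left (h0.trans hs.2).le, h3.le]
      rw [this] at hs
      linarith [hs.1, h1.2]
  · rw [Set.uIoo_of_ge h] at hs
    by_cases ht : t ∈ G.closedEdge e
    · rw [clamp_of_mem ht] at hs; exact lt_irrefl _ (hs.1.trans hs.2)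
    · have h0 : (0:ℝ) < s := hso.1
      by_cases htn : t < 0
      · have : G.clamp e t = 0 := by
          simp [clamp, htn.le]
        rw [this] at hs
        exact lt_irrefl _ (h0.trans hs.2)
      · push Not at htn
        have : G.clamp e t ≤ t := by
          unfold clamp
          split_ifs
          · exact (max_eq_left htn).le
          · rw [max_eq_left htn]; exact min_le_left _ _
        have := le_antisymm this h
        rw [this] at hs
        exact lt_irrefl _ (hs.1.trans hs.2)

theorem mem_closure_openEdge {e : E} {t : ℝ} (ht : t ∈ G.closedEdge e) :
    t ∈ closure (G.openEdge e) := by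
  by_cases hl : G.len e = ⊤
  · rw [openEdge_eq_of_top hl, closure_Ioi]; exact (mem_closedEdge_iff_of_top hl).1 ht
  · rw [openEdge_eq hl, closure_Ioo (toReal_len_pos hl).ne]; exact (mem_closedEdge_iff hl).1 ht

/-- A continuous function with an `L²` weak derivative is a primitive of it. -/
theorem IsEdgeDeriv.exists_eq_primitive {u : G.Point → ℝ} {e : E} {g : ℝ → ℝ}
    (hu : Continuous (G.restr u e)) (h : G.IsEdgeDeriv u e g) :
    ∃ c, ∀ t, G.restr u e t = c + ∫ s in (0:ℝ)..t, (G.openEdge e).indicator g s := by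
  have hg := locallyIntegrable_indicator h.1
  obtain ⟨t₀, ht₀⟩ := exists_mem_openEdge (G := G) e
  have hf : LocallyIntegrable ((G.openEdge e).indicator (G.restr u e)) :=
    hu.locallyIntegrable.indicator (measurableSet_openEdge e)
  obtain ⟨c, hc⟩ := h.2.exists_primitive (isOpen_openEdge e) (ordConnected_openEdge e) ht₀ hf hg
  set F : ℝ → ℝ := fun t => ∫ s in t₀..t, (G.openEdge e).indicator g s with hF
  have hFc : Continuous F := (LocAC.primitive hg t₀).continuous
  have h1 : Set.EqOn (G.restr u e) (fun t => c + F t) (G.openEdge e) :=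
    Measure.eqOn_open_of_ae_eq hc (isOpen_openEdge e) hu.continuousOn
      (continuous_const.add hFc).continuousOn
  have h2 : ∀ t ∈ G.closedEdge e, G.restr u e t = c + F t := by
    intro t ht
    exact h1.closure hu (continuous_const.add hFc) (mem_closure_openEdge ht)
  have hii : ∀ x y, IntervalIntegrable ((G.openEdge e).indicator g) volume x y := fun x y =>
    intervalIntegrable_iff.2 ((hg.integrableOn_isCompact isCompact_uIcc).mono_set
      Set.uIoc_subset_uIcc)
  -- Beyond the edge the integrand is cut to zero and the coordinate is clamped, so both sides are
  -- constant there. The identity thus extends from the edge to all of ℝ.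
  have h3 : ∀ t, F (G.clamp e t) = F t := by
    intro t
    have : ∫ s in (G.clamp e t)..t, (G.openEdge e).indicator g s = 0 := by
      refine intervalIntegral.integral_zero_ae ?_
      have h4 : ∀ᵐ s : ℝ, s ≠ t := by simp [ae_iff]
      have h5 : ∀ᵐ s : ℝ, s ≠ G.clamp e t := by simp [ae_iff]
      filter_upwards [h4, h5] with s h4 h5 hs
      refine Set.indicator_of_notMem (clamp_notMem_openEdge_between (t := t) ?_) _
      rcases le_total (G.clamp e t) t with h | h
      · rw [Set.uIoc_of_le h] at hs; rw [Set.uIoo_of_le h]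
        exact ⟨hs.1, lt_of_le_of_ne hs.2 h4⟩
      · rw [Set.uIoc_of_ge h] at hs; rw [Set.uIoo_of_ge h]
        exact ⟨hs.1, lt_of_le_of_ne hs.2 h5⟩
    have h6 := intervalIntegral.integral_add_adjacent_intervals (hii t₀ (G.clamp e t))
      (hii (G.clamp e t) t)
    simp only [hF]
    linarith
  refine ⟨c + F 0, fun t => ?_⟩
  rw [← restr_clamp, h2 _ (clamp_mem e t), h3]
  have h6 := intervalIntegral.integral_add_adjacent_intervals (hii t₀ 0) (hii 0 t)
  simp only [hF]
  linarith

theorem IsEdgeDeriv.locAC {u : G.Point → ℝ} {e : E} {g : ℝ → ℝ}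
    (hu : Continuous (G.restr u e)) (h : G.IsEdgeDeriv u e g) :
    LocAC (G.restr u e) ∧ ∀ᵐ t ∂volume.restrict (G.openEdge e), g t = deriv (G.restr u e) t := by
  obtain ⟨c, hc⟩ := h.exists_eq_primitive hu
  have hg := locallyIntegrable_indicator h.1
  have hfun := funext hc
  rw [hfun]
  refine ⟨LocAC.add (LocAC.of_lipschitz (K := 0) (by simp)) (LocAC.primitive hg 0), ?_⟩
  rw [ae_restrict_iff' (measurableSet_openEdge e)]
  filter_upwards [LocAC.deriv_primitive hg 0] with t ht hte
  rw [deriv_const_add, ht, Set.indicator_of_mem hte]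

theorem isEdgeDeriv_deriv {u : G.Point → ℝ} {e : E} (hu : LocAC (G.restr u e))
    (h : MemLp (deriv (G.restr u e)) 2 (volume.restrict (G.openEdge e))) :
    G.IsEdgeDeriv u e (deriv (G.restr u e)) := by
  refine ⟨h, fun φ h1 h2 h3 => ?_⟩
  have hz : ∀ t, t ∉ G.openEdge e → φ t = 0 := fun t ht =>
    image_eq_zero_of_notMem_tsupport fun hs => ht (h3 hs)
  have hz' : ∀ t, t ∉ G.openEdge e → deriv φ t = 0 := fun t ht => by
    by_contra hne
    exact ht (h3 (support_deriv_subset hne))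
  rw [setIntegral_eq_integral_of_forall_compl_eq_zero fun t ht => by rw [hz' t ht, mul_zero],
    setIntegral_eq_integral_of_forall_compl_eq_zero fun t ht => by rw [hz t ht, mul_zero]]
  exact hu.integral_mul_deriv (LocAC.of_contDiff (h1.of_le (by simp))) h2

/-- Replaces the chosen weak derivative by `deriv` of a function that is absolutely continuous on
the whole line, so that the a.e. product rule and the fundamental theorem of calculus become
available. -/
theorem memH1_iff {u : G.Point → ℝ} : G.MemH1 u ↔ ∀ e, LocAC (G.restr u e) ∧
    MemLp (G.restr u e) 2 (volume.restrict (G.openEdge e)) ∧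
    MemLp (deriv (G.restr u e)) 2 (volume.restrict (G.openEdge e)) := by
  constructor
  · rintro ⟨h1, h2⟩ e
    obtain ⟨h3, g, hg⟩ := h2 e
    obtain ⟨h4, h5⟩ := hg.locAC (continuous_iff_restr.1 h1 e)
    exact ⟨h4, h3, hg.1.ae_eq h5⟩
  · intro h
    exact ⟨continuous_iff_restr.2 fun e => (h e).1.continuous,
      fun e => ⟨(h e).2.1, _, isEdgeDeriv_deriv (h e).1 (h e).2.2⟩⟩

theorem MemH1.weakDeriv_eq {u : G.Point → ℝ} (h : G.MemH1 u) (e : E) :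
    ∀ᵐ t ∂volume.restrict (G.openEdge e), G.weakDeriv u e t = deriv (G.restr u e) t := by
  have hex := (h.2 e).2
  have : G.weakDeriv u e = hex.choose := by simp [weakDeriv, hex]
  rw [this]
  exact (hex.choose_spec.locAC (continuous_iff_restr.1 h.1 e)).2

theorem integral_congr [Fintype E] {f g : E → ℝ → ℝ}
    (h : ∀ e, ∀ᵐ t ∂volume.restrict (G.openEdge e), f e t = g e t) :
    G.integral f = G.integral g :=
  Finset.sum_congr rfl fun e _ => integral_congr_ae (h e)

theorem quadForm_eq [Fintype E] {p : ℝ} {W ρ u φ : G.Point → ℝ} (h : G.MemH1 φ) :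
    G.quadForm p W ρ u φ = G.integral fun e t => (deriv (G.restr φ e) t) ^ 2
      + G.restr W e t * (G.restr φ e t) ^ 2
      - (p - 1) * G.restr ρ e t * |G.restr u e t| ^ (p - 2) * (G.restr φ e t) ^ 2 := by
  refine integral_congr fun e => ?_
  filter_upwards [h.weakDeriv_eq e] with t ht
  rw [ht]

theorem IsSolution.eq [Fintype E] {p : ℝ} {W ρ u φ : G.Point → ℝ} (h : G.IsSolution p W ρ u)
    (hφ : G.MemH1c φ) :
    G.integral (fun e t => deriv (G.restr u e) t * deriv (G.restr φ e) t
      + G.restr W e t * G.restr u e t * G.restr φ e t)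
    = G.integral (fun e t =>
        G.restr ρ e t * |G.restr u e t| ^ (p - 2) * G.restr u e t * G.restr φ e t) := by
  rw [← h.2 φ hφ]
  refine integral_congr fun e => ?_
  filter_upwards [h.1.weakDeriv_eq e, hφ.1.weakDeriv_eq e] with t h1 h2
  rw [h1, h2]

/-! ### Closure properties -/

theorem MemH1.mul_lipschitz {φ η : G.Point → ℝ} (hφ : G.MemH1 φ) {K B : ℝ}
    (hη : ∀ e s t, |G.restr η e s - G.restr η e t| ≤ K * |s - t|)
    (hB : ∀ x, |η x| ≤ B) : G.MemH1 fun x => φ x * η x := by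
  rw [memH1_iff] at hφ ⊢
  intro e
  obtain ⟨h1, h2, h3⟩ := hφ e
  have h4 : LocAC (G.restr η e) := LocAC.of_lipschitz (hη e)
  have hm : AEStronglyMeasurable (G.restr η e) (volume.restrict (G.openEdge e)) :=
    h4.continuous.aestronglyMeasurable
  have hd : AEStronglyMeasurable (deriv (G.restr η e)) (volume.restrict (G.openEdge e)) :=
    (measurable_deriv _).aestronglyMeasurable
  have hdb : ∀ t, |deriv (G.restr η e) t| ≤ |K| := fun t =>
    abs_deriv_le_of_local (w := fun _ => |K|) continuousAt_const (abs_nonneg K) fun s =>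
      (hη e s t).trans (mul_le_mul_of_nonneg_right (le_abs_self K) (abs_nonneg _))
  have bdd : ∀ {f g : ℝ → ℝ} {C : ℝ}, MemLp f 2 (volume.restrict (G.openEdge e)) →
      AEStronglyMeasurable g (volume.restrict (G.openEdge e)) → (∀ t, |g t| ≤ C) →
      MemLp (fun t => f t * g t) 2 (volume.restrict (G.openEdge e)) := by
    intro f g C hf hg hC
    refine MemLp.of_le_mul (c := C) hf (hf.1.mul hg) (Eventually.of_forall fun t => ?_)
    rw [norm_mul, mul_comm]
    exact mul_le_mul_of_nonneg_right (hC t) (norm_nonneg _)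
  refine ⟨h1.mul h4, bdd h2 hm (fun t => hB _), ?_⟩
  refine MemLp.ae_eq ?_ ((bdd h3 hm (fun t => hB _)).add (bdd h2 hd hdb))
  filter_upwards [ae_restrict_of_ae (h1.deriv_mul h4)] with t ht
  exact ht.symm

theorem memH1_smul_add {φ ψ : G.Point → ℝ} (hφ : G.MemH1 φ) (hψ : G.MemH1 ψ) (c : ℝ) :
    G.MemH1 fun x => c * φ x + ψ x := by
  rw [memH1_iff] at hφ hψ ⊢
  intro e
  obtain ⟨h1, h2, h3⟩ := hφ e
  obtain ⟨h1', h2', h3'⟩ := hψ e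
  refine ⟨(h1.const_mul c).add h1', (h2.const_mul c).add h2', ?_⟩
  refine MemLp.ae_eq ?_ ((h3.const_mul c).add h3')
  filter_upwards [ae_restrict_of_ae h1.ae_differentiableAt,
    ae_restrict_of_ae h1'.ae_differentiableAt] with t ht ht'
  exact ((ht.hasDerivAt.const_mul c).add ht'.hasDerivAt).deriv.symm

theorem memH1_zero : G.MemH1 fun _ => 0 := by
  rw [memH1_iff]
  intro e
  have : G.restr (fun _ => (0:ℝ)) e = fun _ => 0 := rfl
  rw [this, deriv_const']
  exact ⟨LocAC.of_lipschitz (K := 0) (by simp), MemLp.zero', MemLp.zero'⟩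

/-! ### The Sobolev inequality -/

variable (G) in
/-- The squared norm `∫ |φ'|² + k² φ²`. -/
def energy [Fintype E] (k : ℝ) (φ : G.Point → ℝ) : ℝ :=
  G.integral fun e t => (deriv (G.restr φ e) t) ^ 2 + k ^ 2 * (G.restr φ e t) ^ 2

theorem MemH1.integrableOn_energy {φ : G.Point → ℝ} (h : G.MemH1 φ) (k : ℝ) (e : E) :
    IntegrableOn (fun t => (deriv (G.restr φ e) t) ^ 2 + k ^ 2 * (G.restr φ e t) ^ 2)
      (G.openEdge e) :=
  ((memH1_iff.1 h e).2.2.integrable_sq).add ((memH1_iff.1 h e).2.1.integrable_sq.const_mul _)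

theorem exists_segment {e : E} {k t : ℝ} (hk : 0 < k) (hl : ENNReal.ofReal (1 / k) ≤ G.len e)
    (ht : t ∈ G.closedEdge e) : ∃ α, t ∈ Set.Icc α (α + 1 / k) ∧ α ∈ G.closedEdge e ∧
      α + 1 / k ∈ G.closedEdge e := by
  have hk' : 0 < 1 / k := by positivity
  by_cases h : G.len e = ⊤
  · rw [mem_closedEdge_iff_of_top h] at ht
    exact ⟨t, ⟨le_rfl, by linarith⟩, (mem_closedEdge_iff_of_top h).2 ht,
      (mem_closedEdge_iff_of_top h).2 (by linarith)⟩
  · rw [mem_closedEdge_iff h] at ht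
    rw [ENNReal.ofReal_le_iff_le_toReal h] at hl
    rcases le_total (t + 1 / k) (G.len e).toReal with h' | h'
    · exact ⟨t, ⟨le_rfl, by linarith⟩, (mem_closedEdge_iff h).2 ht,
        (mem_closedEdge_iff h).2 ⟨by linarith, h'⟩⟩
    · refine ⟨(G.len e).toReal - 1 / k, ⟨by linarith, by linarith⟩,
        (mem_closedEdge_iff h).2 ⟨by linarith, by linarith⟩,
        (mem_closedEdge_iff h).2 ⟨by linarith, by linarith⟩⟩

/-- On an interval of length 1/k containing t, f(t)² ≤ f(s)² + ∫ |2ff'|, and k|2ff'| ≤ f'² + k²f².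
Averaging over s gives one copy of the energy from each term, whence the factor 2. -/
theorem MemH1.sobolev_edge {φ : G.Point → ℝ} (h : G.MemH1 φ) {e : E} {k t : ℝ} (hk : 0 < k)
    (hl : ENNReal.ofReal (1 / k) ≤ G.len e) (ht : t ∈ G.closedEdge e) :
    k * (G.restr φ e t) ^ 2 ≤ 2 * ∫ t in G.openEdge e,
      ((deriv (G.restr φ e) t) ^ 2 + k ^ 2 * (G.restr φ e t) ^ 2) := by
  obtain ⟨α, htα, h0, h1⟩ := exists_segment hk hl ht
  obtain ⟨hac, hL, hL'⟩ := memH1_iff.1 h e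
  set f := G.restr φ e
  set D := ∫ t in G.openEdge e, ((deriv f t) ^ 2 + k ^ 2 * (f t) ^ 2)
  have hαβ : α ≤ α + 1 / k := by linarith [show 0 < 1 / k by positivity]
  have hsub : Set.Ioo α (α + 1 / k) ⊆ G.openEdge e := Ioo_subset_openEdge h0 h1
  have hint : IntegrableOn (fun t => (deriv f t) ^ 2 + k ^ 2 * (f t) ^ 2) (G.openEdge e) :=
    h.integrableOn_energy k e
  have hintJ : IntegrableOn (fun t => (deriv f t) ^ 2 + k ^ 2 * (f t) ^ 2)
      (Set.Ioc α (α + 1 / k)) :=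
    (integrableOn_Ioc_iff_integrableOn_Ioo).2 (hint.mono_set hsub)
  have hJD : ∫ t in Set.Ioc α (α + 1 / k), ((deriv f t) ^ 2 + k ^ 2 * (f t) ^ 2) ≤ D := by
    rw [integral_Ioc_eq_integral_Ioo]
    exact setIntegral_mono_set hint (Eventually.of_forall fun t => by positivity)
      hsub.eventuallyLE
  have hsq : LocAC fun t => f t * f t := hac.mul hac
  have step : ∀ s ∈ Set.Icc α (α + 1 / k), f t ^ 2 ≤ f s ^ 2 + D / k := by
    intro s hs
    have e1 : ∫ r in s..t, deriv (fun t => f t * f t) r = f t * f t - f s * f s :=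
      hsq.integral_deriv s t
    have e2 : |∫ r in s..t, deriv (fun t => f t * f t) r| ≤ D / k := by
      rw [← Real.norm_eq_abs]
      refine (intervalIntegral.norm_integral_le_integral_norm_uIoc).trans ?_
      simp only [Real.norm_eq_abs]
      have hus : Set.uIoc s t ⊆ Set.Ioc α (α + 1 / k) := by
        intro r hr
        rw [Set.mem_uIoc] at hr
        rcases hr with hr | hr
        · exact ⟨hs.1.trans_lt hr.1, hr.2.trans htα.2⟩
        · exact ⟨htα.1.trans_lt hr.1, hr.2.trans hs.2⟩
      calc ∫ r in Set.uIoc s t, |deriv (fun t => f t * f t) r|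
          ≤ ∫ r in Set.uIoc s t, ((deriv f r) ^ 2 + k ^ 2 * (f r) ^ 2) / k := by
            refine setIntegral_mono_ae_restrict
              (intervalIntegrable_iff.1 (hsq.intervalIntegrable_deriv s t)).abs
              ((hintJ.mono_set hus).div_const k) ?_
            filter_upwards [ae_restrict_of_ae (hac.deriv_mul hac)] with r hr
            rw [hr, le_div_iff₀ hk, ← abs_of_pos hk, ← abs_mul, abs_of_pos hk, abs_le]
            constructor <;> nlinarith [sq_nonneg (deriv f r - k * f r),
              sq_nonneg (deriv f r + k * f r)]
        _ ≤ ∫ r in Set.Ioc α (α + 1 / k), ((deriv f r) ^ 2 + k ^ 2 * (f r) ^ 2) / k :=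
            setIntegral_mono_set (hintJ.div_const k)
              (Eventually.of_forall fun t => by positivity) hus.eventuallyLE
        _ ≤ D / k := by
            rw [integral_div]
            exact div_le_div_of_nonneg_right hJD hk.le
    have := (abs_le.1 e2).2
    rw [e1] at this
    linarith [sq (f t), sq (f s)]
  have hf2 : IntegrableOn (fun t => f t ^ 2) (Set.Ioc α (α + 1 / k)) :=
    ((hac.continuous.pow 2).integrableOn_Ioc)
  have e3 : (1 / k) * f t ^ 2 ≤ ∫ s in Set.Ioc α (α + 1 / k), (f s ^ 2 + D / k) := by
    have : ∫ s in Set.Ioc α (α + 1 / k), f t ^ 2 = (1 / k) * f t ^ 2 := by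
      rw [setIntegral_const, measureReal_def, Real.volume_Ioc, smul_eq_mul,
        ENNReal.toReal_ofReal (by linarith)]
      ring
    rw [← this]
    exact setIntegral_mono_on (by simp) (hf2.add (by simp))
      measurableSet_Ioc fun s hs => step s ⟨hs.1.le, hs.2⟩
  have e4 : ∫ s in Set.Ioc α (α + 1 / k), (f s ^ 2 + D / k) =
      (∫ s in Set.Ioc α (α + 1 / k), f s ^ 2) + (1 / k) * (D / k) := by
    rw [integral_add hf2 (by simp), setIntegral_const, measureReal_def, Real.volume_Ioc,
      smul_eq_mul, ENNReal.toReal_ofReal (by linarith)]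
    ring
  have e5 : k ^ 2 * ∫ s in Set.Ioc α (α + 1 / k), f s ^ 2 ≤ D := by
    rw [← integral_const_mul]
    refine le_trans ?_ hJD
    exact setIntegral_mono_on (hf2.const_mul _) hintJ measurableSet_Ioc
      fun s _ => by nlinarith [sq_nonneg (deriv f s)]
  rw [e4] at e3
  have : k ^ 2 * ((1 / k) * f t ^ 2) ≤
      k ^ 2 * ((∫ s in Set.Ioc α (α + 1 / k), f s ^ 2) + (1 / k) * (D / k)) :=
    mul_le_mul_of_nonneg_left e3 (by positivity)
  rw [mul_add, ← mul_assoc, show k ^ 2 * (1 / k) = k by field_simp,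
    show k ^ 2 * (1 / k * (D / k)) = D by field_simp] at this
  linarith

theorem MemH1.sobolev [Fintype E] [Nonempty E] (hG : G.Connected) {φ : G.Point → ℝ}
    (h : G.MemH1 φ) {k : ℝ} (hk : 0 < k) (hl : ∀ e, ENNReal.ofReal (1 / k) ≤ G.len e)
    (x : G.Point) : k * φ x ^ 2 ≤ 2 * G.energy k φ := by
  obtain ⟨e, t, ht, rfl⟩ := exists_coord_eq hG x
  refine (h.sobolev_edge hk (hl e) ht).trans ?_
  refine mul_le_mul_of_nonneg_left ?_ (by norm_num)
  exact Finset.single_le_sum (f := fun e => ∫ t in G.openEdge e,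
      ((deriv (G.restr φ e) t) ^ 2 + k ^ 2 * (G.restr φ e t) ^ 2))
    (fun e _ => integral_nonneg fun t => by positivity) (Finset.mem_univ e)

end MetricGraph

/-! ### Edgewise integration, cutoffs and identities for a single solution. -/

theorem integrable_bdd_mul_mul {μ : Measure ℝ} {m f g : ℝ → ℝ} {C : ℝ}
    (hm : AEStronglyMeasurable m μ) (hC : ∀ᵐ t ∂μ, |m t| ≤ C) (hf : MemLp f 2 μ)
    (hg : MemLp g 2 μ) : Integrable (fun t => m t * (f t * g t)) μ :=
  (hf.integrable_mul hg).bdd_mul hm hC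

namespace MetricGraph

variable {V E : Type*} {G : MetricGraph V E}

variable (G) in
/-- Edgewise integrability. -/
def EdgeIntegrable (f : E → ℝ → ℝ) : Prop := ∀ e, IntegrableOn (f e) (G.openEdge e)

theorem integral_add' [Fintype E] {f g : E → ℝ → ℝ} (hf : G.EdgeIntegrable f)
    (hg : G.EdgeIntegrable g) :
    G.integral (fun e t => f e t + g e t) = G.integral f + G.integral g := by
  simp only [integral, ← Finset.sum_add_distrib]
  exact Finset.sum_congr rfl fun e _ => MeasureTheory.integral_add (hf e) (hg e)

theorem integral_sub' [Fintype E] {f g : E → ℝ → ℝ} (hf : G.EdgeIntegrable f)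
    (hg : G.EdgeIntegrable g) :
    G.integral (fun e t => f e t - g e t) = G.integral f - G.integral g := by
  simp only [integral, ← Finset.sum_sub_distrib]
  exact Finset.sum_congr rfl fun e _ => MeasureTheory.integral_sub (hf e) (hg e)

theorem integral_const_mul' [Fintype E] (c : ℝ) (f : E → ℝ → ℝ) :
    G.integral (fun e t => c * f e t) = c * G.integral f := by
  simp only [integral, Finset.mul_sum]
  exact Finset.sum_congr rfl fun e _ => MeasureTheory.integral_const_mul _ _

theorem integral_mono' [Fintype E] {f g : E → ℝ → ℝ} (hf : G.EdgeIntegrable f)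
    (hg : G.EdgeIntegrable g)
    (h : ∀ e, ∀ᵐ t ∂volume.restrict (G.openEdge e), f e t ≤ g e t) :
    G.integral f ≤ G.integral g :=
  Finset.sum_le_sum fun e _ => MeasureTheory.integral_mono_ae (hf e) (hg e) (h e)

theorem integral_nonneg' [Fintype E] {f : E → ℝ → ℝ}
    (h : ∀ e, ∀ᵐ t ∂volume.restrict (G.openEdge e), 0 ≤ f e t) : 0 ≤ G.integral f :=
  Finset.sum_nonneg fun e _ => MeasureTheory.integral_nonneg_of_ae (h e)

theorem integral_finset_sum' [Fintype E] {ι : Type*} (s : Finset ι) {f : ι → E → ℝ → ℝ}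
    (hf : ∀ i, G.EdgeIntegrable (f i)) :
    G.integral (fun e t => ∑ i ∈ s, f i e t) = ∑ i ∈ s, G.integral (f i) := by
  simp only [integral]
  rw [Finset.sum_comm]
  exact Finset.sum_congr rfl fun e _ => MeasureTheory.integral_finsetSum _ fun i _ => hf i e

theorem integrable_deriv_mul {φ ψ : G.Point → ℝ} (hφ : G.MemH1 φ) (hψ : G.MemH1 ψ) :
    G.EdgeIntegrable fun e t => deriv (G.restr φ e) t * deriv (G.restr ψ e) t :=
  fun e => (memH1_iff.1 hφ e).2.2.integrable_mul (memH1_iff.1 hψ e).2.2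

/-- Admissible cutoff functions. -/
structure Cutoff (η : G.Point → ℝ) : Prop where
  lipschitz : ∃ K, ∀ e s t, |G.restr η e s - G.restr η e t| ≤ K * |s - t|
  bounded : ∃ B, ∀ x, |η x| ≤ B
  compact : HasCompactSupport η

theorem Cutoff.mul_memH1 {η φ : G.Point → ℝ} (hη : Cutoff η)
    (hφ : G.MemH1 φ) : G.MemH1c fun x => φ x * η x := by
  obtain ⟨K, hK⟩ := hη.lipschitz
  obtain ⟨B, hB⟩ := hη.bounded
  exact ⟨hφ.mul_lipschitz hK hB, hη.compact.mul_left⟩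

theorem Cutoff.locAC {η : G.Point → ℝ} (hη : Cutoff η) (e : E) :
    LocAC (G.restr η e) := by
  obtain ⟨K, hK⟩ := hη.lipschitz
  exact LocAC.of_lipschitz (hK e)

theorem Cutoff.integrable_mul_deriv {η φ : G.Point → ℝ} (hη : Cutoff η)
    (hφ : G.MemH1 φ) :
    G.EdgeIntegrable fun e t => (G.restr φ e t) ^ 2 * (deriv (G.restr η e) t) ^ 2 := by
  obtain ⟨K, hK⟩ := hη.lipschitz
  intro e
  have hdb : ∀ t, |deriv (G.restr η e) t| ≤ |K| := fun t =>
    abs_deriv_le_of_local (w := fun _ => |K|) continuousAt_const (abs_nonneg K) fun s =>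
      (hK e s t).trans (mul_le_mul_of_nonneg_right (le_abs_self K) (abs_nonneg _))
  have := integrable_bdd_mul_mul (μ := volume.restrict (G.openEdge e))
    (m := fun t => (deriv (G.restr η e) t) ^ 2) (C := |K| ^ 2)
    ((measurable_deriv _).pow_const 2).aestronglyMeasurable
    (Eventually.of_forall fun t => by
      rw [abs_pow]; exact pow_le_pow_left₀ (abs_nonneg _) (hdb t) 2)
    (memH1_iff.1 hφ e).2.1 (memH1_iff.1 hφ e).2.1
  refine this.congr (Eventually.of_forall fun t => ?_)
  simp only []
  ring

theorem memH1c_sum {ι : Type*} (s : Finset ι) {φ : ι → G.Point → ℝ} (h : ∀ i, G.MemH1c (φ i))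
    (c : ι → ℝ) : G.MemH1c (∑ i ∈ s, c i • φ i) := by
  classical
  induction s using Finset.induction_on with
  | empty => exact ⟨memH1_zero, HasCompactSupport.zero⟩
  | insert i s hi ih =>
    rw [Finset.sum_insert hi]
    exact ⟨memH1_smul_add (h i).1 ih.1 (c i), ((h i).2.smul_left (f := fun _ => c i)).add ih.2⟩

/-- The hypotheses on a single solution, with the parameter `λ = k²`. -/
structure SolData [Fintype E] (G : MetricGraph V E) (p k Wbar b : ℝ) (W ρ u : G.Point → ℝ) :
    Prop where
  two_lt : 2 < p
  k_pos : 0 < k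
  len_le : ∀ e, ENNReal.ofReal (1 / k) ≤ G.len e
  W_le : 8 * Wbar ≤ k ^ 2
  b_pos : 0 < b
  aemeasurable_W : ∀ e, AEMeasurable (G.restr W e) (volume.restrict (G.openEdge e))
  aemeasurable_ρ : ∀ e, AEMeasurable (G.restr ρ e) (volume.restrict (G.openEdge e))
  abs_W_le : ∀ e, ∀ᵐ t ∂volume.restrict (G.openEdge e), |G.restr W e t| ≤ Wbar
  ρ_bounds : ∀ e, ∀ᵐ t ∂volume.restrict (G.openEdge e), 0 ≤ G.restr ρ e t ∧ G.restr ρ e t ≤ b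
  sol : G.IsSolution p (fun x => W x + k ^ 2) ρ u

namespace SolData

variable [Fintype E] {p k Wbar b : ℝ} {W ρ u : G.Point → ℝ}

theorem memH1 (S : SolData G p k Wbar b W ρ u) : G.MemH1 u := S.sol.1

/-- Only qualitative, since the bound depends on the energy of u. It makes the coefficient `ρ
|u|^(p-2)` bounded, hence all the integrals convergent, and the supremum of |u| finite. -/
theorem exists_bound [Nonempty E] (hG : G.Connected) (S : SolData G p k Wbar b W ρ u) :
    ∃ M, 0 ≤ M ∧ ∀ x, |u x| ≤ M := by
  refine ⟨√(2 * G.energy k u / k), Real.sqrt_nonneg _, fun x => ?_⟩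
  refine Real.le_sqrt_of_sq_le ?_
  rw [sq_abs, le_div_iff₀ S.k_pos, mul_comm]
  exact S.memH1.sobolev hG S.k_pos S.len_le x

/-- The coefficient `ρ |u|^(p-2)`. -/
def coeff (_ : SolData G p k Wbar b W ρ u) (e : E) (t : ℝ) : ℝ :=
  G.restr ρ e t * |G.restr u e t| ^ (p - 2)

theorem aesm_coeff (S : SolData G p k Wbar b W ρ u) (e : E) :
    AEStronglyMeasurable (S.coeff e) (volume.restrict (G.openEdge e)) := by
  have h : Continuous (G.restr u e) := continuous_iff_restr.1 S.memH1.1 e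
  exact ((S.aemeasurable_ρ e).mul (h.measurable.norm.pow_const (p - 2)).aemeasurable
    ).aestronglyMeasurable

theorem coeff_nonneg (S : SolData G p k Wbar b W ρ u) (e : E) :
    ∀ᵐ t ∂volume.restrict (G.openEdge e), 0 ≤ S.coeff e t := by
  filter_upwards [S.ρ_bounds e] with t ht
  exact mul_nonneg ht.1 (Real.rpow_nonneg (abs_nonneg _) _)

theorem coeff_le (S : SolData G p k Wbar b W ρ u) (e : E) :
    ∀ᵐ t ∂volume.restrict (G.openEdge e), S.coeff e t ≤ b * |G.restr u e t| ^ (p - 2) := by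
  filter_upwards [S.ρ_bounds e] with t ht
  exact mul_le_mul_of_nonneg_right ht.2 (Real.rpow_nonneg (abs_nonneg _) _)

theorem exists_abs_coeff_le [Nonempty E] (hG : G.Connected) (S : SolData G p k Wbar b W ρ u) :
    ∃ C, ∀ e, ∀ᵐ t ∂volume.restrict (G.openEdge e), |S.coeff e t| ≤ C := by
  obtain ⟨M, hM, hu⟩ := S.exists_bound hG
  refine ⟨b * M ^ (p - 2), fun e => ?_⟩
  filter_upwards [S.coeff_nonneg e, S.coeff_le e] with t h0 h1
  rw [abs_of_nonneg h0]
  refine h1.trans (mul_le_mul_of_nonneg_left ?_ S.b_pos.le)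
  exact Real.rpow_le_rpow (abs_nonneg _) (hu _) (by linarith [S.two_lt])

theorem aesm_pot (S : SolData G p k Wbar b W ρ u) (e : E) :
    AEStronglyMeasurable (fun t => G.restr W e t + k ^ 2) (volume.restrict (G.openEdge e)) :=
  ((S.aemeasurable_W e).add_const _).aestronglyMeasurable

theorem abs_pot_le (S : SolData G p k Wbar b W ρ u) (e : E) :
    ∀ᵐ t ∂volume.restrict (G.openEdge e), |G.restr W e t + k ^ 2| ≤ 2 * k ^ 2 := by
  filter_upwards [S.abs_W_le e] with t ht
  have := S.W_le
  have := abs_le.1 ht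
  rw [abs_le]
  constructor <;> nlinarith [sq_nonneg k]

theorem le_pot (S : SolData G p k Wbar b W ρ u) (e : E) :
    ∀ᵐ t ∂volume.restrict (G.openEdge e), 7 / 8 * k ^ 2 ≤ G.restr W e t + k ^ 2 := by
  filter_upwards [S.abs_W_le e] with t ht
  have := S.W_le
  have := abs_le.1 ht
  linarith

theorem integrable_coeff_mul [Nonempty E] (hG : G.Connected) (S : SolData G p k Wbar b W ρ u)
    {φ ψ : G.Point → ℝ} (hφ : G.MemH1 φ) (hψ : G.MemH1 ψ) :
    G.EdgeIntegrable fun e t => S.coeff e t * (G.restr φ e t * G.restr ψ e t) := fun e => by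
  obtain ⟨C, hC⟩ := S.exists_abs_coeff_le hG
  exact integrable_bdd_mul_mul (S.aesm_coeff e) (hC e) (memH1_iff.1 hφ e).2.1
    (memH1_iff.1 hψ e).2.1

theorem integrable_pot_mul (S : SolData G p k Wbar b W ρ u)
    {φ ψ : G.Point → ℝ} (hφ : G.MemH1 φ) (hψ : G.MemH1 ψ) :
    G.EdgeIntegrable fun e t => (G.restr W e t + k ^ 2) * (G.restr φ e t * G.restr ψ e t) :=
  fun e => integrable_bdd_mul_mul (S.aesm_pot e) (S.abs_pot_le e) (memH1_iff.1 hφ e).2.1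
    (memH1_iff.1 hψ e).2.1

/-- The weak equation. -/
theorem weak_eq (S : SolData G p k Wbar b W ρ u) {φ : G.Point → ℝ} (hφ : G.MemH1c φ) :
    G.integral (fun e t => deriv (G.restr u e) t * deriv (G.restr φ e) t
      + (G.restr W e t + k ^ 2) * (G.restr u e t * G.restr φ e t))
    = G.integral (fun e t => S.coeff e t * (G.restr u e t * G.restr φ e t)) := by
  have h := S.sol.eq hφ
  simp only [coeff]
  convert h using 2
  · funext e t; rw [mul_assoc]; rfl
  · funext e t; ring

variable (k W) in
/-- The quadratic form without the nonlinear term. -/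
def form (φ : G.Point → ℝ) : ℝ :=
  G.integral fun e t => (deriv (G.restr φ e) t) ^ 2 + (G.restr W e t + k ^ 2) * (G.restr φ e t) ^ 2

/-- The nonlinear part of the quadratic form. -/
def nl (S : SolData G p k Wbar b W ρ u) (φ : G.Point → ℝ) : ℝ :=
  G.integral fun e t => S.coeff e t * (G.restr φ e t) ^ 2

theorem integrable_form (S : SolData G p k Wbar b W ρ u) {φ : G.Point → ℝ} (hφ : G.MemH1 φ) :
    G.EdgeIntegrable fun e t =>
      (deriv (G.restr φ e) t) ^ 2 + (G.restr W e t + k ^ 2) * (G.restr φ e t) ^ 2 := fun e => by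
  refine ((integrable_deriv_mul hφ hφ e).add (S.integrable_pot_mul hφ hφ e)).congr
    (Eventually.of_forall fun t => ?_)
  simp only [Pi.add_apply, pow_two]

theorem integrable_nl [Nonempty E] (hG : G.Connected) (S : SolData G p k Wbar b W ρ u)
    {φ : G.Point → ℝ} (hφ : G.MemH1 φ) :
    G.EdgeIntegrable fun e t => S.coeff e t * (G.restr φ e t) ^ 2 := fun e => by
  simpa only [pow_two] using S.integrable_coeff_mul hG hφ hφ e

theorem quadForm_eq_sub [Nonempty E] (hG : G.Connected) (S : SolData G p k Wbar b W ρ u)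
    {φ : G.Point → ℝ} (hφ : G.MemH1 φ) :
    G.quadForm p (fun x => W x + k ^ 2) ρ u φ = form k W φ - (p - 1) * S.nl φ := by
  rw [quadForm_eq hφ, form, nl, ← integral_const_mul',
    ← integral_sub' (S.integrable_form hφ) fun e => (S.integrable_nl hG hφ e).const_mul _]
  congr 1
  funext e t
  simp only [coeff, restr]
  ring

/-- The condition `8 * Wbar ≤ k ^ 2` leaves at least 7/8 of k² in the potential. -/
theorem energy_le_form (S : SolData G p k Wbar b W ρ u) {φ : G.Point → ℝ} (hφ : G.MemH1 φ) :
    7 * G.energy k φ ≤ 8 * form k W φ := by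
  rw [energy, form, ← integral_const_mul', ← integral_const_mul']
  refine integral_mono' (fun e => (hφ.integrableOn_energy k e).const_mul _)
    (fun e => (S.integrable_form hφ e).const_mul _) fun e => ?_
  filter_upwards [S.le_pot e] with t ht
  nlinarith [sq_nonneg (deriv (G.restr φ e) t),
    mul_le_mul_of_nonneg_right ht (sq_nonneg (G.restr φ e t))]

/-- A test function that coincides with `u` wherever it does not vanish. -/
theorem quadForm_nodal [Nonempty E] (hG : G.Connected) (S : SolData G p k Wbar b W ρ u)
    {φ : G.Point → ℝ} (hφ : G.MemH1c φ)
    (h : ∀ e, ∀ᵐ t ∂volume.restrict (G.openEdge e),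
      G.restr u e t * G.restr φ e t = G.restr φ e t ^ 2 ∧
      deriv (G.restr u e) t * deriv (G.restr φ e) t = deriv (G.restr φ e) t ^ 2) :
    G.quadForm p (fun x => W x + k ^ 2) ρ u φ = - (p - 2) * S.nl φ := by
  have h1 := S.weak_eq hφ
  have h2 : form k W φ = S.nl φ := by
    rw [form, nl]
    refine (integral_congr fun e => ?_).trans (h1.trans (integral_congr fun e => ?_))
    · filter_upwards [h e] with t ht
      rw [ht.1, ht.2]
    · filter_upwards [h e] with t ht
      rw [ht.1]
  rw [S.quadForm_eq_sub hG hφ.1, h2]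
  ring

/-- Testing the equation with `u η²`. -/
theorem form_mul_cutoff (S : SolData G p k Wbar b W ρ u)
    {η : G.Point → ℝ} (hη : Cutoff η) :
    form k W (fun x => u x * η x) =
      G.integral (fun e t => (G.restr u e t) ^ 2 * (deriv (G.restr η e) t) ^ 2)
        + S.nl fun x => u x * η x := by
  have h1 := hη.mul_memH1 S.memH1
  have h2 := hη.mul_memH1 h1.1
  have hw := S.weak_eq h2
  have e2 : (S.nl fun x => u x * η x) = G.integral (fun e t => S.coeff e t *
      (G.restr u e t * G.restr (fun x => u x * η x * η x) e t)) := by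
    rw [nl]
    congr 1; funext e t; simp only [restr]; ring
  have hI : G.EdgeIntegrable fun e t =>
      deriv (G.restr u e) t * deriv (G.restr (fun x => u x * η x * η x) e) t
      + (G.restr W e t + k ^ 2) * (G.restr u e t * G.restr (fun x => u x * η x * η x) e t) :=
    fun e => (integrable_deriv_mul S.memH1 h2.1 e).add (S.integrable_pot_mul S.memH1 h2.1 e)
  rw [e2, ← hw, ← integral_add' (hη.integrable_mul_deriv S.memH1) hI]
  refine integral_congr fun e => ?_
  have hu := (memH1_iff.1 S.memH1 e).1
  -- Pointwise, ((uη)')² = u² η'² + u' (uη²)', by the product rule.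
  filter_upwards [ae_restrict_of_ae (hu.deriv_mul (hη.locAC e)),
    ae_restrict_of_ae ((hu.mul (hη.locAC e)).deriv_mul (hη.locAC e))] with t h3 h4
  have r1 : G.restr (fun x => u x * η x) e = fun t => G.restr u e t * G.restr η e t := rfl
  have r2 : G.restr (fun x => u x * η x * η x) e =
    fun t => G.restr u e t * G.restr η e t * G.restr η e t := rfl
  simp only [r1, r2]
  rw [h4, h3]
  ring

theorem energy_mul_cutoff_le (S : SolData G p k Wbar b W ρ u)
    {η : G.Point → ℝ} (hη : Cutoff η) :
    7 * G.energy k (fun x => u x * η x) ≤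
      8 * (G.integral (fun e t => (G.restr u e t) ^ 2 * (deriv (G.restr η e) t) ^ 2)
        + S.nl fun x => u x * η x) := by
  rw [← S.form_mul_cutoff hη]
  exact S.energy_le_form (hη.mul_memH1 S.memH1).1

/-- The nonlinear term enters the equation once but the linearization p-1 times; the surplus p-2 > 0
makes the form negative as soon as the cutoff gradient costs little. -/
theorem quadForm_mul_cutoff [Nonempty E] (hG : G.Connected) (S : SolData G p k Wbar b W ρ u)
    {η : G.Point → ℝ} (hη : Cutoff η) :
    G.quadForm p (fun x => W x + k ^ 2) ρ u (fun x => u x * η x) =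
      G.integral (fun e t => (G.restr u e t) ^ 2 * (deriv (G.restr η e) t) ^ 2)
        - (p - 2) * S.nl fun x => u x * η x := by
  rw [S.quadForm_eq_sub hG (hη.mul_memH1 S.memH1).1, S.form_mul_cutoff hη]
  ring

/-! ### Lower bounds on the Morse index -/

theorem quadForm_sum [Nonempty E] (hG : G.Connected) (S : SolData G p k Wbar b W ρ u) {N : ℕ}
    {φ : Fin N → G.Point → ℝ} (h : ∀ i, G.MemH1c (φ i))
    (hd : ∀ i j, i ≠ j → ∀ e, ∀ᵐ t ∂volume.restrict (G.openEdge e),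
      G.restr (φ i) e t * G.restr (φ j) e t = 0 ∧
      deriv (G.restr (φ i) e) t * deriv (G.restr (φ j) e) t = 0) (c : Fin N → ℝ) :
    G.quadForm p (fun x => W x + k ^ 2) ρ u (∑ i, c i • φ i) =
      ∑ i, c i ^ 2 * G.quadForm p (fun x => W x + k ^ 2) ρ u (φ i) := by
  have hI : ∀ i, G.EdgeIntegrable fun e t => c i ^ 2 * ((deriv (G.restr (φ i) e) t) ^ 2
      + (G.restr W e t + k ^ 2) * (G.restr (φ i) e t) ^ 2
      - (p - 1) * (S.coeff e t * (G.restr (φ i) e t) ^ 2)) := fun i e =>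
    ((S.integrable_form (h i).1 e).sub
      ((S.integrable_nl hG (h i).1 e).const_mul (p - 1))).const_mul _
  have e1 : ∀ ψ : G.Point → ℝ, G.MemH1 ψ → G.quadForm p (fun x => W x + k ^ 2) ρ u ψ =
      G.integral fun e t => (deriv (G.restr ψ e) t) ^ 2
      + (G.restr W e t + k ^ 2) * (G.restr ψ e t) ^ 2
      - (p - 1) * (S.coeff e t * (G.restr ψ e t) ^ 2) := by
    intro ψ hψ
    rw [quadForm_eq hψ]
    congr 1; funext e t; simp only [coeff, restr]; ring
  simp only [fun i => e1 (φ i) (h i).1, ← integral_const_mul']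
  rw [e1 _ (memH1c_sum Finset.univ h c).1, ← integral_finset_sum' Finset.univ hI]
  refine integral_congr fun e => ?_
  have hdiff : ∀ᵐ t ∂volume.restrict (G.openEdge e), ∀ i,
      DifferentiableAt ℝ (G.restr (φ i) e) t :=
    ae_all_iff.2 fun i => ae_restrict_of_ae (memH1_iff.1 (h i).1 e).1.ae_differentiableAt
  have hd' : ∀ᵐ t ∂volume.restrict (G.openEdge e), ∀ i j, i ≠ j →
      G.restr (φ i) e t * G.restr (φ j) e t = 0 ∧
      deriv (G.restr (φ i) e) t * deriv (G.restr (φ j) e) t = 0 :=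
    ae_all_iff.2 fun i => ae_all_iff.2 fun j => by
      by_cases hij : i = j
      · exact Eventually.of_forall fun t h => absurd hij h
      · filter_upwards [hd i j hij e] with t ht _ using ht
  filter_upwards [hdiff, hd'] with t h1 h2
  have r1 : G.restr (∑ i, c i • φ i) e = fun t => ∑ i, c i * G.restr (φ i) e t := by
    funext t; simp [restr]
  have r2 : deriv (G.restr (∑ i, c i • φ i) e) t = ∑ i, c i * deriv (G.restr (φ i) e) t := by
    rw [r1]
    exact (HasDerivAt.fun_sum fun i _ => (h1 i).hasDerivAt.const_mul (c i)).deriv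
  have sq_sum : ∀ x : Fin N → ℝ, (∀ i j, i ≠ j → x i * x j = 0) →
      (∑ i, c i * x i) ^ 2 = ∑ i, c i ^ 2 * x i ^ 2 := by
    intro x hx
    rw [sq, Finset.sum_mul_sum]
    refine Finset.sum_congr rfl fun i _ => ?_
    rw [Finset.sum_eq_single i]
    · ring
    · intro j _ hj
      rw [mul_mul_mul_comm, hx i j (Ne.symm hj), mul_zero]
    · simp
  rw [r2, r1]
  simp only []
  rw [sq_sum _ fun i j hij => (h2 i j hij).1, sq_sum _ fun i j hij => (h2 i j hij).2,
    Finset.mul_sum, Finset.mul_sum, Finset.mul_sum, ← Finset.sum_add_distrib,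
    ← Finset.sum_sub_distrib]
  exact Finset.sum_congr rfl fun i _ => by ring

/-- With disjoint supports the form is diagonal on the span. Its strict negativity on nonzero
coefficient vectors also gives linear independence, so the span has dimension N. -/
theorem le_morseIndex [Nonempty E] (hG : G.Connected) (S : SolData G p k Wbar b W ρ u) {N : ℕ}
    {φ : Fin N → G.Point → ℝ} (h : ∀ i, G.MemH1c (φ i))
    (hd : ∀ i j, i ≠ j → ∀ e, ∀ᵐ t ∂volume.restrict (G.openEdge e),
      G.restr (φ i) e t * G.restr (φ j) e t = 0 ∧
      deriv (G.restr (φ i) e) t * deriv (G.restr (φ j) e) t = 0)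
    (hQ : ∀ i, G.quadForm p (fun x => W x + k ^ 2) ρ u (φ i) < 0) :
    (N : ℕ∞) ≤ G.morseIndex p (fun x => W x + k ^ 2) ρ u := by
  have hsum := S.quadForm_sum hG h hd
  have hzero : G.quadForm p (fun x => W x + k ^ 2) ρ u 0 = 0 := by
    have := hsum 0
    simpa using this
  have hneg : ∀ c : Fin N → ℝ, c ≠ 0 →
      G.quadForm p (fun x => W x + k ^ 2) ρ u (∑ i, c i • φ i) < 0 := by
    intro c hc
    rw [hsum]
    obtain ⟨i, hi⟩ := Function.ne_iff.1 hc
    exact Finset.sum_neg' (fun j _ => mul_nonpos_of_nonneg_of_nonpos (sq_nonneg _) (hQ j).le)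
      ⟨i, Finset.mem_univ i, mul_neg_of_pos_of_neg (sq_pos_of_ne_zero hi) (hQ i)⟩
  have hli : LinearIndependent ℝ φ := by
    rw [Fintype.linearIndependent_iff]
    intro c hc i
    by_contra hi
    have := hneg c fun h0 => hi (by rw [h0]; rfl)
    rw [hc, hzero] at this
    exact lt_irrefl _ this
  have hmem : ∀ ψ ∈ Submodule.span ℝ (Set.range φ), ∃ c : Fin N → ℝ, ∑ i, c i • φ i = ψ :=
    fun ψ hψ => (Submodule.mem_span_range_iff_exists_fun ℝ).1 hψ
  have hX : FiniteDimensional ℝ (Submodule.span ℝ (Set.range φ)) ∧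
      (∀ ψ ∈ Submodule.span ℝ (Set.range φ), G.MemH1c ψ) ∧
      ∀ ψ ∈ Submodule.span ℝ (Set.range φ), ψ ≠ 0 →
        G.quadForm p (fun x => W x + k ^ 2) ρ u ψ < 0 := by
    refine ⟨FiniteDimensional.span_of_finite ℝ (Set.finite_range φ), fun ψ hψ => ?_,
      fun ψ hψ hne => ?_⟩
    · obtain ⟨c, rfl⟩ := hmem ψ hψ
      exact memH1c_sum _ h c
    · obtain ⟨c, rfl⟩ := hmem ψ hψ
      exact hneg c fun h0 => hne (by simp [h0])
  have hfr : Module.finrank ℝ (Submodule.span ℝ (Set.range φ)) = N := by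
    rw [finrank_span_eq_card hli, Fintype.card_fin]
  unfold morseIndex
  calc (N : ℕ∞) = (Module.finrank ℝ (Submodule.span ℝ (Set.range φ)) : ℕ∞) := by rw [hfr]
    _ ≤ _ := le_iSup₂_of_le (Submodule.span ℝ (Set.range φ)) hX le_rfl

end SolData

end MetricGraph

/-! ### Oscillation of superlinear scalar equations -/

theorem exists_first_eq {f : ℝ → ℝ} {x y c : ℝ} (hf : ContinuousOn f (Set.Icc x y)) (hx : f x < c)
    (h : ∃ t ∈ Set.Icc x y, c ≤ f t) :
    ∃ t ∈ Set.Ioc x y, f t = c ∧ ∀ r ∈ Set.Icc x t, f r ≤ c := by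
  obtain ⟨t₁, ht₁, hct⟩ := h
  have ivt : ∀ r ∈ Set.Icc x y, c ≤ f r → ∃ s ∈ Set.Icc x r, f s = c := by
    intro r hr hcr
    obtain ⟨s, hs, hs'⟩ := intermediate_value_Icc hr.1 (hf.mono (Set.Icc_subset_Icc_right hr.2))
      (show c ∈ Set.Icc (f x) (f r) from ⟨hx.le, hcr⟩)
    exact ⟨s, hs, hs'⟩
  have hcomp : IsCompact (Set.Icc x y ∩ f ⁻¹' {c}) :=
    isCompact_Icc.of_isClosed_subset (hf.preimage_isClosed_of_isClosed isClosed_Icc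
      isClosed_singleton) Set.inter_subset_left
  obtain ⟨s, hs, hsc⟩ := ivt t₁ ht₁ hct
  obtain ⟨t, ⟨ht, htc⟩, hmin⟩ := hcomp.exists_isLeast ⟨s, ⟨hs.1, hs.2.trans ht₁.2⟩, hsc⟩
  have htc : f t = c := htc
  refine ⟨t, ⟨lt_of_le_of_ne ht.1 ?_, ht.2⟩, htc, fun r hr => ?_⟩
  · rintro rfl; exact hx.ne htc
  · by_contra hcon
    push Not at hcon
    obtain ⟨s, hs, hsc⟩ := ivt r ⟨hr.1, hr.2.trans ht.2⟩ hcon.le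
    have h1 := hmin ⟨⟨hs.1, hs.2.trans (hr.2.trans ht.2)⟩, hsc⟩
    have h2 : r = t := le_antisymm hr.2 (h1.trans hs.2)
    rw [h2, htc] at hcon
    exact lt_irrefl _ hcon

/-- One-sided bounds for a solution `v` with derivative `w` of a superlinear equation
`v'' = v - c(t) |v|^(p-2) v`, expressed through increments of `w`. -/
structure OscSide (C₀ k₀ : ℝ) (F D : ℝ → ℝ) (v w : ℝ → ℝ) (α β : ℝ) : Prop where
  upper : ∀ s t, α ≤ s → s ≤ t → t ≤ β → (∀ r ∈ Set.Icc s t, 0 ≤ v r) → w t - w s ≤ C₀ * (t - s)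
  strong : ∀ κ, k₀ ≤ κ → ∀ s t, α ≤ s → s ≤ t → t ≤ β → (∀ r ∈ Set.Icc s t, κ ≤ v r) →
    w t - w s ≤ -F κ * (t - s)
  lower : ∀ K s t, α ≤ s → s ≤ t → t ≤ β → (∀ r ∈ Set.Icc s t, |v r| ≤ K) →
    w t - w s ≤ D K * (t - s)

/-- Bounds for a solution `v` with derivative `w` of a superlinear equation on `[α, β]`. -/
structure Osc (C₀ k₀ : ℝ) (F D : ℝ → ℝ) (v w : ℝ → ℝ) (α β : ℝ) : Prop where
  cont : ContinuousOn v (Set.Icc α β)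
  cont' : ContinuousOn w (Set.Icc α β)
  hasDerivAt : ∀ t ∈ Set.Ioo α β, HasDerivAt v (w t) t
  pos : OscSide C₀ k₀ F D v w α β
  neg : OscSide C₀ k₀ F D (fun t => -v t) (fun t => -w t) α β

namespace Osc

variable {C₀ k₀ : ℝ} {F D : ℝ → ℝ} {v w : ℝ → ℝ} {α β : ℝ}

theorem symm (h : Osc C₀ k₀ F D v w α β) :
    Osc C₀ k₀ F D (fun t => -v t) (fun t => -w t) α β where
  cont := h.cont.neg
  cont' := h.cont'.neg
  hasDerivAt t ht := (h.hasDerivAt t ht).neg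
  pos := h.neg
  neg := by simpa only [neg_neg] using h.pos

theorem _root_.OscSide.mono (h : OscSide C₀ k₀ F D v w α β) {α' : ℝ} (hα : α ≤ α') :
    OscSide C₀ k₀ F D v w α' β where
  upper s t h1 := h.upper s t (hα.trans h1)
  strong κ h0 s t h1 := h.strong κ h0 s t (hα.trans h1)
  lower K s t h1 := h.lower K s t (hα.trans h1)

theorem mono (h : Osc C₀ k₀ F D v w α β) {α' : ℝ} (hα : α ≤ α') :
    Osc C₀ k₀ F D v w α' β where
  cont := h.cont.mono (Set.Icc_subset_Icc_left hα)
  cont' := h.cont'.mono (Set.Icc_subset_Icc_left hα)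
  hasDerivAt t ht := h.hasDerivAt t ⟨hα.trans_lt ht.1, ht.2⟩
  pos := h.pos.mono hα
  neg := h.neg.mono hα

theorem mvt (h : Osc C₀ k₀ F D v w α β) {s t : ℝ} (hs : α ≤ s) (hst : s < t) (ht : t ≤ β) :
    ∃ ξ ∈ Set.Ioo s t, v t - v s = w ξ * (t - s) := by
  obtain ⟨ξ, hξ, h1⟩ := exists_hasDerivAt_eq_slope v w hst
    (h.cont.mono (Set.Icc_subset_Icc hs ht))
    fun x hx => h.hasDerivAt x ⟨hs.trans_lt hx.1, hx.2.trans_le ht⟩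
  refine ⟨ξ, hξ, ?_⟩
  rw [h1, div_mul_cancel₀ _ (sub_ne_zero.2 hst.ne')]

theorem le_of_nonneg (h : Osc C₀ k₀ F D v w α β) {s t : ℝ} (hs : α ≤ s) (hst : s ≤ t)
    (ht : t ≤ β) (hw : ∀ r ∈ Set.Icc s t, 0 ≤ w r) : v s ≤ v t := by
  rcases hst.eq_or_lt with rfl | hst
  · exact le_rfl
  obtain ⟨ξ, hξ, h1⟩ := h.mvt hs hst ht
  have := mul_nonneg (hw ξ ⟨hξ.1.le, hξ.2.le⟩) (sub_nonneg.2 hst.le)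
  linarith

/-- As long as v ≥ κ, w ≤ -F κ (t - α). Over the second half of a unit interval v then loses at
least F κ / 4 ≥ 5κ/4, more than the κ available between 2κ and κ. -/
theorem exists_lt_half (h : Osc C₀ k₀ F D v w α β) {κ : ℝ} (hk : k₀ ≤ κ) (hκ : 0 < κ)
    (hF : 5 * κ ≤ F κ) (hβ : α + 1 ≤ β) (hv : v α = 2 * κ) (hw : w α ≤ 0) :
    ∃ t ∈ Set.Ioc α (α + 1), v t < κ := by
  by_contra hcon
  push Not at hcon
  have hge : ∀ r ∈ Set.Icc α (α + 1), κ ≤ v r := by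
    intro r hr
    rcases hr.1.eq_or_lt with rfl | h1
    · linarith
    · exact hcon r ⟨h1, hr.2⟩
  have hwt : ∀ t ∈ Set.Icc α (α + 1), w t ≤ - F κ * (t - α) := by
    intro t ht
    have := h.pos.strong κ hk α t le_rfl ht.1 (ht.2.trans hβ)
      fun r hr => hge r ⟨hr.1, hr.2.trans ht.2⟩
    linarith
  obtain ⟨ξ, hξ, h1⟩ := h.mvt (s := α) (t := α + 1 / 2) le_rfl (by linarith) (by linarith)
  obtain ⟨ζ, hζ, h2⟩ := h.mvt (s := α + 1 / 2) (t := α + 1) (by linarith) (by linarith) hβ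
  have h3 := hwt ξ ⟨hξ.1.le, by linarith [hξ.2]⟩
  have h4 := hwt ζ ⟨by linarith [hζ.1], hζ.2.le⟩
  have h5 := hge (α + 1) ⟨by linarith, le_rfl⟩
  have h6 : w ξ ≤ 0 := h3.trans (by nlinarith [hξ.1])
  have h7 : w ζ ≤ - F κ / 2 := h4.trans (by nlinarith [hζ.1])
  nlinarith

/-- A drop of κ within unit time forces a slope ≤ -κ somewhere. While v ≥ 0 the slope recovers by at
most 6 C₀ ≤ κ/2, so it stays ≤ -κ/2, and five further units of time bring v below zero. -/
theorem exists_zero (h : Osc C₀ k₀ F D v w α β) {κ : ℝ} (hk : k₀ ≤ κ) (hκ : 0 < κ)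
    (hF : 5 * κ ≤ F κ) (hC : 12 * C₀ ≤ κ) (hC₀ : 0 ≤ C₀) (hβ : α + 6 ≤ β) (hv : v α = 2 * κ)
    (hw : w α ≤ 0) : ∃ z ∈ Set.Ioc α (α + 6), v z = 0 ∧ w z ≤ -(κ / 2) := by
  obtain ⟨t₁, ht₁, hv₁⟩ := h.exists_lt_half hk hκ hF (by linarith) hv hw
  have slope : ∀ t ∈ Set.Ioc α (α + 1), v t < κ → ∀ s, t ≤ s → s ≤ α + 6 →
      (∀ r ∈ Set.Icc α s, 0 ≤ v r) → w s ≤ -(κ / 2) := by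
    intro t ht htκ s hts hs hpos
    obtain ⟨ξ, hξ, h1⟩ := h.mvt le_rfl ht.1 (by linarith [ht.2])
    have h2 : w ξ ≤ -κ := by
      by_contra hcon
      push Not at hcon
      have : t - α ≤ 1 := by linarith [ht.2]
      have h0 : 0 < t - α := by linarith [ht.1]
      nlinarith
    have h3 := h.pos.upper ξ s hξ.1.le (hξ.2.le.trans hts) (hs.trans hβ)
      fun r hr => hpos r ⟨hξ.1.le.trans hr.1, hr.2⟩
    have h4 : C₀ * (s - ξ) ≤ C₀ * 6 := mul_le_mul_of_nonneg_left (by linarith [hξ.1]) hC₀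
    linarith
  have hex : ∃ t ∈ Set.Icc α (α + 6), 0 ≤ -v t := by
    by_contra hcon
    push Not at hcon
    have hpos : ∀ r ∈ Set.Icc α (α + 6), 0 ≤ v r := fun r hr => by linarith [hcon r hr]
    obtain ⟨ζ, hζ, h1⟩ := h.mvt (s := t₁) (t := α + 6) ht₁.1.le (by linarith [ht₁.2]) hβ
    have h2 := slope t₁ ht₁ hv₁ ζ hζ.1.le hζ.2.le fun r hr => hpos r ⟨hr.1, hr.2.trans hζ.2.le⟩
    have h3 := hpos (α + 6) ⟨by linarith, le_rfl⟩
    have h4 : 5 ≤ α + 6 - t₁ := by linarith [ht₁.2]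
    nlinarith
  obtain ⟨z, hz, hz0, hzle⟩ := exists_first_eq (f := fun t => -v t) (c := 0)
    ((h.cont.mono (Set.Icc_subset_Icc_right hβ)).neg) (by linarith) hex
  have hz0 : v z = 0 := by simpa using hz0
  have hpos : ∀ r ∈ Set.Icc α z, 0 ≤ v r := fun r hr => by linarith [hzle r hr]
  refine ⟨z, hz, hz0, ?_⟩
  rcases le_total t₁ z with h1 | h1
  · exact slope t₁ ht₁ hv₁ z h1 hz.2 hpos
  · exact slope z ⟨hz.1, h1.trans ht₁.2⟩ (by rw [hz0]; exact hκ) z le_rfl hz.2 hpos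

/-- While |v| ≤ K, the slope loses at most D K in unit time, so v climbs to K within time 1. Above K
the superlinear force turns it around within one more unit. -/
theorem exists_peak (h : Osc C₀ k₀ F D v w α β) {K : ℝ} (hK : 0 < K) (hk : k₀ ≤ K)
    (hF : ∀ κ, K ≤ κ → 5 * κ ≤ F κ) (hβ : α + 2 ≤ β) (hv : v α = 0)
    (hw : D K + K + 1 ≤ w α) (hD : 0 ≤ D K) :
    ∃ y ∈ Set.Ioc α (α + 2), K ≤ v y ∧ w y ≤ 0 := by
  have hwlow : ∀ t ∈ Set.Icc α (α + 1), (∀ r ∈ Set.Icc α t, |v r| ≤ K) → K + 1 ≤ w t := by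
    intro t ht hr
    have := h.neg.lower K α t le_rfl ht.1 (by linarith [ht.2]) fun r hr' => by
      rw [abs_neg]; exact hr r hr'
    have h2 : D K * (t - α) ≤ D K * 1 := mul_le_mul_of_nonneg_left (by linarith [ht.2]) hD
    linarith
  have hex : ∃ t ∈ Set.Icc α (α + 1), K ≤ |v t| := by
    by_contra hcon
    push Not at hcon
    obtain ⟨ξ, hξ, h1⟩ := h.mvt (s := α) (t := α + 1) le_rfl (by linarith) (by linarith)
    have h2 := hwlow ξ ⟨hξ.1.le, hξ.2.le⟩ fun r hr => (hcon r ⟨hr.1, hr.2.trans hξ.2.le⟩).le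
    have h3 := hcon (α + 1) ⟨by linarith, le_rfl⟩
    have h4 := (abs_lt.1 h3).2
    linarith
  obtain ⟨t, ht, htK, htle⟩ := exists_first_eq
    (h.cont.mono (Set.Icc_subset_Icc_right (by linarith : α + 1 ≤ β))).abs
    (by simpa [hv] using hK) hex
  have hvt : v t = K := by
    have h1 : v α ≤ v t := h.le_of_nonneg le_rfl ht.1.le (by linarith [ht.2]) fun r hr => by
      have := hwlow r ⟨hr.1, hr.2.trans ht.2⟩ fun s hs => htle s ⟨hs.1, hs.2.trans hr.2⟩
      linarith
    rw [hv] at h1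
    rwa [abs_of_nonneg h1] at htK
  have hwt : 0 < w t := by
    have := hwlow t ⟨ht.1.le, ht.2⟩ htle
    linarith
  have hex' : ∃ y ∈ Set.Icc t (t + 1), 0 ≤ - w y := by
    by_contra hcon
    push Not at hcon
    have hmono : ∀ r s, t ≤ r → r ≤ s → s ≤ t + 1 → v r ≤ v s := fun r s h1 h2 h3 =>
      h.le_of_nonneg (ht.1.le.trans h1) h2 (by linarith [ht.2]) fun q hq => by
        linarith [hcon q ⟨h1.trans hq.1, hq.2.trans h3⟩]
    obtain ⟨ξ, hξ, h1⟩ := h.mvt (s := t) (t := t + 1 / 2) ht.1.le (by linarith)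
      (by linarith [ht.2])
    set v₀ := v (t + 1 / 2)
    -- If w stayed positive, w ξ = 2(v₀ - K) at some point of the first half, whereas over the
    -- second half w loses F v₀ / 2 ≥ 5 v₀ / 2; it would end negative.
    have hKv : K ≤ v₀ := hvt ▸ hmono t (t + 1 / 2) le_rfl (by linarith) (by linarith)
    have h2 := h.pos.strong K hk ξ (t + 1 / 2) (by linarith [hξ.1, ht.1]) hξ.2.le
      (by linarith [ht.2]) fun r hr => hvt ▸ hmono t r le_rfl (hξ.1.le.trans hr.1)
        (by linarith [hr.2])
    have h3 := h.pos.strong v₀ (hk.trans hKv) (t + 1 / 2) (t + 1) (by linarith [ht.1])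
      (by linarith) (by linarith [ht.2]) fun r hr => hmono (t + 1 / 2) r (by linarith) hr.1 hr.2
    have h4 := hcon (t + 1) ⟨by linarith, le_rfl⟩
    have h5 := hF v₀ hKv
    have h6 : 0 ≤ F K * (t + 1 / 2 - ξ) :=
      mul_nonneg (by linarith [hF K le_rfl]) (by linarith [hξ.2])
    linarith
  obtain ⟨y, hy, hy0, hyle⟩ := exists_first_eq (f := fun t => -w t) (c := 0)
    ((h.cont'.mono (Set.Icc_subset_Icc ht.1.le (by linarith [ht.2] : t + 1 ≤ β))).neg)
    (by linarith) hex'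
  refine ⟨y, ⟨by linarith [ht.1, hy.1], by linarith [ht.2, hy.2]⟩, ?_, by linarith⟩
  exact hvt ▸ h.le_of_nonneg ht.1.le hy.1.le (by linarith [ht.2, hy.2])
    fun r hr => by linarith [hyle r hr]

/-- From a large value with inward slope, the solution crosses zero and then reaches a large value
of the opposite sign. -/
theorem exists_step (C₀ k₀ : ℝ) (F D : ℝ → ℝ) (hC₀ : 0 ≤ C₀) (hD : ∀ K, 0 ≤ K → 0 ≤ D K)
    (hF : ∀ᶠ κ in atTop, 5 * κ ≤ F κ) (K₁ : ℝ) :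
    ∃ A, ∀ v w α β, Osc C₀ k₀ F D v w α β → α + 8 ≤ β → A ≤ v α → w α ≤ 0 →
      ∃ z y, α < z ∧ z < y ∧ y ≤ α + 8 ∧ v z = 0 ∧ v y ≤ -K₁ ∧ 0 ≤ w y := by
  obtain ⟨κ₀, hκ₀⟩ := eventually_atTop.1 hF
  set K := max (max K₁ 1) (max k₀ κ₀) with hKdef
  have hK1 : K₁ ≤ K := (le_max_left _ _).trans (le_max_left _ _)
  have hK2 : 1 ≤ K := (le_max_right _ _).trans (le_max_left _ _)
  have hK3 : k₀ ≤ K := (le_max_left _ _).trans (le_max_right _ _)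
  have hK4 : κ₀ ≤ K := (le_max_right _ _).trans (le_max_right _ _)
  have hDK := hD K (by linarith)
  -- With κ = v α / 2, this value gives both 12 C₀ ≤ κ and a crossing slope κ/2 ≥ D K + K + 1, as
  -- needed for the descent and for the next peak.
  refine ⟨4 * (D K + K + 1) + 24 * C₀, fun v w α β h hβ hv hw => ?_⟩
  have hκ : D K + K + 1 ≤ (v α / 2) / 2 := by linarith
  obtain ⟨z, hz, hz0, hzw⟩ := h.exists_zero (κ := v α / 2) (by linarith) (by linarith)
    (hκ₀ _ (by linarith)) (by linarith) hC₀ (by linarith) (by ring) hw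
  obtain ⟨y, hy, hyK, hyw⟩ := (h.mono hz.1.le).symm.exists_peak (K := K) (by linarith) hK3
    (fun κ hκ => hκ₀ κ (hK4.trans hκ)) (by linarith [hz.2]) (by simp [hz0]) (by linarith) hDK
  exact ⟨z, y, hz.1, hy.1, by linarith [hy.2, hz.2], hz0, by linarith, by linarith⟩

/-- Iterates the step on the reflected solution; each one takes time 6 + 2 = 8. The target `max A'
1` is large enough to restart, and the 1 makes v nonzero at the peak between consecutive zeros. -/
theorem exists_many_zeros (C₀ k₀ : ℝ) (F D : ℝ → ℝ) (hC₀ : 0 ≤ C₀) (hD : ∀ K, 0 ≤ K → 0 ≤ D K)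
    (hF : ∀ᶠ κ in atTop, 5 * κ ≤ F κ) (N : ℕ) :
    ∃ A, ∀ v w α β, Osc C₀ k₀ F D v w α β → α + 8 * N ≤ β → A ≤ v α → w α ≤ 0 →
      ∃ z y : ℕ → ℝ, ∀ i < N, α < z i ∧ z i < y i ∧ y i ≤ α + 8 * N ∧ v (z i) = 0 ∧ v (y i) ≠ 0 ∧
        (i + 1 < N → y i < z (i + 1)) := by
  induction N with
  | zero => exact ⟨0, fun _ _ _ _ _ _ _ _ => ⟨0, 0, fun i hi => absurd hi (Nat.not_lt_zero i)⟩⟩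
  | succ N ih =>
    obtain ⟨A', hA'⟩ := ih
    obtain ⟨A, hA⟩ := exists_step C₀ k₀ F D hC₀ hD hF (max A' 1)
    refine ⟨A, fun v w α β h hβ hv hw => ?_⟩
    push_cast at hβ ⊢
    have hN : (0:ℝ) ≤ N := Nat.cast_nonneg N
    obtain ⟨z, y, h1, h2, h3, h4, h5, h6⟩ := hA v w α β h (by linarith) hv hw
    have h5' : v y ≤ -A' := h5.trans (neg_le_neg (le_max_left _ _))
    have h5'' : v y ≤ -1 := h5.trans (neg_le_neg (le_max_right _ _))
    obtain ⟨zs, ys, hzy⟩ := hA' (fun t => -v t) (fun t => -w t) y β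
      (h.mono (h1.le.trans h2.le)).symm (by linarith) (by linarith) (by linarith)
    refine ⟨fun i => Nat.casesOn i z zs, fun i => Nat.casesOn i y ys, fun i hi => ?_⟩
    cases i with
    | zero =>
      refine ⟨h1, h2, show y ≤ α + 8 * ((N : ℝ) + 1) by linarith, h4,
        fun h0 : v y = 0 => by linarith, fun hi' => ?_⟩
      exact (hzy 0 (by omega)).1
    | succ i =>
      obtain ⟨g1, g2, g3, g4, g5, g6⟩ := hzy i (by omega)
      refine ⟨show α < zs i by linarith, g2, show ys i ≤ α + 8 * ((N : ℝ) + 1) by linarith,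
        by simpa using g4,
        by simpa using g5, fun hi' => g6 (by omega)⟩

end Osc

namespace MetricGraph

variable {V E : Type*} {G : MetricGraph V E}

/-! ### Functions supported in one edge -/

open scoped Classical in
/-- The function on the graph given by `f` in the interior of the edge `e`, and `0` elsewhere. -/
def single (e : E) (f : ℝ → ℝ) : G.Point → ℝ
  | .vertex _ => 0
  | .interior e' t _ _ => if e' = e then f t else 0

theorem exists_coord_eq_vertex {e : E} {t : ℝ} (h : t ∉ G.openEdge e) :
    ∃ v, G.coord e t = .vertex v := by
  unfold coord
  split_ifs with h0 h1
  · exact absurd ⟨h0, h1⟩ h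
  · exact ⟨_, rfl⟩
  · exact ⟨_, rfl⟩

theorem restr_single_self {e : E} {f : ℝ → ℝ} (hf : ∀ t, t ∉ G.openEdge e → f t = 0) :
    G.restr (single e f) e = f := by
  funext t
  by_cases ht : t ∈ G.openEdge e
  · simp [restr, coord_of_mem ht, single]
  · obtain ⟨v, hv⟩ := exists_coord_eq_vertex ht
    simp [restr, hv, single, hf t ht]

theorem restr_single_of_ne {e e' : E} (f : ℝ → ℝ) (h : e' ≠ e) :
    G.restr (single e f) e' = fun _ => 0 := by
  funext t
  by_cases ht : t ∈ G.openEdge e'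
  · simp [restr, coord_of_mem ht, single, h]
  · obtain ⟨v, hv⟩ := exists_coord_eq_vertex ht
    simp [restr, hv, single]

/-- The image of `[x, y]` is closed in the quotient topology because, `[x, y]` being interior to the
edge, its preimage is `[x, y]` on `e` and empty on every other edge. -/
theorem memH1c_single {e : E} {f : ℝ → ℝ} {x y : ℝ} (hxy : Set.Icc x y ⊆ G.openEdge e)
    (hf : LocAC f) (hz : ∀ t, t ∉ Set.Icc x y → f t = 0)
    (hd : MemLp (deriv f) 2 (volume.restrict (G.openEdge e))) : G.MemH1c (single e f) := by
  have hz' : ∀ t, t ∉ G.openEdge e → f t = 0 := fun t ht => hz t fun h => ht (hxy h)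
  constructor
  · rw [memH1_iff]
    intro e'
    by_cases h : e' = e
    · subst h
      rw [restr_single_self hz']
      refine ⟨hf, ?_, hd⟩
      have hc : HasCompactSupport f := HasCompactSupport.intro isCompact_Icc hz
      exact (hf.continuous.memLp_of_hasCompactSupport hc).restrict _
    · rw [restr_single_of_ne f h, deriv_const']
      exact ⟨LocAC.of_lipschitz (K := 0) (by simp), MemLp.zero', MemLp.zero'⟩
  · refine HasCompactSupport.intro' (K := G.coord e '' Set.Icc x y)
      (isCompact_Icc.image (continuous_coord e)) (isClosed_iff_preimage_coord.2 fun e' => ?_) ?_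
    · by_cases h : e' = e
      · subst h
        convert isClosed_Icc (a := x) (b := y)
        ext t
        constructor
        · rintro ⟨s, hs, hst⟩
          rw [(coord_eq_coord (hxy hs) hst.symm).2]; exact hs
        · exact fun ht => ⟨t, ht, rfl⟩
      · convert isClosed_empty
        ext t
        simp only [Set.mem_preimage, Set.mem_image, Set.mem_empty_iff_false, iff_false]
        rintro ⟨s, hs, hst⟩
        exact h (coord_eq_coord (hxy hs) hst.symm).1
    · intro q hq
      cases q with
      | vertex v => rfl
      | interior e' t h0 h1 =>
        simp only [single]
        split_ifs with h
        · subst h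
          refine hz t fun ht => hq ⟨t, ht, coord_of_mem (hxy ht)⟩
        · rfl

theorem integral_eq_single [Fintype E] (e : E) {f : E → ℝ → ℝ}
    (h : ∀ e', e' ≠ e → ∀ t, f e' t = 0) : G.integral f = ∫ t in G.openEdge e, f e t := by
  classical
  unfold integral
  rw [Finset.sum_eq_single e]
  · intro e' _ he'
    simp only [h e' he', MeasureTheory.integral_zero]
  · simp

namespace SolData

variable [Fintype E] {p k Wbar b : ℝ} {W ρ u : G.Point → ℝ}

/-! ### Regularity on the edges -/

/-- The second derivative of `u`. -/
def accel (S : SolData G p k Wbar b W ρ u) (e : E) (t : ℝ) : ℝ :=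
  (G.restr W e t + k ^ 2 - S.coeff e t) * G.restr u e t

theorem memLp_accel [Nonempty E] (hG : G.Connected) (S : SolData G p k Wbar b W ρ u) (e : E) :
    MemLp (S.accel e) 2 (volume.restrict (G.openEdge e)) := by
  obtain ⟨C, hC⟩ := S.exists_abs_coeff_le hG
  have h := (memH1_iff.1 S.memH1 e).2.1
  refine MemLp.of_le_mul (c := 2 * k ^ 2 + C) h
    (((S.aesm_pot e).sub (S.aesm_coeff e)).mul h.1) ?_
  filter_upwards [S.abs_pot_le e, hC e] with t h1 h2
  rw [accel, norm_mul]
  refine mul_le_mul_of_nonneg_right ?_ (norm_nonneg _)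
  exact (norm_sub_le _ _).trans (add_le_add h1 h2)

/-- W and ρ are merely measurable, so u'' exists only as an L² function. Its primitive w is the
continuous representative of u', and the equation is used later only through increments of w. -/
theorem exists_deriv [Nonempty E] (hG : G.Connected) (S : SolData G p k Wbar b W ρ u) (e : E) :
    ∃ w : ℝ → ℝ, Continuous w ∧ (∀ t ∈ G.openEdge e, HasDerivAt (G.restr u e) (w t) t) ∧
      ∀ s ∈ G.closedEdge e, ∀ t ∈ G.closedEdge e, s ≤ t →
        IntegrableOn (S.accel e) (Set.Ioo s t) ∧ w t - w s = ∫ r in Set.Ioo s t, S.accel e r := by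
  obtain ⟨hac, h2, h3⟩ := memH1_iff.1 S.memH1 e
  set f := G.restr u e
  have hF := S.memLp_accel hG e
  have hweak : HasWeakDeriv (G.openEdge e) (deriv f) (S.accel e) := by
    intro φ g1 g2 g3
    have hz : ∀ t, t ∉ G.openEdge e → φ t = 0 := fun t ht =>
      image_eq_zero_of_notMem_tsupport fun hs => ht (g3 hs)
    obtain ⟨x, y, hxy, hz2⟩ : ∃ x y, Set.Icc x y ⊆ G.openEdge e ∧
        ∀ t, t ∉ Set.Icc x y → φ t = 0 := by
      by_cases hn : (tsupport φ).Nonempty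
      · refine ⟨sInf (tsupport φ), sSup (tsupport φ), (ordConnected_openEdge e).out
          (g3 (g2.isCompact.sInf_mem hn)) (g3 (g2.isCompact.sSup_mem hn)), fun t ht => ?_⟩
        refine image_eq_zero_of_notMem_tsupport fun hs => ht ?_
        exact ⟨csInf_le g2.isCompact.bddBelow hs, le_csSup g2.isCompact.bddAbove hs⟩
      · refine ⟨1, 0, by simp, fun t _ => image_eq_zero_of_notMem_tsupport fun hs => hn ⟨t, hs⟩⟩
    have hφac : LocAC φ := LocAC.of_contDiff (g1.of_le (by simp))
    have hd : MemLp (deriv φ) 2 (volume.restrict (G.openEdge e)) :=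
      ((g1.continuous_deriv (by simp)).memLp_of_hasCompactSupport g2.deriv).restrict _
    have hmem := memH1c_single hxy hφac hz2 hd
    have hw := S.weak_eq hmem
    rw [integral_eq_single e, integral_eq_single e, restr_single_self hz] at hw
    · have i1 : IntegrableOn (fun t => deriv f t * deriv φ t) (G.openEdge e) :=
        h3.integrable_mul hd
      have hφ2 : MemLp φ 2 (volume.restrict (G.openEdge e)) :=
        (g1.continuous.memLp_of_hasCompactSupport g2).restrict _
      have i2 := integrable_bdd_mul_mul (S.aesm_pot e) (S.abs_pot_le e) h2 hφ2
      obtain ⟨C, hC⟩ := S.exists_abs_coeff_le hG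
      have i3 := integrable_bdd_mul_mul (S.aesm_coeff e) (hC e) h2 hφ2
      rw [MeasureTheory.integral_add i1 i2] at hw
      have : ∫ t in G.openEdge e, S.accel e t * φ t =
          (∫ t in G.openEdge e, (G.restr W e t + k ^ 2) * (f t * φ t)) -
          ∫ t in G.openEdge e, S.coeff e t * (f t * φ t) := by
        rw [← MeasureTheory.integral_sub i2 i3]
        congr 1; funext t; simp only [accel]; ring
      rw [this]
      linarith
    · intro e' he' t
      rw [restr_single_of_ne φ he']; ring
    · intro e' he' t
      rw [restr_single_of_ne φ he', deriv_const']; ring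
  obtain ⟨t₀, ht₀⟩ := exists_mem_openEdge (G := G) e
  have hFl := locallyIntegrable_indicator hF
  obtain ⟨c, hc⟩ := hweak.exists_primitive (isOpen_openEdge e) (ordConnected_openEdge e) ht₀
    (locallyIntegrable_indicator h3) hFl
  set w : ℝ → ℝ := fun t => c + ∫ s in t₀..t, (G.openEdge e).indicator (S.accel e) s with hw
  have hwc : Continuous w := continuous_const.add (LocAC.primitive hFl t₀).continuous
  have hii : ∀ x y, IntervalIntegrable ((G.openEdge e).indicator (S.accel e)) volume x y :=
    fun x y => intervalIntegrable_iff.2 ((hFl.integrableOn_isCompact isCompact_uIcc).mono_set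
      Set.uIoc_subset_uIcc)
  refine ⟨w, hwc, fun t ht => ?_, fun s hs t ht hst => ?_⟩
  · have h4 : ∀ r ∈ G.openEdge e, f r = f t + ∫ x in t..r, w x := by
      intro r hr
      have : ∫ x in t..r, w x = ∫ x in t..r, deriv f x := by
        refine intervalIntegral.integral_congr_ae ?_
        rw [ae_restrict_iff' (measurableSet_openEdge e)] at hc
        filter_upwards [hc] with x hx hxm
        exact (hx ((ordConnected_openEdge e).uIcc_subset ht hr (Set.uIoc_subset_uIcc hxm))).symm
      rw [this, hac.integral_deriv]
      ring
    have h5 : HasDerivAt (fun r => f t + ∫ x in t..r, w x) (w t) t :=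
      (intervalIntegral.integral_hasDerivAt_right (hwc.intervalIntegrable _ _)
        (hwc.stronglyMeasurableAtFilter _ _) hwc.continuousAt).const_add _
    refine h5.congr_of_eventuallyEq ?_
    filter_upwards [(isOpen_openEdge e).mem_nhds ht] with r hr
    exact h4 r hr
  · have hsub : Set.Ioo s t ⊆ G.openEdge e := Ioo_subset_openEdge hs ht
    constructor
    · have := ((hii s t).1).mono_set (Set.Ioo_subset_Ioc_self)
      refine this.congr_fun (fun r hr => ?_) measurableSet_Ioo
      exact Set.indicator_of_mem (hsub hr) _
    · have h6 := intervalIntegral.integral_add_adjacent_intervals (hii t₀ s) (hii s t)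
      have h7 : ∫ r in s..t, (G.openEdge e).indicator (S.accel e) r =
          ∫ r in Set.Ioo s t, S.accel e r := by
        rw [intervalIntegral.integral_of_le hst, integral_Ioc_eq_integral_Ioo]
        refine setIntegral_congr_fun measurableSet_Ioo fun r hr => ?_
        exact Set.indicator_of_mem (hsub hr) _
      simp only [hw]
      linarith

/-! ### Nodal test functions -/

/-- The restriction of a locally absolutely continuous function to an interval between two zeros. -/
theorem _root_.LocAC.indicator_Icc {f : ℝ → ℝ} (hf : LocAC f) {x y : ℝ} (hxy : x ≤ y)
    (hx : f x = 0) (hy : f y = 0) : LocAC ((Set.Icc x y).indicator f) ∧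
    ∀ᵐ t : ℝ, deriv ((Set.Icc x y).indicator f) t = (Set.Icc x y).indicator (deriv f) t := by
  have hli : LocallyIntegrable ((Set.Icc x y).indicator (deriv f)) := by
    have : IntegrableOn (deriv f) (Set.Icc x y) := by
      rw [integrableOn_Icc_iff_integrableOn_Ioc]
      exact (hf.intervalIntegrable_deriv x y).1
    exact (this.integrable_indicator measurableSet_Icc).locallyIntegrable
  have heq : (Set.Icc x y).indicator f =
      fun t => ∫ s in x..t, (Set.Icc x y).indicator (deriv f) s := by
    funext t
    have hcong : ∀ t ∈ Set.Icc x y,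
        ∫ s in x..t, (Set.Icc x y).indicator (deriv f) s = f t - f x := by
      intro t ht
      rw [← hf.integral_deriv x t]
      refine intervalIntegral.integral_congr fun s hs => ?_
      rw [Set.uIcc_of_le ht.1] at hs
      have hs' : s ∈ Set.Icc x y := ⟨hs.1, hs.2.trans ht.2⟩
      simp only [Set.indicator_of_mem hs']
    by_cases ht : t ∈ Set.Icc x y
    · rw [Set.indicator_of_mem ht, hcong t ht, hx, sub_zero]
    · rw [Set.indicator_of_notMem ht]
      have hii : ∀ a b, IntervalIntegrable ((Set.Icc x y).indicator (deriv f)) volume a b :=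
        fun a b => intervalIntegrable_iff.2 ((hli.integrableOn_isCompact isCompact_uIcc).mono_set
          Set.uIoc_subset_uIcc)
      rcases lt_or_ge t x with h | h
      · symm
        refine intervalIntegral.integral_zero_ae ?_
        have : ∀ᵐ s : ℝ, s ≠ x := by simp [ae_iff]
        filter_upwards [this] with s hs hs'
        rw [Set.uIoc_of_ge h.le] at hs'
        exact Set.indicator_of_notMem (s := Set.Icc x y) (fun h' => hs (le_antisymm hs'.2 h'.1)) _
      · have hyt : y < t := by
          by_contra hc; exact ht ⟨h, not_lt.1 hc⟩
        have h0 : ∫ s in y..t, (Set.Icc x y).indicator (deriv f) s = 0 := by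
          refine intervalIntegral.integral_zero_ae (Eventually.of_forall fun s hs => ?_)
          rw [Set.uIoc_of_le hyt.le] at hs
          exact Set.indicator_of_notMem (s := Set.Icc x y) (fun h' => not_lt.2 h'.2 hs.1) _
        rw [← intervalIntegral.integral_add_adjacent_intervals (hii x y) (hii y t),
          hcong y ⟨hxy, le_rfl⟩, hx, hy, h0]
        simp
  have h1 := LocAC.primitive hli x
  have h2 := LocAC.deriv_primitive hli x
  rw [← heq] at h1 h2
  exact ⟨h1, h2⟩

/-- Disjoint nodal intervals on an edge where `ρ` is bounded below contribute to the Morse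
index. -/
theorem le_morseIndex_of_nodal [Nonempty E] (hG : G.Connected) (S : SolData G p k Wbar b W ρ u)
    {a : ℝ} (ha : 0 < a) {e : E}
    (hρ : ∀ᵐ t ∂volume.restrict (G.openEdge e), a ≤ G.restr ρ e t) {N : ℕ} (x y : Fin N → ℝ)
    (hx : ∀ i, x i ∈ G.openEdge e) (hy : ∀ i, y i ∈ G.openEdge e)
    (hux : ∀ i, G.restr u e (x i) = 0) (huy : ∀ i, G.restr u e (y i) = 0)
    (hne : ∀ i, ∃ t ∈ Set.Icc (x i) (y i), G.restr u e t ≠ 0)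
    (hdisj : ∀ i j, i ≠ j → ∀ t, t ∈ Set.Ioo (x i) (y i) → t ∉ Set.Icc (x j) (y j)) :
    (N : ℕ∞) ≤ G.morseIndex p (fun x => W x + k ^ 2) ρ u := by
  obtain ⟨hac, h2, h3⟩ := memH1_iff.1 S.memH1 e
  set f := G.restr u e with hf
  set g : Fin N → ℝ → ℝ := fun i => (Set.Icc (x i) (y i)).indicator f with hg
  have hxy : ∀ i, x i ≤ y i := fun i => by
    obtain ⟨t, ht, _⟩ := hne i
    exact ht.1.trans ht.2
  have hsub : ∀ i, Set.Icc (x i) (y i) ⊆ G.openEdge e := fun i =>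
    (ordConnected_openEdge e).out (hx i) (hy i)
  have hgac : ∀ i, LocAC (g i) := fun i => (hac.indicator_Icc (hxy i) (hux i) (huy i)).1
  have hgd : ∀ i, ∀ᵐ t : ℝ, deriv (g i) t = (Set.Icc (x i) (y i)).indicator (deriv f) t :=
    fun i => (hac.indicator_Icc (hxy i) (hux i) (huy i)).2
  have hz : ∀ i t, t ∉ Set.Icc (x i) (y i) → g i t = 0 := fun i t ht =>
    Set.indicator_of_notMem ht _
  have hzo : ∀ i t, t ∉ G.openEdge e → g i t = 0 := fun i t ht => hz i t fun h => ht (hsub i h)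
  have hdL : ∀ i, MemLp (deriv (g i)) 2 (volume.restrict (G.openEdge e)) := fun i =>
    (h3.indicator (measurableSet_Icc (a := x i) (b := y i))).ae_eq (by
      filter_upwards [ae_restrict_of_ae (hgd i)] with t ht using ht.symm)
  have hmem : ∀ i, G.MemH1c (single e (g i)) := fun i =>
    memH1c_single (hsub i) (hgac i) (hz i) (hdL i)
  have hrs : ∀ i, G.restr (single e (g i)) e = g i := fun i => restr_single_self (hzo i)
  refine S.le_morseIndex hG (φ := fun i => single e (g i)) hmem (fun i j hij e' => ?_) fun i => ?_
  · by_cases he : e' = e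
    · subst he
      have hb : ∀ᵐ t : ℝ, t ≠ x i := by simp [ae_iff]
      have hb' : ∀ᵐ t : ℝ, t ≠ y i := by simp [ae_iff]
      refine ae_restrict_of_ae ?_
      filter_upwards [hgd i, hgd j, hb, hb'] with t d1 d2 n1 n2
      rw [hrs, hrs, d1, d2]
      by_cases hti : t ∈ Set.Icc (x i) (y i)
      · have := hdisj i j hij t ⟨lt_of_le_of_ne hti.1 (Ne.symm n1), lt_of_le_of_ne hti.2 n2⟩
        rw [hz j t this, Set.indicator_of_notMem this]
        simp
      · rw [hz i t hti, Set.indicator_of_notMem hti]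
        simp
    · refine Eventually.of_forall fun t => ?_
      simp only [restr_single_of_ne _ he, deriv_const', mul_zero, and_self]
  · have hQ := S.quadForm_nodal hG (hmem i) (fun e' => by
      by_cases he : e' = e
      · subst he
        refine ae_restrict_of_ae ?_
        filter_upwards [hgd i] with t d1
        rw [hrs, d1]
        by_cases hti : t ∈ Set.Icc (x i) (y i)
        · simp only [hg, Set.indicator_of_mem hti]
          constructor <;> rw [← hf] <;> ring
        · simp only [hg, Set.indicator_of_notMem hti]
          constructor <;> ring
      · refine Eventually.of_forall fun t => ?_
        simp only [restr_single_of_ne _ he, deriv_const']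
        constructor <;> ring)
    rw [hQ]
    have hp := S.two_lt
    have hnl : 0 < S.nl (single e (g i)) := by
      have e1 : S.nl (single e (g i)) = ∫ t in G.openEdge e, S.coeff e t * (g i t) ^ 2 := by
        rw [nl, integral_eq_single e, hrs]
        intro e' he' t
        rw [restr_single_of_ne _ he']; ring
      -- A continuous minorant of the integrand, available because ρ ≥ a: its integral is positive
      -- as soon as it is nonzero at one point.
      set ψ : ℝ → ℝ := fun t => a * (|g i t| ^ (p - 2) * (g i t) ^ 2) with hψ
      have hψc : Continuous ψ := continuous_const.mul
        (((hgac i).continuous.abs.rpow_const fun t => Or.inr (by linarith)).mul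
          ((hgac i).continuous.pow 2))
      have hψs : HasCompactSupport ψ := HasCompactSupport.intro
        (isCompact_Icc (a := x i) (b := y i)) fun t ht => by simp [hψ, hz i t ht]
      have hψ0 : 0 < ∫ t, ψ t := by
        obtain ⟨t, ht, htne⟩ := hne i
        refine hψc.integral_pos_of_hasCompactSupport_nonneg_nonzero hψs (fun t => ?_) (x := t) ?_
        · exact mul_nonneg ha.le (mul_nonneg (Real.rpow_nonneg (abs_nonneg _) _) (sq_nonneg _))
        · have : g i t ≠ 0 := by simpa only [hg, Set.indicator_of_mem ht] using htne
          have h5 : 0 < |g i t| ^ (p - 2) := Real.rpow_pos_of_pos (abs_pos.2 this) _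
          simp only [hψ]
          positivity
      have e2 : ∫ t, ψ t = ∫ t in G.openEdge e, ψ t :=
        (setIntegral_eq_integral_of_forall_compl_eq_zero fun t ht => by
          simp [hψ, hzo i t ht]).symm
      rw [e1]
      refine hψ0.trans_le (e2 ▸ ?_)
      have hint := S.integrable_nl hG (hmem i).1 e
      simp only [hrs] at hint
      refine integral_mono_ae (hψc.integrable_of_hasCompactSupport hψs).integrableOn hint ?_
      filter_upwards [hρ] with t ht
      simp only [hψ, coeff]
      by_cases hti : t ∈ Set.Icc (x i) (y i)
      · simp only [hg, Set.indicator_of_mem hti, ← hf, ← mul_assoc]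
        refine mul_le_mul_of_nonneg_right ?_ (sq_nonneg _)
        exact mul_le_mul_of_nonneg_right ht (Real.rpow_nonneg (abs_nonneg _) _)
      · simp only [hg, Set.indicator_of_notMem hti]
        simp
    have : 0 < (p - 2) * S.nl (single e (g i)) := mul_pos (by linarith) hnl
    linarith

end SolData

end MetricGraph

/-! ### The rescaled nonlinearity -/

section Nonlinearity

variable {a b q θ r y : ℝ}

theorem threshold_pos (q : ℝ) (ha : 0 < a) : 0 < (4 / a) ^ (1 / q) :=
  Real.rpow_pos_of_pos (by positivity) _

theorem four_le_of_threshold_le (hq : 0 < q) (ha : 0 < a) (h : (4 / a) ^ (1 / q) ≤ y) :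
    4 ≤ a * y ^ q := by
  have h1 := Real.rpow_le_rpow (threshold_pos q ha).le h hq.le
  rw [← Real.rpow_mul (by positivity), one_div_mul_cancel hq.ne', Real.rpow_one] at h1
  rwa [div_le_iff₀ ha, mul_comm] at h1

/-- Above the threshold (4/a)^(1/q), a κ^q ≥ 4 ≥ 2θ, so half of the nonlinear term already absorbs
the linear one. -/
theorem nonlin_strong {κ : ℝ} (hq : 0 < q) (ha : 0 < a) (hθ : θ ≤ 2) (hr : a ≤ r)
    (hκ : (4 / a) ^ (1 / q) ≤ κ) (hy : κ ≤ y) :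
    (θ - r * |y| ^ q) * y ≤ -(κ * (a * κ ^ q / 2)) := by
  have hκ0 : 0 < κ := (threshold_pos q ha).trans_le hκ
  have h4 := four_le_of_threshold_le hq ha hκ
  rw [abs_of_pos (hκ0.trans_le hy)]
  have h1 : κ ^ q ≤ y ^ q := Real.rpow_le_rpow hκ0.le hy hq.le
  have h2 : a * κ ^ q ≤ r * y ^ q :=
    mul_le_mul hr h1 (Real.rpow_nonneg hκ0.le _) (ha.le.trans hr)
  have h3 : θ - r * y ^ q ≤ -(a * κ ^ q / 2) := by linarith
  have h5 : 0 ≤ a * κ ^ q / 2 := by linarith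
  nlinarith

theorem nonlin_upper (hq : 0 < q) (ha : 0 < a) (hθ : θ ≤ 2) (hr : a ≤ r) (hy : 0 ≤ y) :
    (θ - r * |y| ^ q) * y ≤ 2 * (4 / a) ^ (1 / q) := by
  have h0 := threshold_pos q ha
  rcases le_total y ((4 / a) ^ (1 / q)) with h | h
  · have h1 : 0 ≤ r * |y| ^ q := mul_nonneg (ha.le.trans hr) (Real.rpow_nonneg (abs_nonneg _) _)
    nlinarith
  · have h1 := nonlin_strong hq ha hθ hr le_rfl h
    have h4 := four_le_of_threshold_le hq ha le_rfl
    have h2 : 0 ≤ (4 / a) ^ (1 / q) * (a * ((4 / a) ^ (1 / q)) ^ q / 2) :=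
      mul_nonneg h0.le (by linarith)
    linarith

theorem nonlin_lower {K : ℝ} (hq : 0 < q) (hθ0 : 0 ≤ θ) (hθ : θ ≤ 2) (hr0 : 0 ≤ r) (hr : r ≤ b)
    (hy : |y| ≤ K) : (θ - r * |y| ^ q) * y ≤ 2 * K + b * K ^ q * K := by
  have hK : 0 ≤ K := (abs_nonneg y).trans hy
  have h1 : |y| ^ q ≤ K ^ q := Real.rpow_le_rpow (abs_nonneg _) hy hq.le
  have h2 : 0 ≤ |y| ^ q := Real.rpow_nonneg (abs_nonneg _) _
  have h3 : r * |y| ^ q ≤ b * K ^ q := mul_le_mul hr h1 h2 (hr0.trans hr)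
  calc (θ - r * |y| ^ q) * y ≤ |θ - r * |y| ^ q| * |y| := by
        rw [← abs_mul]; exact le_abs_self _
    _ ≤ (2 + b * K ^ q) * K := by
        refine mul_le_mul ?_ hy (abs_nonneg _) (by nlinarith [mul_nonneg hr0 h2])
        rw [abs_le]
        constructor <;> nlinarith [mul_nonneg hr0 h2]
    _ = _ := by ring

theorem eventually_five_mul_le (hq : 0 < q) (ha : 0 < a) :
    ∀ᶠ κ : ℝ in atTop, 5 * κ ≤ κ * (a * κ ^ q / 2) := by
  filter_upwards [(tendsto_rpow_atTop hq).eventually_ge_atTop (10 / a), eventually_ge_atTop 0]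
    with κ h1 h2
  rw [div_le_iff₀ ha] at h1
  nlinarith

end Nonlinearity

/-! ### Rescaling and the bound on edges where `ρ` is bounded below. -/

namespace MetricGraph

variable {V E : Type*} {G : MetricGraph V E}

/-- The natural amplitude `λ^(1/(p-2))`, for `λ = k²`. -/
def amp (p k : ℝ) : ℝ := (k ^ 2) ^ (1 / (p - 2))

theorem amp_pos {p k : ℝ} (hk : 0 < k) : 0 < amp p k := Real.rpow_pos_of_pos (by positivity) _

theorem amp_rpow {p k : ℝ} (hp : 2 < p) : amp p k ^ (p - 2) = k ^ 2 := by
  rw [amp, ← Real.rpow_mul (sq_nonneg k), one_div_mul_cancel (by linarith), Real.rpow_one]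

namespace SolData

variable [Fintype E] {p k Wbar b : ℝ} {W ρ u : G.Point → ℝ}

/-- Since μ^(p-2) = k², dividing u by μ and u'' by μ k² normalizes both terms at once: θ = (W +
k²)/k² lies in [0, 2] and r = ρ in [a, b]. -/
theorem accel_eq (S : SolData G p k Wbar b W ρ u) {a : ℝ} {e : E}
    (hρ : ∀ᵐ t ∂volume.restrict (G.openEdge e), a ≤ G.restr ρ e t) {σ : ℝ} (hσ : |σ| = 1) :
    ∀ᵐ t ∂volume.restrict (G.openEdge e), ∃ θ r, 0 ≤ θ ∧ θ ≤ 2 ∧ a ≤ r ∧ 0 ≤ r ∧ r ≤ b ∧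
      σ * S.accel e t = (θ - r * |σ * G.restr u e t / amp p k| ^ (p - 2)) *
        (σ * G.restr u e t / amp p k) * (amp p k * k ^ 2) := by
  have hμ : 0 < amp p k := amp_pos S.k_pos
  have hk := S.k_pos
  have hk2 : (0:ℝ) < k ^ 2 := by positivity
  filter_upwards [S.abs_pot_le e, S.le_pot e, S.ρ_bounds e, hρ] with t h1 h2 h3 h4
  refine ⟨(G.restr W e t + k ^ 2) / k ^ 2, G.restr ρ e t, div_nonneg (by linarith) hk2.le, ?_, h4,
    h3.1, h3.2, ?_⟩
  · rw [div_le_iff₀ hk2]; exact (le_abs_self _).trans h1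
  · have h5 : |σ * G.restr u e t / amp p k| ^ (p - 2) = |G.restr u e t| ^ (p - 2) / k ^ 2 := by
      rw [abs_div, abs_mul, hσ, one_mul, abs_of_pos hμ, Real.div_rpow (abs_nonneg _) hμ.le,
        amp_rpow S.two_lt]
    rw [h5, accel, coeff]
    field_simp

/-- Turns the a.e. equation into the three increment bounds. The sign σ lets one statement serve v
and -v, and τ lets time run in either direction along the edge. -/
theorem oscSide [Nonempty E] (S : SolData G p k Wbar b W ρ u)
    {a : ℝ} (ha : 0 < a) {e : E}
    (hρ : ∀ᵐ t ∂volume.restrict (G.openEdge e), a ≤ G.restr ρ e t) {w : ℝ → ℝ}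
    (hw : ∀ s ∈ G.closedEdge e, ∀ t ∈ G.closedEdge e, s ≤ t →
        IntegrableOn (S.accel e) (Set.Ioo s t) ∧ w t - w s = ∫ r in Set.Ioo s t, S.accel e r)
    {σ τ t₀ β : ℝ} (hσ : |σ| = 1) (hτ : τ = 1 ∨ τ = -1)
    (hmem : ∀ s ∈ Set.Icc 0 β, t₀ + τ * s / k ∈ G.closedEdge e) :
    OscSide (2 * (4 / a) ^ (1 / (p - 2))) ((4 / a) ^ (1 / (p - 2)))
      (fun κ => κ * (a * κ ^ (p - 2) / 2)) (fun K => 2 * K + b * K ^ (p - 2) * K)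
      (fun s => σ * G.restr u e (t₀ + τ * s / k) / amp p k)
      (fun s => σ * τ * w (t₀ + τ * s / k) / (amp p k * k)) 0 β := by
  have hμ : 0 < amp p k := amp_pos S.k_pos
  have hk := S.k_pos
  have hq : 0 < p - 2 := by linarith [S.two_lt]
  set f := G.restr u e
  have key : ∀ B s t, 0 ≤ s → s ≤ t → t ≤ β →
      (∀ θ r x, 0 ≤ θ → θ ≤ 2 → a ≤ r → 0 ≤ r → r ≤ b → x ∈ Set.Icc s t →
        (θ - r * |σ * f (t₀ + τ * x / k) / amp p k| ^ (p - 2)) *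
          (σ * f (t₀ + τ * x / k) / amp p k) ≤ B) →
      σ * τ * w (t₀ + τ * t / k) / (amp p k * k) - σ * τ * w (t₀ + τ * s / k) / (amp p k * k)
        ≤ B * (t - s) := by
    intro B s t hs hst ht hB
    have main : ∀ x₁ ∈ G.closedEdge e, ∀ x₂ ∈ G.closedEdge e, x₁ ≤ x₂ → x₂ - x₁ = (t - s) / k →
        (∀ x ∈ Set.Ioo x₁ x₂, ∃ r ∈ Set.Icc s t, t₀ + τ * r / k = x) →
        σ * (w x₂ - w x₁) ≤ B * (amp p k * k ^ 2) * ((t - s) / k) := by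
      intro x₁ h1 x₂ h2 h12 hlen hx
      obtain ⟨hint, heq⟩ := hw x₁ h1 x₂ h2 h12
      have hsub := Ioo_subset_openEdge h1 h2
      rw [heq, ← integral_const_mul, ← hlen]
      have hconst : B * (amp p k * k ^ 2) * (x₂ - x₁) =
          ∫ x in Set.Ioo x₁ x₂, B * (amp p k * k ^ 2) := by
        rw [setIntegral_const, measureReal_def, Real.volume_Ioo, smul_eq_mul,
          ENNReal.toReal_ofReal (by linarith)]
        ring
      rw [hconst]
      have hci : IntegrableOn (fun _ : ℝ => B * (amp p k * k ^ 2)) (Set.Ioo x₁ x₂) :=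
        continuous_const.integrableOn_Icc.mono_set Set.Ioo_subset_Icc_self
      refine setIntegral_mono_on_ae (hint.const_mul σ) hci measurableSet_Ioo ?_
      have hacc := S.accel_eq hρ hσ
      rw [ae_restrict_iff' (measurableSet_openEdge e)] at hacc
      filter_upwards [hacc] with x hxa hxm
      obtain ⟨θ, r, g1, g2, g3, g4, g5, g6⟩ := hxa (hsub hxm)
      obtain ⟨r', hr', rfl⟩ := hx x hxm
      rw [g6]
      exact mul_le_mul_of_nonneg_right (hB θ r r' g1 g2 g3 g4 g5 hr') (by positivity)
    have hs' := hmem s ⟨hs, hst.trans ht⟩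
    have ht' := hmem t ⟨hs.trans hst, ht⟩
    have hdiv : s / k ≤ t / k := div_le_div_of_nonneg_right hst hk.le
    have fin : ∀ d : ℝ, σ * d ≤ B * (amp p k * k ^ 2) * ((t - s) / k) →
        σ * d / (amp p k * k) ≤ B * (t - s) := by
      intro d hd
      rw [div_le_iff₀ (by positivity)]
      refine hd.trans (le_of_eq ?_)
      field_simp
    rcases hτ with rfl | rfl
    · have := main _ hs' _ ht' (by rw [one_mul, one_mul]; linarith) (by ring) fun x hx => by
        refine ⟨(x - t₀) * k, ⟨?_, ?_⟩, by field_simp; ring⟩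
        · have := hx.1; rw [one_mul] at this
          rw [← div_le_iff₀ hk]; linarith
        · have := hx.2; rw [one_mul] at this
          rw [← le_div_iff₀ hk]; linarith
      have := fin _ this
      rw [← sub_div]
      convert this using 2
      ring
    · have e1 : ∀ x : ℝ, t₀ + -1 * x / k = t₀ - x / k := fun x => by ring
      have := main _ ht' _ hs' (by rw [e1, e1]; linarith) (by ring) fun x hx => by
        rw [e1, e1] at hx
        refine ⟨(t₀ - x) * k, ⟨?_, ?_⟩, by field_simp; ring⟩
        · rw [← div_le_iff₀ hk]; linarith [hx.2]
        · rw [← le_div_iff₀ hk]; linarith [hx.1]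
      have := fin _ this
      rw [← sub_div]
      convert this using 2
      ring
  refine ⟨fun s t h1 h2 h3 h4 => ?_, fun κ hκ s t h1 h2 h3 h4 => ?_, fun K s t h1 h2 h3 h4 => ?_⟩
  · exact key _ s t h1 h2 h3 fun θ r x g1 g2 g3 g4 g5 g6 => nonlin_upper hq ha g2 g3 (h4 x g6)
  · exact key _ s t h1 h2 h3 fun θ r x g1 g2 g3 g4 g5 g6 => nonlin_strong hq ha g2 g3 hκ (h4 x g6)
  · exact key _ s t h1 h2 h3 fun θ r x g1 g2 g3 g4 g5 g6 => nonlin_lower hq g1 g2 g4 g5 (h4 x g6)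

theorem osc [Nonempty E] (S : SolData G p k Wbar b W ρ u)
    {a : ℝ} (ha : 0 < a) {e : E}
    (hρ : ∀ᵐ t ∂volume.restrict (G.openEdge e), a ≤ G.restr ρ e t) {w : ℝ → ℝ}
    (hwc : Continuous w) (hwd : ∀ t ∈ G.openEdge e, HasDerivAt (G.restr u e) (w t) t)
    (hw : ∀ s ∈ G.closedEdge e, ∀ t ∈ G.closedEdge e, s ≤ t →
        IntegrableOn (S.accel e) (Set.Ioo s t) ∧ w t - w s = ∫ r in Set.Ioo s t, S.accel e r)
    {σ τ t₀ β : ℝ} (hσ : |σ| = 1) (hτ : τ = 1 ∨ τ = -1)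
    (hmem : ∀ s ∈ Set.Icc 0 β, t₀ + τ * s / k ∈ G.closedEdge e)
    (hmemo : ∀ s ∈ Set.Ioo 0 β, t₀ + τ * s / k ∈ G.openEdge e) :
    Osc (2 * (4 / a) ^ (1 / (p - 2))) ((4 / a) ^ (1 / (p - 2)))
      (fun κ => κ * (a * κ ^ (p - 2) / 2)) (fun K => 2 * K + b * K ^ (p - 2) * K)
      (fun s => σ * G.restr u e (t₀ + τ * s / k) / amp p k)
      (fun s => σ * τ * w (t₀ + τ * s / k) / (amp p k * k)) 0 β := by
  have hk := S.k_pos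
  have hc : Continuous (G.restr u e) := continuous_iff_restr.1 S.memH1.1 e
  have haff : Continuous fun s : ℝ => t₀ + τ * s / k := by fun_prop
  refine ⟨((continuous_const.mul (hc.comp haff)).div_const _).continuousOn,
    ((continuous_const.mul (hwc.comp haff)).div_const _).continuousOn, fun s hs => ?_,
    S.oscSide ha hρ hw hσ hτ hmem, ?_⟩
  · have h1 : HasDerivAt (fun s : ℝ => t₀ + τ * s / k) (τ / k) s := by
      have := (((hasDerivAt_id s).const_mul τ).div_const k).const_add t₀
      simpa using this
    have h2 := (((hwd _ (hmemo s hs)).comp s h1).const_mul σ).div_const (amp p k)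
    have h3 : σ * τ * w (t₀ + τ * s / k) / (amp p k * k) =
        σ * (w (t₀ + τ * s / k) * (τ / k)) / amp p k := by
      have := (amp_pos (p := p) hk).ne'
      field_simp
    simp only [h3]
    exact h2
  · have := S.oscSide ha hρ hw (σ := -σ) (by rwa [abs_neg]) hτ hmem
    convert this using 2 <;> ring

/-- On edges where `ρ` is bounded below, solutions of bounded Morse index are bounded by a multiple
of the natural amplitude. -/
theorem exists_bound_of_morseIndex_le (p a b : ℝ) (hp : 2 < p) (ha : 0 < a) (hb : 0 < b)
    (M : ℕ) : ∃ A, 0 < A ∧ ∀ {V E : Type*} [Fintype E] [Nonempty E] {G : MetricGraph V E}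
      (_ : G.Connected) {k Wbar : ℝ} {W ρ u : G.Point → ℝ} (_ : SolData G p k Wbar b W ρ u)
      (_ : G.morseIndex p (fun x => W x + k ^ 2) ρ u ≤ M) (e : E)
      (_ : ∀ᵐ t ∂volume.restrict (G.openEdge e), a ≤ G.restr ρ e t)
      (_ : ENNReal.ofReal (16 * (M + 2) / k) ≤ G.len e), ∀ t ∈ G.closedEdge e,
        |G.restr u e t| ≤ A * amp p k := by
  obtain ⟨A, hA⟩ := Osc.exists_many_zeros (2 * (4 / a) ^ (1 / (p - 2))) ((4 / a) ^ (1 / (p - 2)))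
    (fun κ => κ * (a * κ ^ (p - 2) / 2)) (fun K => 2 * K + b * K ^ (p - 2) * K)
    (by have := threshold_pos (p - 2) ha; linarith)
    (fun K hK => add_nonneg (by linarith)
      (mul_nonneg (mul_nonneg hb.le (Real.rpow_nonneg hK _)) hK))
    (eventually_five_mul_le (by linarith) ha) (M + 2)
  refine ⟨max A 1, lt_max_of_lt_right one_pos, ?_⟩
  intro V E _ _ G hG k Wbar W ρ u S hM e hρ hlen t ht
  by_contra hcon
  push Not at hcon
  have hk := S.k_pos
  have hμ : 0 < amp p k := amp_pos hk
  obtain ⟨w, hwc, hwd, hw⟩ := S.exists_deriv hG e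
  have hfc : Continuous (G.restr u e) := continuous_iff_restr.1 S.memH1.1 e
  set f := G.restr u e with hf
  have hℓ : 0 < 8 * ((M : ℝ) + 2) / k := by positivity
  -- A compact piece `[0, T]` of the edge containing t and of length at least 16(M+2)/k; truncation
  -- is needed on half-lines.
  obtain ⟨T, hT, htT, hTl⟩ : ∃ T ∈ G.closedEdge e, t ≤ T ∧ 2 * (8 * ((M : ℝ) + 2) / k) ≤ T := by
    by_cases hl : G.len e = ⊤
    · refine ⟨max t (2 * (8 * ((M : ℝ) + 2) / k)), ?_, le_max_left _ _, le_max_right _ _⟩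
      rw [mem_closedEdge_iff_of_top hl]
      exact le_max_of_le_right (by linarith)
    · rw [ENNReal.ofReal_le_iff_le_toReal hl] at hlen
      refine ⟨(G.len e).toReal, ?_, ((mem_closedEdge_iff hl).1 ht).2, ?_⟩
      · rw [mem_closedEdge_iff hl]; exact ⟨ENNReal.toReal_nonneg, le_rfl⟩
      · refine le_trans (le_of_eq ?_) hlen; ring
  have hsubT : Set.Icc 0 T ⊆ G.closedEdge e :=
    (ordConnected_closedEdge e).out (zero_mem_closedEdge e) hT
  have hsubTo : Set.Ioo 0 T ⊆ G.openEdge e := Ioo_subset_openEdge (zero_mem_closedEdge e) hT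
  obtain ⟨t₀, ht₀, hmax⟩ := isCompact_Icc.exists_isMaxOn (s := Set.Icc 0 T)
    ⟨t, ht.1, htT⟩ hfc.abs.continuousOn
  have hmax : ∀ s ∈ Set.Icc 0 T, |f s| ≤ |f t₀| := hmax
  have hbig : max A 1 * amp p k < |f t₀| := hcon.trans_le (hmax t ⟨ht.1, htT⟩)
  obtain ⟨σ, hσ, hσf⟩ : ∃ σ : ℝ, |σ| = 1 ∧ σ * f t₀ = |f t₀| := by
    rcases le_total 0 (f t₀) with h | h
    · exact ⟨1, by simp, by rw [abs_of_nonneg h, one_mul]⟩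
    · exact ⟨-1, by simp, by rw [abs_of_nonpos h]; ring⟩
  -- From the maximum point at least one direction has room 8(M+2)/k, the time needed for M+2 zeros.
  obtain ⟨τ, hτ, hroom⟩ : ∃ τ : ℝ, (τ = 1 ∨ τ = -1) ∧
      t₀ + τ * (8 * ((M : ℝ) + 2) / k) ∈ Set.Icc 0 T := by
    rcases le_total (t₀ + 8 * ((M : ℝ) + 2) / k) T with h | h
    · exact ⟨1, Or.inl rfl, by linarith [ht₀.1], by linarith⟩
    · exact ⟨-1, Or.inr rfl, by linarith, by linarith [ht₀.2]⟩
  have hconv : ∀ s ∈ Set.Icc 0 (8 * ((M : ℝ) + 2)), t₀ + τ * s / k ∈ Set.Icc 0 T := by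
    intro s hs
    have h1 : s / k ≤ 8 * ((M : ℝ) + 2) / k := div_le_div_of_nonneg_right hs.2 hk.le
    have h2 : 0 ≤ s / k := div_nonneg hs.1 hk.le
    rw [mul_div_assoc]
    rcases hτ with rfl | rfl
    · exact ⟨by linarith [ht₀.1], by linarith [hroom.2]⟩
    · exact ⟨by linarith [hroom.1], by linarith [ht₀.2]⟩
  have hconvo : ∀ s ∈ Set.Ioo 0 (8 * ((M : ℝ) + 2)), t₀ + τ * s / k ∈ Set.Ioo 0 T := by
    intro s hs
    have h1 : s / k < 8 * ((M : ℝ) + 2) / k := div_lt_div_of_pos_right hs.2 hk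
    have h2 : 0 < s / k := div_pos hs.1 hk
    rw [mul_div_assoc]
    rcases hτ with rfl | rfl
    · exact ⟨by linarith [ht₀.1], by linarith [hroom.2]⟩
    · exact ⟨by linarith [hroom.1], by linarith [ht₀.2]⟩
  have hosc := S.osc ha hρ hwc hwd hw hσ hτ (β := 8 * ((M : ℝ) + 2)) (t₀ := t₀)
    (fun s hs => hsubT (hconv s hs)) (fun s hs => hsubTo (hconvo s hs))
  -- At a maximum of |f| the slope in the direction of travel is nonpositive, even if t₀ is an end
  -- of `[0, T]`, since only one side is used.
  have hslope : σ * τ * w (t₀ + τ * 0 / k) / (amp p k * k) ≤ 0 := by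
    by_contra hc
    push Not at hc
    have hev : ∀ᶠ s in 𝓝[>] (0:ℝ), 0 < σ * τ * w (t₀ + τ * s / k) / (amp p k * k) := by
      have hcw : Continuous fun s : ℝ => σ * τ * w (t₀ + τ * s / k) / (amp p k * k) := by fun_prop
      exact (hcw.continuousAt.tendsto.mono_left nhdsWithin_le_nhds).eventually (lt_mem_nhds hc)
    obtain ⟨δ, hδ, hδs⟩ := mem_nhdsGT_iff_exists_Ioo_subset.1 hev
    have hδ : (0:ℝ) < δ := hδ
    set s := min (δ / 2) (8 * ((M : ℝ) + 2)) with hs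
    have hs0 : 0 < s := lt_min (by linarith) (by positivity)
    have hsδ : s < δ := (min_le_left _ _).trans_lt (by linarith)
    have hsN : s ≤ 8 * ((M : ℝ) + 2) := min_le_right _ _
    obtain ⟨ξ, hξ, h1⟩ := hosc.mvt le_rfl hs0 hsN
    have h2 := hδs (⟨hξ.1, hξ.2.trans hsδ⟩ : ξ ∈ Set.Ioo 0 δ)
    simp only [Set.mem_ofPred_eq] at h2
    have h3 : σ * f (t₀ + τ * s / k) ≤ σ * f t₀ := by
      rw [hσf]
      refine le_trans ?_ (hmax _ (hconv s ⟨hs0.le, hsN⟩))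
      calc σ * f (t₀ + τ * s / k) ≤ |σ * f (t₀ + τ * s / k)| := le_abs_self _
        _ = _ := by rw [abs_mul, hσ, one_mul]
    have h4 : σ * f (t₀ + τ * s / k) / amp p k - σ * f (t₀ + τ * 0 / k) / amp p k ≤ 0 := by
      rw [mul_zero, zero_div, add_zero, ← sub_div]
      exact div_nonpos_of_nonpos_of_nonneg (by linarith) hμ.le
    rw [h1] at h4
    exact absurd h4 (not_le.2 (mul_pos h2 (by linarith)))
  obtain ⟨z, y, hzy⟩ := hA _ _ 0 (8 * ((M : ℝ) + 2)) hosc (by push_cast; linarith) (by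
    rw [mul_zero, zero_div, add_zero, hσf, le_div_iff₀ hμ]
    exact (mul_le_mul_of_nonneg_right (le_max_left _ _) hμ.le).trans hbig.le) hslope
  have hσ0 : σ ≠ 0 := fun h => by rw [h] at hσ; simp at hσ
  have hz0 : ∀ i < M + 2, f (t₀ + τ * z i / k) = 0 := by
    intro i hi
    have := (hzy i hi).2.2.2.1
    simpa [hμ.ne', hσ0] using this
  have hyne : ∀ i < M + 2, f (t₀ + τ * y i / k) ≠ 0 := by
    intro i hi h0
    apply (hzy i hi).2.2.2.2.1
    have h0 : G.restr u e (t₀ + τ * y i / k) = 0 := h0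
    rw [h0]; simp
  have hzmem : ∀ i < M + 2, z i ∈ Set.Ioo 0 (8 * ((M : ℝ) + 2)) := by
    intro i hi
    obtain ⟨g1, g2, g3, -⟩ := hzy i hi
    push_cast at g3
    exact ⟨g1, by linarith⟩
  have hzstep : ∀ i, i + 1 < M + 2 → z i < z (i + 1) := fun i hi =>
    (hzy i (by omega)).2.1.trans ((hzy i (by omega)).2.2.2.2.2 hi)
  have hzmono : ∀ i j, i ≤ j → j < M + 2 → z i ≤ z j := by
    intro i j hij hj
    induction j, hij using Nat.le_induction with
    | base => exact le_rfl
    | succ j hij ih => exact (ih (by omega)).trans (hzstep j hj).le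
  have hdisjz : ∀ i j : ℕ, i < M + 1 → j < M + 1 → i ≠ j → ∀ s, s ∈ Set.Ioo (z i) (z (i + 1)) →
      s ∉ Set.Icc (z j) (z (j + 1)) := by
    intro i j hi hj hij s hs hs'
    rcases lt_or_gt_of_ne hij with h | h
    · have := hzmono (i + 1) j h (by omega)
      linarith [hs.2, hs'.1]
    · have := hzmono (j + 1) i h (by omega)
      linarith [hs.1, hs'.2]
  have hinv : ∀ s : ℝ, t₀ + τ * (τ * (s - t₀) * k) / k = s := by
    intro s
    rcases hτ with rfl | rfl <;> field_simp <;> ring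
  -- M + 2 successive zeros bound M + 1 nodal intervals, on each of which u is nonzero somewhere.
  -- The `min` and `max` restore the order of the endpoints when τ = -1.
  have hle : ((M + 1 : ℕ) : ℕ∞) ≤ G.morseIndex p (fun x => W x + k ^ 2) ρ u := by
    refine S.le_morseIndex_of_nodal hG ha hρ
      (fun i : Fin (M + 1) => min (t₀ + τ * z i / k) (t₀ + τ * z (i + 1) / k))
      (fun i : Fin (M + 1) => max (t₀ + τ * z i / k) (t₀ + τ * z (i + 1) / k)) ?_ ?_ ?_ ?_ ?_ ?_
    · intro i
      rcases min_choice (t₀ + τ * z i / k) (t₀ + τ * z (i + 1) / k) with h | h <;> rw [h]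
      · exact hsubTo (hconvo _ (hzmem i (by omega)))
      · exact hsubTo (hconvo _ (hzmem (i + 1) (by omega)))
    · intro i
      rcases max_choice (t₀ + τ * z i / k) (t₀ + τ * z (i + 1) / k) with h | h <;> rw [h]
      · exact hsubTo (hconvo _ (hzmem i (by omega)))
      · exact hsubTo (hconvo _ (hzmem (i + 1) (by omega)))
    · intro i
      rcases min_choice (t₀ + τ * z i / k) (t₀ + τ * z (i + 1) / k) with h | h <;> rw [h]
      · exact hz0 i (by omega)
      · exact hz0 (i + 1) (by omega)
    · intro i
      rcases max_choice (t₀ + τ * z i / k) (t₀ + τ * z (i + 1) / k) with h | h <;> rw [h]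
      · exact hz0 i (by omega)
      · exact hz0 (i + 1) (by omega)
    · intro i
      refine ⟨t₀ + τ * y i / k, ?_, hyne i (by omega)⟩
      have g1 : z i / k ≤ y i / k := div_le_div_of_nonneg_right (hzy i (by omega)).2.1.le hk.le
      have g2 : y i / k ≤ z (i + 1) / k :=
        div_le_div_of_nonneg_right ((hzy i (by omega)).2.2.2.2.2 (by omega)).le hk.le
      simp only [mul_div_assoc]
      rcases hτ with rfl | rfl
      · exact ⟨min_le_of_left_le (by linarith), le_max_of_le_right (by linarith)⟩
      · exact ⟨min_le_of_right_le (by linarith), le_max_of_le_left (by linarith)⟩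
    · intro i j hij s hs hs'
      have hlt := hzstep i (by omega)
      have hltj := hzstep j (by omega)
      have g : ∀ x : ℝ, (x < s * k - t₀ * k ↔ t₀ + x / k < s) ∧
          (s * k - t₀ * k < x ↔ s < t₀ + x / k) ∧ (x ≤ s * k - t₀ * k ↔ t₀ + x / k ≤ s) ∧
          (s * k - t₀ * k ≤ x ↔ s ≤ t₀ + x / k) := by
        intro x
        rw [← sub_mul]
        refine ⟨?_, ?_, ?_, ?_⟩
        · rw [← div_lt_iff₀ hk, lt_sub_iff_add_lt, add_comm]
        · rw [← lt_div_iff₀ hk, sub_lt_iff_lt_add, add_comm]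
        · rw [← div_le_iff₀ hk, le_sub_iff_add_le, add_comm]
        · rw [← le_div_iff₀ hk, sub_le_iff_le_add, add_comm]
      refine hdisjz i j i.2 j.2 (fun h => hij (Fin.ext h)) (τ * (s * k - t₀ * k)) ?_ ?_
      · have h1 := hs.1
        have h2 := hs.2
        rcases hτ with rfl | rfl
        · simp only [one_mul, min_lt_iff, lt_max_iff, ← (g _).1, ← (g _).2.1] at h1 h2 ⊢
          constructor
          · rcases h1 with h | h <;> linarith
          · rcases h2 with h | h <;> linarith
        · simp only [min_lt_iff, lt_max_iff, ← (g _).1, ← (g _).2.1] at h1 h2 ⊢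
          constructor
          · rcases h2 with h | h <;> linarith
          · rcases h1 with h | h <;> linarith
      · have h1 := hs'.1
        have h2 := hs'.2
        rcases hτ with rfl | rfl
        · simp only [one_mul, min_le_iff, le_max_iff, ← (g _).2.2.1, ← (g _).2.2.2] at h1 h2 ⊢
          constructor
          · rcases h1 with h | h <;> linarith
          · rcases h2 with h | h <;> linarith
        · simp only [min_le_iff, le_max_iff, ← (g _).2.2.1, ← (g _).2.2.2] at h1 h2 ⊢
          constructor
          · rcases h2 with h | h <;> linarith
          · rcases h1 with h | h <;> linarith
  have := hle.trans hM
  rw [Nat.cast_le] at this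
  omega

end SolData

end MetricGraph

/-! ### Lipschitz estimates for exponentials and finite infima. -/

theorem abs_exp_sub_exp_le (x y : ℝ) :
    |Real.exp x - Real.exp y| ≤ max (Real.exp x) (Real.exp y) * |x - y| := by
  have key : ∀ x y : ℝ, x ≤ y → Real.exp y - Real.exp x ≤ Real.exp y * (y - x) := by
    intro x y _
    have h1 := Real.add_one_le_exp (x - y)
    have h2 : Real.exp x = Real.exp y * Real.exp (x - y) := by rw [← Real.exp_add]; ring_nf
    nlinarith [Real.exp_pos y]
  rcases le_total x y with h | h
  · rw [abs_sub_comm, abs_sub_comm x, abs_of_nonneg (sub_nonneg.2 (Real.exp_le_exp.2 h)),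
      abs_of_nonneg (sub_nonneg.2 h), max_eq_right (Real.exp_le_exp.2 h)]
    exact key x y h
  · rw [abs_of_nonneg (sub_nonneg.2 (Real.exp_le_exp.2 h)),
      abs_of_nonneg (sub_nonneg.2 h), max_eq_left (Real.exp_le_exp.2 h)]
    exact key y x h

theorem abs_iInf_sub_iInf_le {ι : Type*} [Finite ι] {f g : ι → ℝ} {r : ℝ} (hr : 0 ≤ r)
    (h : ∀ i, |f i - g i| ≤ r) : |(⨅ i, f i) - ⨅ i, g i| ≤ r := by
  cases isEmpty_or_nonempty ι
  · simpa using hr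
  have key : ∀ f g : ι → ℝ, (∀ i, |f i - g i| ≤ r) → (⨅ i, f i) - r ≤ ⨅ i, g i := by
    intro f g h
    refine le_ciInf fun i => ?_
    have h1 := ciInf_le (Set.finite_range f).bddBelow i
    have h2 := (abs_le.1 (h i)).2
    linarith
  rw [abs_le]
  constructor
  · linarith [key g f fun i => by rw [abs_sub_comm]; exact h i]
  · linarith [key f g h]

namespace MetricGraph

variable {V E : Type*} {G : MetricGraph V E}

theorem integral_exp_dist_le [Fintype E] (hG : G.Connected) (x : G.Point) {κ : ℝ} (hκ : 0 < κ) :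
    G.integral (fun e t => Real.exp (-κ * dist (G.coord e t) x)) ≤ Fintype.card E * (6 / κ) := by
  unfold integral
  calc _ ≤ ∑ _e : E, 6 / κ := Finset.sum_le_sum fun e _ => (exp_dist_bound hG e x hκ).2
    _ = _ := by simp

theorem edgeIntegrable_exp_dist (hG : G.Connected) (x : G.Point) {κ : ℝ} (hκ : 0 < κ) :
    G.EdgeIntegrable fun e t => Real.exp (-κ * dist (G.coord e t) x) :=
  fun e => (exp_dist_bound hG e x hκ).1

/-! ### Exponential cutoff functions -/

/-- The positive part of `exp (-c dist(·, x)) - δ`. -/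
def expCut (c δ : ℝ) (x : G.Point) (y : G.Point) : ℝ := max 0 (Real.exp (-c * dist y x) - δ)

section expCut

variable {c δ : ℝ} {x : G.Point}

theorem expCut_nonneg (y : G.Point) : 0 ≤ expCut c δ x y := le_max_left _ _

theorem expCut_le (hδ : 0 ≤ δ) (y : G.Point) : expCut c δ x y ≤ Real.exp (-c * dist y x) :=
  max_le (Real.exp_pos _).le (by linarith)

theorem expCut_self (hδ : δ ≤ 1) : expCut c δ x x = 1 - δ := by
  rw [expCut, pdist_self, mul_zero, Real.exp_zero, max_eq_right (by linarith)]

theorem expCut_eq_zero {y : G.Point} (h : Real.exp (-c * dist y x) ≤ δ) : expCut c δ x y = 0 :=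
  max_eq_left (by linarith)

theorem abs_expCut_sub_le (hG : G.Connected) (hc : 0 ≤ c) (e : E) (s t : ℝ) :
    |G.restr (expCut c δ x) e s - G.restr (expCut c δ x) e t| ≤
      c * max (Real.exp (-c * dist (G.coord e s) x)) (Real.exp (-c * dist (G.coord e t) x)) *
        |s - t| := by
  simp only [restr, expCut]
  have h1 := abs_max_sub_max_le_abs (Real.exp (-c * dist (G.coord e s) x) - δ)
    (Real.exp (-c * dist (G.coord e t) x) - δ) 0
  rw [max_comm _ 0, max_comm _ 0] at h1
  refine h1.trans ?_
  rw [sub_sub_sub_cancel_right]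
  refine (abs_exp_sub_exp_le _ _).trans ?_
  have h2 := abs_dist_coord_sub_le hG e x s t
  have h3 : |(-c * dist (G.coord e s) x) - (-c * dist (G.coord e t) x)| ≤ c * |s - t| := by
    rw [← mul_sub, abs_mul, abs_neg, abs_of_nonneg hc]
    exact mul_le_mul_of_nonneg_left h2 hc
  calc _ ≤ _ := mul_le_mul_of_nonneg_left h3 ((Real.exp_pos _).le.trans (le_max_left _ _))
    _ = _ := by ring

theorem cutoff_expCut [Finite E] [Nonempty E] (hG : G.Connected) (hc : 0 < c) (hδ : 0 < δ) :
    Cutoff (expCut c δ x) where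
  lipschitz := by
    refine ⟨c, fun e s t => (abs_expCut_sub_le hG hc.le e s t).trans ?_⟩
    have hexp : ∀ y : G.Point, Real.exp (-c * dist y x) ≤ 1 := fun y => by
      rw [Real.exp_le_one_iff]; nlinarith [pdist_nonneg y x]
    have := max_le (hexp (G.coord e s)) (hexp (G.coord e t))
    exact mul_le_mul_of_nonneg_right (by nlinarith) (abs_nonneg _)
  bounded := by
    refine ⟨1, fun y => ?_⟩
    rw [abs_of_nonneg (expCut_nonneg y)]
    refine (expCut_le hδ.le y).trans ?_
    rw [Real.exp_le_one_iff]; nlinarith [pdist_nonneg y x]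
  compact := by
    refine hasCompactSupport_of_dist hG x (-Real.log δ / c) fun y hy => expCut_eq_zero ?_
    rw [← Real.exp_log hδ]
    refine Real.exp_le_exp.2 ?_
    rw [div_lt_iff₀ hc] at hy
    linarith

theorem abs_deriv_expCut_le (hG : G.Connected) (hc : 0 ≤ c) (e : E) (t : ℝ) :
    |deriv (G.restr (expCut c δ x) e) t| ≤ c * Real.exp (-c * dist (G.coord e t) x) := by
  have hcont : Continuous fun s => Real.exp (-c * dist (G.coord e s) x) :=
    Real.continuous_exp.comp (continuous_const.mul
      ((continuous_dist_left hG x).comp (continuous_coord e)))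
  have := abs_deriv_le_of_local (f := G.restr (expCut c δ x) e) (t := t)
    (w := fun s => c * max (Real.exp (-c * dist (G.coord e s) x))
      (Real.exp (-c * dist (G.coord e t) x)))
    (continuous_const.mul (hcont.max continuous_const)).continuousAt
    (mul_nonneg hc ((Real.exp_pos _).le.trans (le_max_left _ _)))
    fun s => abs_expCut_sub_le hG hc e s t
  simpa using this

/-- Where the cutoff vanishes it is minimal and its derivative is 0. Elsewhere |η'| ≤ cX with X = η
+ δ, and X² ≤ 2η² + 2δ², δ² ≤ δX. The gradient is thus controlled by η itself up to an error that is
small with δ. -/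
theorem deriv_expCut_sq_le (hG : G.Connected) (hc : 0 ≤ c) (hδ : 0 ≤ δ) (e : E) (t : ℝ) :
    (deriv (G.restr (expCut c δ x) e) t) ^ 2 ≤ 2 * c ^ 2 * (G.restr (expCut c δ x) e t) ^ 2 +
      2 * c ^ 2 * δ * Real.exp (-c * dist (G.coord e t) x) := by
  set X := Real.exp (-c * dist (G.coord e t) x) with hX
  have hX0 : 0 < X := Real.exp_pos _
  rcases (expCut_nonneg (c := c) (δ := δ) (x := x) (G.coord e t)).eq_or_lt with h | h
  · have hmin : IsLocalMin (G.restr (expCut c δ x) e) t := by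
      refine Eventually.of_forall fun s => ?_
      simp only [restr]
      rw [← h]
      exact expCut_nonneg _
    rw [hmin.deriv_eq_zero, zero_pow two_ne_zero]
    positivity
  · have h1 := abs_deriv_expCut_le (δ := δ) (x := x) hG hc e t
    have h2 : G.restr (expCut c δ x) e t = X - δ := by
      simp only [restr, expCut] at h ⊢
      rw [max_eq_right]
      by_contra hcon
      rw [max_eq_left (not_le.1 hcon).le] at h
      exact lt_irrefl _ h
    have h3 : δ ≤ X := by
      have : 0 < G.restr (expCut c δ x) e t := h
      linarith
    have h4 : (deriv (G.restr (expCut c δ x) e) t) ^ 2 ≤ (c * X) ^ 2 := by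
      rw [← sq_abs (deriv _ _)]
      exact pow_le_pow_left₀ (abs_nonneg _) h1 2
    rw [h2]
    have h5 : X ^ 2 ≤ 2 * (X - δ) ^ 2 + 2 * δ ^ 2 := by nlinarith [sq_nonneg (X - 2 * δ)]
    have h6 : δ ^ 2 ≤ δ * X := by nlinarith
    nlinarith [sq_nonneg c, mul_le_mul_of_nonneg_left h5 (sq_nonneg c),
      mul_le_mul_of_nonneg_left h6 (sq_nonneg c)]

end expCut

namespace SolData

variable [Fintype E] {p k Wbar b : ℝ} {W ρ u : G.Point → ℝ}

theorem abs_rpow_mul_sq {q y : ℝ} (hq : 0 < q) : |y| ^ q * y ^ 2 = |y| ^ (q + 2) := by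
  rcases eq_or_ne y 0 with rfl | hy
  · rw [abs_zero, Real.zero_rpow hq.ne', Real.zero_rpow (by linarith)]; ring
  · rw [Real.rpow_add (abs_pos.2 hy), Real.rpow_two, sq_abs]

theorem amp_rpow_p (S : SolData G p k Wbar b W ρ u) : amp p k ^ p = k ^ 2 * amp p k ^ 2 := by
  have := amp_rpow (k := k) S.two_lt
  rw [← this, ← Real.rpow_two, ← Real.rpow_add (amp_pos S.k_pos)]
  ring_nf

/-! ### The uniform bound -/

/-- On every edge the nonlinear term is either zero or at most b(|A|μ)^p. Testing around x with a
cutoff of slow rate αk, the gradient term is a small multiple of M² = sup u², which is absorbed. -/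
theorem exists_amplitude_bound (p A b : ℝ) (hb : 0 < b) (n : ℕ) :
    ∃ M₀, 0 < M₀ ∧ ∀ {V E : Type*} [Fintype E] [Nonempty E] {G : MetricGraph V E}
      (_ : Fintype.card E = n) (_ : G.Connected) {k Wbar : ℝ} {W ρ u : G.Point → ℝ}
      (_ : SolData G p k Wbar b W ρ u) (_ : ∀ e,
        (∀ t ∈ G.closedEdge e, |G.restr u e t| ≤ A * amp p k) ∨
        (∀ᵐ t ∂volume.restrict (G.openEdge e), G.restr ρ e t = 0)),
      ∀ x, |u x| ≤ M₀ * amp p k := by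
  set B := b * |A| ^ p with hB
  have hB0 : 0 ≤ B := mul_nonneg hb.le (Real.rpow_nonneg (abs_nonneg _) _)
  set M₀ := √(4 * (64 * 3 * n * B * (64 * n))) + 1 with hM₀
  refine ⟨M₀, by positivity, ?_⟩
  intro V E _ _ G hn hG k Wbar W ρ u S hdich
  have hp := S.two_lt
  have hk := S.k_pos
  have hμ : 0 < amp p k := amp_pos hk
  set μ := amp p k
  have hn1 : (1:ℝ) ≤ n := by
    rw [← hn]; exact_mod_cast Fintype.card_pos
  obtain ⟨M', hM', hM'u⟩ := S.exists_bound hG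
  set M := sSup (Set.range fun x => |u x|)
  have hbdd : BddAbove (Set.range fun x => |u x|) := ⟨M', by rintro _ ⟨x, rfl⟩; exact hM'u x⟩
  have hM : ∀ x, |u x| ≤ M := fun x => le_csSup hbdd ⟨x, rfl⟩
  have hne : (Set.range fun x => |u x|).Nonempty := by
    obtain ⟨e⟩ := ‹Nonempty E›
    exact ⟨_, G.coord e 0, rfl⟩
  have hM0 : 0 ≤ M := Real.sSup_nonneg (by rintro _ ⟨x, rfl⟩; exact abs_nonneg _)
  -- The weight integral is at most 3n/(αk), so the gradient term is at most 3nαk M² = (3/64) k M².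
  -- After the Sobolev inequality this becomes (3/7) M², with coefficient below 1.
  set α : ℝ := 1 / (64 * n) with hα
  have hα0 : 0 < α := by positivity
  have hc : 0 < α * k := by positivity
  have key : ∀ x, u x ^ 2 ≤ 3 / 7 * M ^ 2 + 64 * 3 * n * B * (64 * n) * μ ^ 2 := by
    intro x
    have hη := cutoff_expCut (c := α * k) (δ := 1 / 2) (x := x) hG hc (by norm_num)
    set η := expCut (α * k) (1 / 2) x with hηdef
    have h1 := S.energy_mul_cutoff_le hη
    have h2 := (hη.mul_memH1 S.memH1).1.sobolev hG hk S.len_le x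
    have hηx : η x = 1 / 2 := by rw [hηdef, expCut_self (by norm_num)]; norm_num
    rw [hηx] at h2
    have hI := edgeIntegrable_exp_dist hG x (κ := 2 * (α * k)) (by positivity)
    have hIle := integral_exp_dist_le hG x (κ := 2 * (α * k)) (by positivity)
    rw [hn] at hIle
    set I := G.integral fun e t => Real.exp (-(2 * (α * k)) * dist (G.coord e t) x)
    have hexp2 : ∀ d : ℝ, Real.exp (-(2 * (α * k)) * d) = Real.exp (-(α * k) * d) ^ 2 := by
      intro d
      rw [← Real.exp_nat_mul]
      congr 1; push_cast; ring
    have h3 : G.integral (fun e t => (G.restr u e t) ^ 2 * (deriv (G.restr η e) t) ^ 2) ≤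
        M ^ 2 * (α * k) ^ 2 * I := by
      rw [← integral_const_mul']
      refine integral_mono' (hη.integrable_mul_deriv S.memH1)
        (fun e => (hI e).const_mul _) fun e => Eventually.of_forall fun t => ?_
      have g1 := abs_deriv_expCut_le (c := α * k) (δ := 1 / 2) (x := x) hG hc.le e t
      have g2 : (deriv (G.restr η e) t) ^ 2 ≤ (α * k) ^ 2 *
          Real.exp (-(2 * (α * k)) * dist (G.coord e t) x) := by
        rw [hexp2, ← mul_pow, ← sq_abs (deriv _ _)]
        exact pow_le_pow_left₀ (abs_nonneg _) g1 2
      have g3 : (G.restr u e t) ^ 2 ≤ M ^ 2 := by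
        rw [← sq_abs]; exact pow_le_pow_left₀ (abs_nonneg _) (hM _) 2
      rw [mul_assoc]
      exact mul_le_mul g3 g2 (sq_nonneg _) (sq_nonneg _)
    have h4 : (S.nl fun x => u x * η x) ≤ B * (k ^ 2 * μ ^ 2) * I := by
      rw [nl, ← integral_const_mul']
      refine integral_mono' (S.integrable_nl hG (hη.mul_memH1 S.memH1).1)
        (fun e => (hI e).const_mul _) fun e => ?_
      rcases hdich e with hA | hρ0
      · filter_upwards [S.coeff_le e, ae_restrict_mem (measurableSet_openEdge e)] with t g1 ht
        have g2 : (G.restr (fun x => u x * η x) e t) ^ 2 =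
          (G.restr u e t) ^ 2 * (G.restr η e t) ^ 2 := by simp only [restr]; ring
        have g3 : (G.restr η e t) ^ 2 ≤ Real.exp (-(2 * (α * k)) * dist (G.coord e t) x) := by
          rw [hexp2]
          exact pow_le_pow_left₀ (expCut_nonneg _) (expCut_le (by norm_num) _) 2
        have g4 : S.coeff e t * (G.restr u e t) ^ 2 ≤ B * (k ^ 2 * μ ^ 2) := by
          calc S.coeff e t * (G.restr u e t) ^ 2
              ≤ b * |G.restr u e t| ^ (p - 2) * (G.restr u e t) ^ 2 :=
                mul_le_mul_of_nonneg_right g1 (sq_nonneg _)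
            _ = b * |G.restr u e t| ^ p := by
                rw [mul_assoc, abs_rpow_mul_sq (by linarith)]; ring_nf
            _ ≤ b * (|A| * μ) ^ p := by
                refine mul_le_mul_of_nonneg_left ?_ hb.le
                refine Real.rpow_le_rpow (abs_nonneg _) ?_ (by linarith)
                refine (hA t (openEdge_subset_closedEdge e ht)).trans ?_
                exact mul_le_mul_of_nonneg_right (le_abs_self A) hμ.le
            _ = B * (k ^ 2 * μ ^ 2) := by
                rw [Real.mul_rpow (abs_nonneg _) hμ.le, S.amp_rpow_p]; ring
        rw [g2, ← mul_assoc]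
        exact mul_le_mul g4 g3 (sq_nonneg _) (by positivity)
      · filter_upwards [hρ0] with t ht
        rw [coeff, ht, zero_mul, zero_mul]
        positivity
    have h5 : k * (M ^ 2 * (α * k) ^ 2 * (n * (6 / (2 * (α * k)))) +
        B * (k ^ 2 * μ ^ 2) * (n * (6 / (2 * (α * k))))) =
        k ^ 2 * (3 / 64 * M ^ 2 + 3 * n * B * (64 * n) * μ ^ 2) := by
      have hn0 : (n:ℝ) ≠ 0 := by linarith
      rw [hα]
      field_simp
      ring
    have h6 := mul_le_mul_of_nonneg_left hIle (show 0 ≤ M ^ 2 * (α * k) ^ 2 by positivity)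
    have h7 := mul_le_mul_of_nonneg_left hIle (show 0 ≤ B * (k ^ 2 * μ ^ 2) by positivity)
    have h8 : 7 * (k * (k * (u x * (1 / 2)) ^ 2)) ≤ 16 *
        (k ^ 2 * (3 / 64 * M ^ 2 + 3 * n * B * (64 * n) * μ ^ 2)) := by
      rw [← h5]
      have : 7 * (k * (u x * (1 / 2)) ^ 2) ≤ 16 * (M ^ 2 * (α * k) ^ 2 * (n * (6 / (2 * (α * k)))) +
        B * (k ^ 2 * μ ^ 2) * (n * (6 / (2 * (α * k))))) := by linarith
      nlinarith
    have h9 : k ^ 2 * (7 / 4 * u x ^ 2) ≤ k ^ 2 * (16 *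
        (3 / 64 * M ^ 2 + 3 * n * B * (64 * n) * μ ^ 2)) := by linarith
    have h10 := le_of_mul_le_mul_left h9 (by positivity)
    have h11 : 0 ≤ 3 * n * B * (64 * n) * μ ^ 2 := by positivity
    nlinarith
  have hMsq : M ^ 2 ≤ 3 / 7 * M ^ 2 + 64 * 3 * n * B * (64 * n) * μ ^ 2 := by
    set T := 3 / 7 * M ^ 2 + 64 * 3 * n * B * (64 * n) * μ ^ 2 with hT
    have hT0 : 0 ≤ T := by positivity
    have : M ≤ √T := by
      refine csSup_le hne ?_
      rintro _ ⟨x, rfl⟩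
      exact Real.le_sqrt_of_sq_le (by simp only [sq_abs]; exact key x)
    calc M ^ 2 ≤ √T ^ 2 := pow_le_pow_left₀ hM0 this 2
      _ = T := Real.sq_sqrt hT0
  intro x
  refine (hM x).trans ?_
  have h1 : M ^ 2 ≤ 4 * (64 * 3 * n * B * (64 * n)) * μ ^ 2 := by nlinarith
  have h2 : M ≤ √(4 * (64 * 3 * n * B * (64 * n))) * μ := by
    refine le_of_sq_le_sq ?_ (by positivity)
    rw [mul_pow, Real.sq_sqrt (by positivity)]
    exact h1
  refine h2.trans (mul_le_mul_of_nonneg_right ?_ hμ.le)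
  rw [hM₀]; linarith

/-! ### Instability near large values -/

-- If the form were nonnegative, the nonlinear term would be controlled by the gradient term A, so
-- the energy of uη would be at most Γ A. But A is at most a small multiple of that energy plus an
-- error O(δ). Absorbing, uη has energy O(δ), and the Sobolev inequality contradicts |u(x)| ≥ δ₀ μ.
set_option maxHeartbeats 800000 in
theorem exists_unstable (p b M₀ δ₀ : ℝ) (hp : 2 < p) (hM₀ : 0 < M₀) (hδ₀ : 0 < δ₀) (n : ℕ)
    (hn1 : 1 ≤ n) :
    ∃ α δ, 0 < α ∧ 0 < δ ∧ δ < 1 ∧ ∀ {V E : Type*} [Fintype E] [Nonempty E] {G : MetricGraph V E}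
      (_ : Fintype.card E = n) (_ : G.Connected) {k Wbar : ℝ} {W ρ u : G.Point → ℝ}
      (_ : SolData G p k Wbar b W ρ u) (_ : ∀ x, |u x| ≤ M₀ * amp p k),
      ∀ x, δ₀ * amp p k ≤ |u x| →
        G.quadForm p (fun x => W x + k ^ 2) ρ u (fun y => u y * expCut (α * k) δ x y) < 0 := by
  set Γ := 8 / 7 * (1 + 1 / (p - 2)) with hΓ
  have hp2 : 0 < p - 2 := by linarith
  have hΓ0 : 0 < Γ := by positivity
  -- Makes Γ · 2α² = 1/2, so that half of the energy can be absorbed.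
  set α := √(1 / (4 * Γ)) with hα
  have hα0 : 0 < α := Real.sqrt_pos.2 (by positivity)
  have hα2 : α ^ 2 = 1 / (4 * Γ) := Real.sq_sqrt (by positivity)
  set D := 2 * M₀ ^ 2 * n * (6 / α) with hD
  have hn0 : (0:ℝ) < n := by exact_mod_cast hn1
  have hD0 : 0 < D := by positivity
  -- The final comparison would read δ₀²/4 ≤ δ D, whereas this choice gives δ D ≤ δ₀²/8.
  set δ := min (1 / 2) (δ₀ ^ 2 / (8 * D)) with hδ
  have hδpos : 0 < δ := lt_min (by norm_num) (by positivity)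
  have hδ1 : δ ≤ 1 / 2 := min_le_left _ _
  have hδ2 : δ * (8 * D) ≤ δ₀ ^ 2 := by
    rw [← le_div_iff₀ (by positivity)]; exact min_le_right _ _
  refine ⟨α, δ, hα0, hδpos, by linarith, ?_⟩
  intro V E _ _ G hn hG k Wbar W ρ u S hM x hx
  have hk := S.k_pos
  have hμ : 0 < amp p k := amp_pos hk
  set μ := amp p k
  have hc : 0 < α * k := by positivity
  have hη := cutoff_expCut (c := α * k) (δ := δ) (x := x) hG hc hδpos
  set η := expCut (α * k) δ x with hηdef
  rw [S.quadForm_mul_cutoff hG hη]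
  by_contra hcon
  push Not at hcon
  set A := G.integral fun e t => (G.restr u e t) ^ 2 * (deriv (G.restr η e) t) ^ 2 with hA
  have h1 := S.energy_mul_cutoff_le hη
  have h2 := (hη.mul_memH1 S.memH1).1.sobolev hG hk S.len_le x
  rw [show η x = 1 - δ from expCut_self (by linarith)] at h2
  set En := G.energy k fun x => u x * η x with hEn
  have hI := edgeIntegrable_exp_dist hG x hc
  have hIle := integral_exp_dist_le hG x hc
  rw [hn] at hIle
  set I := G.integral fun e t => Real.exp (-(α * k) * dist (G.coord e t) x)
  have hnl : (S.nl fun x => u x * η x) ≤ A / (p - 2) := by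
    rw [le_div_iff₀ hp2]; linarith
  have h3 : En ≤ Γ * A := by
    rw [hΓ]
    have : A / (p - 2) = 1 / (p - 2) * A := by ring
    linarith
  have h4 : A ≤ 2 * α ^ 2 * En + M₀ ^ 2 * μ ^ 2 * (2 * (α * k) ^ 2 * δ) * I := by
    rw [hA, hEn, energy, ← integral_const_mul', ← integral_const_mul', ← integral_add']
    · refine integral_mono' (hη.integrable_mul_deriv S.memH1) (fun e => ?_) fun e =>
        Eventually.of_forall fun t => ?_
      · exact (((hη.mul_memH1 S.memH1).1.integrableOn_energy k e).const_mul _).add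
          ((hI e).const_mul _)
      · have g1 := deriv_expCut_sq_le (c := α * k) (x := x) hG hc.le hδpos.le e t
        have g3 : (G.restr u e t) ^ 2 ≤ M₀ ^ 2 * μ ^ 2 := by
          rw [← sq_abs, ← mul_pow]; exact pow_le_pow_left₀ (abs_nonneg _) (hM _) 2
        have g4 : 0 ≤ 2 * (α * k) ^ 2 * δ * Real.exp (-(α * k) * dist (G.coord e t) x) := by
          positivity
        have g5 : (G.restr (fun x => u x * η x) e t) ^ 2 =
          (G.restr u e t) ^ 2 * (G.restr η e t) ^ 2 := by simp only [restr]; ring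
        calc (G.restr u e t) ^ 2 * (deriv (G.restr η e) t) ^ 2
            ≤ (G.restr u e t) ^ 2 * (2 * (α * k) ^ 2 * (G.restr η e t) ^ 2 +
              2 * (α * k) ^ 2 * δ * Real.exp (-(α * k) * dist (G.coord e t) x)) :=
              mul_le_mul_of_nonneg_left g1 (sq_nonneg _)
          _ ≤ 2 * α ^ 2 * (k ^ 2 * ((G.restr u e t) ^ 2 * (G.restr η e t) ^ 2)) +
              M₀ ^ 2 * μ ^ 2 *
                (2 * (α * k) ^ 2 * δ * Real.exp (-(α * k) * dist (G.coord e t) x)) := by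
              have := mul_le_mul_of_nonneg_right g3 g4
              linarith
          _ ≤ _ := by
              rw [g5]
              have : 0 ≤ 2 * α ^ 2 * (deriv (G.restr (fun x => u x * η x) e) t) ^ 2 := by
                positivity
              linarith
    · exact fun e => ((hη.mul_memH1 S.memH1).1.integrableOn_energy k e).const_mul _
    · exact fun e => (hI e).const_mul _
  have h5 : M₀ ^ 2 * μ ^ 2 * (2 * (α * k) ^ 2 * δ) * I ≤ α ^ 2 * (μ ^ 2 * δ * D * k) := by
    refine (mul_le_mul_of_nonneg_left hIle (by positivity)).trans (le_of_eq ?_)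
    rw [hD]; field_simp
  have h6 : Γ * α ^ 2 = 1 / 4 := by rw [hα2]; field_simp
  have h7 : En ≤ 1 / 2 * En + 1 / 4 * (μ ^ 2 * δ * D * k) := by
    have := mul_le_mul_of_nonneg_left (h4.trans (add_le_add_right h5 _)) hΓ0.le
    have e1 : Γ * (2 * α ^ 2 * En + α ^ 2 * (μ ^ 2 * δ * D * k)) =
      2 * (Γ * α ^ 2) * En + (Γ * α ^ 2) * (μ ^ 2 * δ * D * k) := by ring
    rw [e1, h6] at this
    linarith
  have h8 : k * (u x * (1 - δ)) ^ 2 ≤ k * (μ ^ 2 * δ * D) := by linarith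
  have h9 := le_of_mul_le_mul_left h8 hk
  have h10 : δ₀ ^ 2 * μ ^ 2 ≤ u x ^ 2 := by
    rw [← mul_pow, ← sq_abs (u x)]; exact pow_le_pow_left₀ (by positivity) hx 2
  have h11 : u x ^ 2 * (1 / 4) ≤ (u x * (1 - δ)) ^ 2 := by
    rw [mul_pow]
    exact mul_le_mul_of_nonneg_left (by nlinarith) (sq_nonneg _)
  have h12 : 0 < μ ^ 2 * δ * D := by positivity
  have h13 : δ * (8 * D) * μ ^ 2 ≤ δ₀ ^ 2 * μ ^ 2 :=
    mul_le_mul_of_nonneg_right hδ2 (sq_nonneg _)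
  linarith

/-- Separated points with large values contribute to the Morse index. -/
theorem le_morseIndex_of_separated [Nonempty E] (hG : G.Connected)
    (S : SolData G p k Wbar b W ρ u) {α δ : ℝ} (hα : 0 < α) (hδ : 0 < δ) {N : ℕ}
    {x : Fin N → G.Point}
    (hx : ∀ i, G.quadForm p (fun x => W x + k ^ 2) ρ u
      (fun y => u y * expCut (α * k) δ (x i) y) < 0)
    (hsep : ∀ i j, i ≠ j → 2 * (-Real.log δ / α) < k * dist (x i) (x j)) :
    (N : ℕ∞) ≤ G.morseIndex p (fun x => W x + k ^ 2) ρ u := by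
  have hk := S.k_pos
  have hc : 0 < α * k := mul_pos hα hk
  refine S.le_morseIndex hG (fun i => (cutoff_expCut hG hc hδ).mul_memH1 S.memH1)
    (fun i j hij e => Eventually.of_forall fun t => ?_) hx
  -- The truncated exponential lives where k dist ≤ -log δ / α. Vanishing on a whole neighbourhood
  -- kills the derivative as well; no point can be in two supports by the separation hypothesis.
  have far : ∀ i, -Real.log δ / α < k * dist (G.coord e t) (x i) →
      G.restr (fun y => u y * expCut (α * k) δ (x i) y) e =ᶠ[𝓝 t] fun _ => 0 := by
    intro i hi
    have hcont : Continuous fun s => k * dist (G.coord e s) (x i) :=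
      continuous_const.mul ((continuous_dist_left hG (x i)).comp (continuous_coord e))
    filter_upwards [hcont.continuousAt.eventually (lt_mem_nhds hi)] with s hs
    simp only [restr]
    rw [expCut_eq_zero, mul_zero]
    rw [← Real.exp_log hδ]
    refine Real.exp_le_exp.2 ?_
    rw [div_lt_iff₀ hα] at hs
    linarith
  have hor : -Real.log δ / α < k * dist (G.coord e t) (x i) ∨
      -Real.log δ / α < k * dist (G.coord e t) (x j) := by
    by_contra hcon
    push Not at hcon
    have h1 := hsep i j hij
    have h2 := pdist_triangle hG (x i) (G.coord e t) (x j)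
    rw [pdist_comm (x i) (G.coord e t)] at h2
    have h3 := mul_le_mul_of_nonneg_left h2 hk.le
    linarith [hcon.1, hcon.2]
  rcases hor with h | h
  · have h1 := far i h
    rw [h1.eq_of_nhds, h1.deriv_eq]; simp
  · have h1 := far j h
    rw [h1.eq_of_nhds, h1.deriv_eq]; simp

end SolData

/-! ### Exponential decay -/

theorem iInf_pdist_le {ι : Type*} [Finite ι] (x : ι → G.Point) (y : G.Point) (i : ι) :
    ⨅ i, dist y (x i) ≤ dist y (x i) :=
  ciInf_le (Set.finite_range _).bddBelow i

theorem abs_iInf_pdist_coord_sub_le {ι : Type*} [Finite ι] (hG : G.Connected) (x : ι → G.Point)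
    (e : E) (s t : ℝ) :
    |(⨅ i, dist (G.coord e s) (x i)) - ⨅ i, dist (G.coord e t) (x i)| ≤ |s - t| :=
  abs_iInf_sub_iInf_le (abs_nonneg _) fun i => abs_dist_coord_sub_le hG e (x i) s t

/-- A truncated exponential weight. -/
def weight {ι : Type*} (k N : ℝ) (x : ι → G.Point) (y : G.Point) : ℝ :=
  Real.exp (1 / 2 * k * min (⨅ i, dist y (x i)) N)

/-- A truncated exponential weight, cut off at large distance from `z`. -/
def weightCut {ι : Type*} (k N r : ℝ) (x : ι → G.Point) (z y : G.Point) : ℝ :=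
  weight k N x y * max 0 (1 - r * dist y z)

section weight

variable {ι : Type*} {k N r : ℝ} {x : ι → G.Point} {z : G.Point}

theorem weight_pos (y : G.Point) : 0 < weight k N x y := Real.exp_pos _

theorem weight_le (hk : 0 ≤ k) (y : G.Point) : weight k N x y ≤ Real.exp (1 / 2 * k * N) :=
  Real.exp_le_exp.2 (mul_le_mul_of_nonneg_left (min_le_right _ _) (by positivity))

theorem abs_weight_sub_le [Finite ι] (hG : G.Connected) (hk : 0 ≤ k) (e : E) (s t : ℝ) :
    |weight k N x (G.coord e s) - weight k N x (G.coord e t)| ≤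
      1 / 2 * k * max (weight k N x (G.coord e s)) (weight k N x (G.coord e t)) * |s - t| := by
  refine (abs_exp_sub_exp_le _ _).trans ?_
  have h1 := (abs_min_sub_min_le_max (⨅ i, dist (G.coord e s) (x i)) N
    (⨅ i, dist (G.coord e t) (x i)) N).trans
      (max_le (abs_iInf_pdist_coord_sub_le hG x e s t) (by simp))
  rw [← mul_sub, abs_mul, abs_of_nonneg (by positivity : 0 ≤ 1 / 2 * k)]
  have h2 := mul_le_mul_of_nonneg_left h1 (by positivity : 0 ≤ 1 / 2 * k)
  calc _ ≤ _ := mul_le_mul_of_nonneg_left h2 ((weight_pos _).le.trans (le_max_left _ _))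
    _ = _ := by simp only [weight]; ring

theorem continuous_weight_coord [Finite ι] (hG : G.Connected) (hk : 0 ≤ k) (e : E) :
    Continuous fun s => weight k N x (G.coord e s) := by
  refine (LocAC.of_lipschitz (K := 1 / 2 * k * Real.exp (1 / 2 * k * N)) fun s t => ?_).continuous
  refine (abs_weight_sub_le hG hk e s t).trans ?_
  exact mul_le_mul_of_nonneg_right (mul_le_mul_of_nonneg_left
    (max_le (weight_le hk _) (weight_le hk _)) (by positivity)) (abs_nonneg _)

theorem tent_le_one (hr : 0 ≤ r) (y : G.Point) : max 0 (1 - r * dist y z) ≤ 1 :=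
  max_le zero_le_one (by nlinarith [pdist_nonneg y z])

theorem abs_weightCut_sub_le [Finite ι] (hG : G.Connected) (hk : 0 ≤ k) (hr : 0 ≤ r)
    (e : E) (s t : ℝ) :
    |G.restr (weightCut k N r x z) e s - G.restr (weightCut k N r x z) e t| ≤
      (1 / 2 * k * max (weight k N x (G.coord e s)) (weight k N x (G.coord e t)) *
        max 0 (1 - r * dist (G.coord e s) z) + Real.exp (1 / 2 * k * N) * r) * |s - t| := by
  simp only [restr, weightCut]
  set w := fun s => weight k N x (G.coord e s)
  set c := fun s => max 0 (1 - r * dist (G.coord e s) z) with hc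
  have hc0 : ∀ s, 0 ≤ c s := fun s => le_max_left _ _
  have h1 : |c s - c t| ≤ r * |s - t| := by
    have h1 := abs_max_sub_max_le_abs (1 - r * dist (G.coord e s) z)
      (1 - r * dist (G.coord e t) z) 0
    rw [max_comm _ 0, max_comm _ 0] at h1
    refine h1.trans ?_
    rw [sub_sub_sub_cancel_left, ← mul_sub, abs_mul, abs_of_nonneg hr, abs_sub_comm]
    exact mul_le_mul_of_nonneg_left (abs_dist_coord_sub_le hG e z s t) hr
  have h2 : |w s - w t| ≤ 1 / 2 * k * max (w s) (w t) * |s - t| := abs_weight_sub_le hG hk e s t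
  have h3 : w t ≤ Real.exp (1 / 2 * k * N) := weight_le hk _
  have h4 : 0 < w t := weight_pos _
  calc |w s * c s - w t * c t| = |(w s - w t) * c s + w t * (c s - c t)| := by ring_nf
    _ ≤ |w s - w t| * c s + w t * |c s - c t| := by
        refine (abs_add_le _ _).trans ?_
        rw [abs_mul, abs_mul, abs_of_nonneg (hc0 s), abs_of_pos h4]
    _ ≤ 1 / 2 * k * max (w s) (w t) * |s - t| * c s +
        Real.exp (1 / 2 * k * N) * (r * |s - t|) :=
        add_le_add (mul_le_mul_of_nonneg_right h2 (hc0 s))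
          (mul_le_mul h3 h1 (abs_nonneg _) (Real.exp_pos _).le)
    _ = _ := by ring

theorem cutoff_weightCut [Finite ι] [Finite E] [Nonempty E] (hG : G.Connected) (hk : 0 ≤ k)
    (hr : 0 < r) : Cutoff (weightCut k N r x z) where
  lipschitz := by
    refine ⟨1 / 2 * k * Real.exp (1 / 2 * k * N) * 1 + Real.exp (1 / 2 * k * N) * r,
      fun e s t => (abs_weightCut_sub_le hG hk hr.le e s t).trans ?_⟩
    refine mul_le_mul_of_nonneg_right (add_le_add_left ?_ _) (abs_nonneg _)
    exact mul_le_mul (mul_le_mul_of_nonneg_left (max_le (weight_le hk _) (weight_le hk _))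
      (by positivity)) (tent_le_one hr.le _) (le_max_left _ _) (by positivity)
  bounded := by
    refine ⟨Real.exp (1 / 2 * k * N), fun y => ?_⟩
    rw [weightCut, abs_of_nonneg (mul_nonneg (weight_pos _).le (le_max_left _ _))]
    calc _ ≤ Real.exp (1 / 2 * k * N) * 1 :=
          mul_le_mul (weight_le hk _) (tent_le_one hr.le _) (le_max_left _ _) (Real.exp_pos _).le
      _ = _ := mul_one _
  compact := by
    refine hasCompactSupport_of_dist hG z (1 / r) fun y hy => ?_
    rw [div_lt_iff₀ hr] at hy
    rw [weightCut, max_eq_left (by linarith), mul_zero]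

theorem abs_deriv_weightCut_le [Finite ι] (hG : G.Connected) (hk : 0 ≤ k) (hr : 0 ≤ r)
    (e : E) (t : ℝ) :
    |deriv (G.restr (weightCut k N r x z) e) t| ≤
      1 / 2 * k * G.restr (weightCut k N r x z) e t + Real.exp (1 / 2 * k * N) * r := by
  have hw := continuous_weight_coord (N := N) (x := x) hG hk e
  have hd : Continuous fun s => max 0 (1 - r * dist (G.coord e s) z) :=
    continuous_const.max (continuous_const.sub (continuous_const.mul
      ((continuous_dist_left hG z).comp (continuous_coord e))))
  have := abs_deriv_le_of_local (f := G.restr (weightCut k N r x z) e) (t := t)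
    (w := fun s => 1 / 2 * k * max (weight k N x (G.coord e s)) (weight k N x (G.coord e t)) *
        max 0 (1 - r * dist (G.coord e s) z) + Real.exp (1 / 2 * k * N) * r)
    (((continuous_const.mul (hw.max continuous_const)).mul hd).add continuous_const).continuousAt
    (add_nonneg (mul_nonneg (mul_nonneg (by positivity)
      ((weight_pos _).le.trans (le_max_left _ _))) (le_max_left _ _))
      (mul_nonneg (Real.exp_pos _).le hr))
    fun s => abs_weightCut_sub_le hG hk hr e s t
  rw [max_self] at this
  refine this.trans (le_of_eq ?_)
  simp only [restr, weightCut]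
  ring

theorem deriv_weightCut_sq_le [Finite ι] (hG : G.Connected) (hk : 0 ≤ k) (hr : 0 ≤ r)
    (e : E) (t : ℝ) :
    (deriv (G.restr (weightCut k N r x z) e) t) ^ 2 ≤
      1 / 2 * k ^ 2 * (G.restr (weightCut k N r x z) e t) ^ 2 +
        2 * (Real.exp (1 / 2 * k * N) * r) ^ 2 := by
  rw [← sq_abs (deriv _ _)]
  have h := pow_le_pow_left₀ (abs_nonneg _)
    (abs_deriv_weightCut_le (N := N) (x := x) (z := z) hG hk hr e t) 2
  refine h.trans ?_
  nlinarith [sq_nonneg (1 / 2 * k * G.restr (weightCut k N r x z) e t -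
    Real.exp (1 / 2 * k * N) * r)]

end weight

namespace SolData

variable [Fintype E] {p k Wbar b : ℝ} {W ρ u : G.Point → ℝ}

/-- An Agmon type estimate: exponential decay away from the region where `u` is large. -/
theorem sq_mul_exp_le [Nonempty E] (hG : G.Connected) (S : SolData G p k Wbar b W ρ u)
    {M₀ δ₀ D : ℝ} (hM₀ : 0 < M₀) (hM : ∀ y, |u y| ≤ M₀ * amp p k) (hδ₀ : 0 < δ₀)
    (hb : b * δ₀ ^ (p - 2) ≤ 1 / 8) {m : ℕ} {x : Fin m → G.Point}
    (hcov : ∀ y, δ₀ * amp p k ≤ |u y| → ∃ i, k * dist y (x i) ≤ D) (z : G.Point) :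
    u z ^ 2 * Real.exp (k * ⨅ i, dist z (x i)) ≤
      48 * b * M₀ ^ p * Real.exp (2 * D) * Fintype.card E * m * amp p k ^ 2 := by
  have hk := S.k_pos
  have hp := S.two_lt
  have hbp := S.b_pos
  have hμ : 0 < amp p k := amp_pos hk
  set μ := amp p k with hμdef
  -- Truncating the weight at its value at z keeps it bounded without losing anything at z.
  set N := ⨅ i, dist z (x i) with hN
  set Λ := Real.exp (1 / 2 * k * N) with hΛ
  set U := G.integral fun e t => (G.restr u e t) ^ 2 with hU
  have hUint : G.EdgeIntegrable fun e t => (G.restr u e t) ^ 2 := fun e =>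
    (memH1_iff.1 S.memH1 e).2.1.integrable_sq
  set K := b * M₀ ^ p * k ^ 2 * μ ^ 2 * Real.exp (2 * D) with hK
  have hK0 : 0 ≤ K := by positivity
  have hexpint : ∀ i, G.EdgeIntegrable fun e t => Real.exp (-k * dist (G.coord e t) (x i)) :=
    fun i => edgeIntegrable_exp_dist hG (x i) hk
  have hexpint' : G.EdgeIntegrable fun e t => ∑ i, Real.exp (-k * dist (G.coord e t) (x i)) :=
    fun e => integrable_finsetSum _ fun i _ => hexpint i e
  -- The tent of slope r only provides compact support; its error is O(r²) ∫ u² and disappears as r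
  -- → 0.
  have key : ∀ r : ℝ, 0 < r → k * (u z ^ 2 * Real.exp (k * N)) ≤
      16 * Λ ^ 2 * U * r ^ 2 + 8 * (K * (m * (Fintype.card E * (6 / k)))) := by
    intro r hr
    have hη := cutoff_weightCut (k := k) (N := N) (x := x) (z := z) hG hk.le hr
    set η := weightCut k N r x z with hηdef
    have hη0 : ∀ y, 0 ≤ η y := fun y => mul_nonneg (weight_pos _).le (le_max_left _ _)
    have hφ := (hη.mul_memH1 S.memH1).1
    have h1 := S.energy_mul_cutoff_le hη
    have h2 := hφ.sobolev hG hk S.len_le z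
    have hηz : η z = Λ := by
      rw [hηdef, weightCut, pdist_self, mul_zero, sub_zero, max_eq_right zero_le_one, mul_one,
        weight, min_self]
    have hηz2 : (u z * η z) ^ 2 = u z ^ 2 * Real.exp (k * N) := by
      rw [hηz, mul_pow, hΛ, ← Real.exp_nat_mul]
      congr 2; push_cast; ring
    rw [hηz2] at h2
    have hmul : ∀ e t, (G.restr (fun x => u x * η x) e t) ^ 2 =
      (G.restr u e t) ^ 2 * (G.restr η e t) ^ 2 := fun e t => by simp only [restr]; ring
    set En := G.energy k fun x => u x * η x with hEn
    have hEnint := fun e => hφ.integrableOn_energy k e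
    have h3 : G.integral (fun e t => (G.restr u e t) ^ 2 * (deriv (G.restr η e) t) ^ 2) ≤
        1 / 2 * En + 2 * (Λ * r) ^ 2 * U := by
      rw [hEn, hU, energy, ← integral_const_mul', ← integral_const_mul', ← integral_add'
        (fun e => (hEnint e).const_mul _) (fun e => (hUint e).const_mul _)]
      refine integral_mono' (hη.integrable_mul_deriv S.memH1)
        (fun e => ((hEnint e).const_mul _).add ((hUint e).const_mul _)) fun e =>
        Eventually.of_forall fun t => ?_
      have g1 := mul_le_mul_of_nonneg_left
        (deriv_weightCut_sq_le (k := k) (N := N) (x := x) (z := z) hG hk.le hr.le e t)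
        (sq_nonneg (G.restr u e t))
      refine g1.trans ?_
      rw [hmul]
      have g2 := sq_nonneg (deriv (G.restr (fun x => u x * η x) e) t)
      linarith
    -- Where |u| ≥ δ₀ μ, some center is within D/k, so the weight is bounded and the contribution is
    -- dominated by K Σ exp(-k dist). Elsewhere the coefficient is at most k²/8 and is absorbed by
    -- the energy.
    have h4 : (S.nl fun x => u x * η x) ≤
        1 / 8 * En + K * ∑ i, G.integral fun e t => Real.exp (-k * dist (G.coord e t) (x i)) := by
      rw [← integral_finset_sum' _ hexpint, nl, hEn, energy, ← integral_const_mul',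
        ← integral_const_mul', ← integral_add' (fun e => (hEnint e).const_mul _)
        (fun e => (hexpint' e).const_mul _)]
      refine integral_mono' (S.integrable_nl hG hφ)
        (fun e => ((hEnint e).const_mul _).add ((hexpint' e).const_mul _)) fun e => ?_
      filter_upwards [S.coeff_le e] with t g1
      have gS : 0 ≤ ∑ i, Real.exp (-k * dist (G.coord e t) (x i)) :=
        Finset.sum_nonneg fun i _ => (Real.exp_pos _).le
      have gE : 0 ≤ 1 / 8 * (deriv (G.restr (fun x => u x * η x) e) t) ^ 2 := by positivity
      by_cases hbig : δ₀ * μ ≤ |G.restr u e t|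
      · obtain ⟨i, hi⟩ := hcov (G.coord e t) hbig
        have g2 : Real.exp (-D) ≤ ∑ i, Real.exp (-k * dist (G.coord e t) (x i)) :=
          (Real.exp_le_exp.2 (by linarith)).trans (Finset.single_le_sum
            (f := fun i => Real.exp (-k * dist (G.coord e t) (x i)))
            (fun i _ => (Real.exp_pos _).le) (Finset.mem_univ i))
        have g3 : G.restr η e t ≤ Real.exp (1 / 2 * D) := by
          calc G.restr η e t ≤ weight k N x (G.coord e t) * 1 :=
                mul_le_mul_of_nonneg_left (tent_le_one hr.le _) (weight_pos _).le
            _ ≤ Real.exp (1 / 2 * D) := by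
                rw [mul_one]
                refine Real.exp_le_exp.2 ?_
                have h5 := (min_le_left (⨅ i, dist (G.coord e t) (x i)) N).trans
                  (iInf_pdist_le x (G.coord e t) i)
                have := mul_le_mul_of_nonneg_left h5 hk.le
                linarith
        have g4 : (G.restr η e t) ^ 2 ≤ Real.exp D := by
          have := pow_le_pow_left₀ (hη0 _) g3 2
          rw [← Real.exp_nat_mul] at this
          refine this.trans (le_of_eq ?_)
          congr 1; push_cast; ring
        have g5 : S.coeff e t * (G.restr u e t) ^ 2 ≤ b * M₀ ^ p * k ^ 2 * μ ^ 2 := by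
          calc S.coeff e t * (G.restr u e t) ^ 2
              ≤ b * |G.restr u e t| ^ (p - 2) * (G.restr u e t) ^ 2 :=
                mul_le_mul_of_nonneg_right g1 (sq_nonneg _)
            _ = b * |G.restr u e t| ^ p := by
                rw [mul_assoc, abs_rpow_mul_sq (by linarith)]; ring_nf
            _ ≤ b * (M₀ * μ) ^ p := by
                refine mul_le_mul_of_nonneg_left ?_ hbp.le
                exact Real.rpow_le_rpow (abs_nonneg _) (hM _) (by linarith)
            _ = _ := by rw [Real.mul_rpow hM₀.le hμ.le, S.amp_rpow_p]; ring
        have g6 : S.coeff e t * (G.restr (fun x => u x * η x) e t) ^ 2 ≤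
            K * ∑ i, Real.exp (-k * dist (G.coord e t) (x i)) := by
          calc S.coeff e t * (G.restr (fun x => u x * η x) e t) ^ 2
              = S.coeff e t * (G.restr u e t) ^ 2 * (G.restr η e t) ^ 2 := by rw [hmul]; ring
            _ ≤ b * M₀ ^ p * k ^ 2 * μ ^ 2 * Real.exp D :=
                mul_le_mul g5 g4 (sq_nonneg _) (by positivity)
            _ = K * Real.exp (-D) := by
                rw [hK, mul_assoc _ (Real.exp (2 * D)), ← Real.exp_add]; ring_nf
            _ ≤ _ := mul_le_mul_of_nonneg_left g2 hK0
        have gF : 0 ≤ k ^ 2 * (G.restr (fun x => u x * η x) e t) ^ 2 := by positivity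
        linarith
      · have g2 : S.coeff e t ≤ 1 / 8 * k ^ 2 := by
          refine g1.trans ?_
          calc b * |G.restr u e t| ^ (p - 2) ≤ b * (δ₀ * μ) ^ (p - 2) :=
                mul_le_mul_of_nonneg_left (Real.rpow_le_rpow (abs_nonneg _) (not_le.1 hbig).le
                  (by linarith)) hbp.le
            _ = b * δ₀ ^ (p - 2) * k ^ 2 := by
                rw [Real.mul_rpow hδ₀.le hμ.le, amp_rpow hp]; ring
            _ ≤ _ := mul_le_mul_of_nonneg_right hb (sq_nonneg k)
        have g3 := mul_le_mul_of_nonneg_right g2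
          (sq_nonneg (G.restr (fun x => u x * η x) e t))
        have g4 := mul_nonneg hK0 gS
        linarith
    have h5 : ∑ i, G.integral (fun e t => Real.exp (-k * dist (G.coord e t) (x i))) ≤
        m * (Fintype.card E * (6 / k)) := by
      calc _ ≤ ∑ _i : Fin m, (Fintype.card E * (6 / k)) :=
            Finset.sum_le_sum fun i _ => integral_exp_dist_le hG (x i) hk
        _ = _ := by simp
    have h6 := mul_le_mul_of_nonneg_left h5 hK0
    -- The absorbed part is 8 (1/2 + 1/8) En = 5 En out of 7 En, hence 2 En remains.
    have h7 : 2 * En ≤ 16 * Λ ^ 2 * U * r ^ 2 + 8 * (K * (m * (Fintype.card E * (6 / k)))) := by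
      linarith
    exact h2.trans h7
  have hlim : k * (u z ^ 2 * Real.exp (k * N)) ≤ 8 * (K * (m * (Fintype.card E * (6 / k)))) := by
    have ht : Tendsto (fun r : ℝ => 16 * Λ ^ 2 * U * r ^ 2 +
        8 * (K * (m * (Fintype.card E * (6 / k))))) (𝓝[>] 0)
        (𝓝 (16 * Λ ^ 2 * U * 0 ^ 2 + 8 * (K * (m * (Fintype.card E * (6 / k)))))) :=
      (Continuous.tendsto (by fun_prop) 0).mono_left nhdsWithin_le_nhds
    have := ge_of_tendsto ht (eventually_nhdsWithin_of_forall fun r hr => key r hr)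
    simpa using this
  have heq : 8 * (K * (m * (Fintype.card E * (6 / k)))) =
      k * (48 * b * M₀ ^ p * Real.exp (2 * D) * Fintype.card E * m * μ ^ 2) := by
    rw [hK]; field_simp; ring
  rw [heq] at hlim
  exact le_of_mul_le_mul_left hlim hk

end SolData

end MetricGraph

/-! ### Minimal covers and concentration points. -/

theorem tendsto_iInf_atTop {ι : Type*} [Finite ι] [Nonempty ι] {f : ι → ℕ → ℝ}
    (hf : ∀ i, Tendsto (f i) atTop atTop) : Tendsto (fun n => ⨅ i, f i n) atTop atTop := by
  refine tendsto_atTop.2 fun B => ?_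
  filter_upwards [eventually_all.2 fun i => tendsto_atTop.1 (hf i) B] with n hn
  exact le_ciInf hn

/-- A sequence of pseudodistances on a set. -/
structure IsPseudoDistSeq {X : Type*} (d : ℕ → X → X → ℝ) : Prop where
  symm : ∀ n x y, d n x y = d n y x
  triangle : ∀ n x y z, d n x z ≤ d n x y + d n y z

/-- Along a subsequence, the sets `S n` are covered by `m` balls of fixed radius. -/
def CoveredBy {X : Type*} (d : ℕ → X → X → ℝ) (S : ℕ → Set X) (m : ℕ) : Prop :=
  ∃ σ : ℕ → ℕ, StrictMono σ ∧ ∃ (D : ℝ) (x : Fin m → ℕ → X),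
    ∀ n, ∀ y ∈ S (σ n), ∃ i, d (σ n) y (x i n) ≤ D

section cover

variable {X : Type*} {d : ℕ → X → X → ℝ} {S : ℕ → Set X}

/-- A separated subset of largest cardinality is a net: a point farther than L from all its members
could be added to it. -/
theorem coveredBy_of_separated (hd : IsPseudoDistSeq d) {L : ℝ} {M : ℕ}
    (hne : ∀ n, (S n).Nonempty)
    (hsep : ∀ n N (x : Fin N → X), (∀ i, x i ∈ S n) →
      (∀ i j, i ≠ j → L < d n (x i) (x j)) → N ≤ M) : CoveredBy d S M := by
  classical
  have key : ∀ n, ∃ x : Fin M → X, ∀ y ∈ S n, ∃ i, d n y (x i) ≤ L := by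
    intro n
    set Q : ℕ → Prop := fun N => ∃ x : Fin N → X, (∀ i, x i ∈ S n) ∧
      ∀ i j, i ≠ j → L < d n (x i) (x j) with hQ
    have hQ0 : Q 0 := ⟨Fin.elim0, fun i => i.elim0, fun i => i.elim0⟩
    obtain ⟨x, hxS, hx⟩ : Q (Nat.findGreatest Q M) := Nat.findGreatest_spec (Nat.zero_le M) hQ0
    have hmax : ¬ Q (Nat.findGreatest Q M + 1) := by
      intro h
      have h1 : Nat.findGreatest Q M + 1 ≤ M := by
        obtain ⟨x, h2, h3⟩ := h
        exact hsep n _ x h2 h3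
      have := Nat.le_findGreatest h1 h
      omega
    have hle : Nat.findGreatest Q M ≤ M := Nat.findGreatest_le M
    generalize Nat.findGreatest Q M = N at *
    obtain ⟨y₀, hy₀⟩ := hne n
    -- The net may have fewer than M points; the remaining centers are filled with an arbitrary
    -- point of `S n`.
    refine ⟨fun i => if h : (i : ℕ) < N then x ⟨i, h⟩ else y₀, fun y hy => ?_⟩
    by_contra! hcon
    have hy2 : ∀ j : Fin N, L < d n y (x j) := fun j => by
      simpa using hcon ⟨j, lt_of_lt_of_le j.2 hle⟩
    refine hmax ⟨Fin.cons y x, Fin.cases hy hxS, ?_⟩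
    refine Fin.cases (fun j => ?_) (fun i => ?_)
    · refine Fin.cases (fun h => absurd rfl h) (fun j _ => ?_) j
      simpa using hy2 j
    · refine Fin.cases (fun _ => ?_) (fun j h => ?_)
      · rw [hd.symm]; simpa using hy2 i
      · simpa using hx i j fun h' => h (by rw [h'])
  choose x hx using key
  exact ⟨id, strictMono_id, L, fun i n => x n i, hx⟩

/-- Minimal covers by balls of fixed radius: the centers drift apart from each other. -/
theorem exists_clusters (hd : IsPseudoDistSeq d) {L : ℝ} {M : ℕ}
    (hne : ∀ n, (S n).Nonempty)
    (hsep : ∀ n N (x : Fin N → X), (∀ i, x i ∈ S n) →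
      (∀ i j, i ≠ j → L < d n (x i) (x j)) → N ≤ M) :
    ∃ σ : ℕ → ℕ, StrictMono σ ∧ ∃ m, 1 ≤ m ∧ m ≤ M ∧ ∃ (D : ℝ) (x : Fin m → ℕ → X),
      (∀ n, ∀ y ∈ S (σ n), ∃ i, d (σ n) y (x i n) ≤ D) ∧
      (∀ n i, ∃ y ∈ S (σ n), d (σ n) y (x i n) ≤ D) ∧
      ∀ i j, i ≠ j → Tendsto (fun n => d (σ n) (x i n) (x j n)) atTop atTop := by
  classical
  -- The least m over all subsequences and all radii: minimality forbids both merging two balls and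
  -- discarding one, even along a further subsequence.
  have hex : ∃ m, CoveredBy d S m := ⟨M, coveredBy_of_separated hd hne hsep⟩
  obtain ⟨σ, hσ, D, x, hx⟩ := Nat.find_spec hex
  have hM := Nat.find_min' hex (coveredBy_of_separated hd hne hsep)
  have hmin : ∀ m', m' < Nat.find hex → ¬ CoveredBy d S m' := fun m' h => Nat.find_min hex h
  generalize Nat.find hex = m at *
  obtain _ | m := m
  · obtain ⟨y, hy⟩ := hne (σ 0)
    obtain ⟨i, _⟩ := hx 0 y hy
    exact i.elim0
  have hfar : ∀ i j, i ≠ j → Tendsto (fun n => d (σ n) (x i n) (x j n)) atTop atTop := by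
    intro i j hij
    by_contra hcon
    rw [tendsto_atTop] at hcon
    push Not at hcon
    obtain ⟨B, hB⟩ := hcon
    obtain ⟨τ, hτ, hτB⟩ := extraction_of_frequently_atTop hB
    obtain ⟨i', hi'⟩ := Fin.exists_succAbove_eq hij
    -- Two centers at distance below B along a subsequence: ball j lies in the ball of radius D + B
    -- about center i, so m balls suffice.
    refine hmin m (Nat.lt_succ_self m) ⟨σ ∘ τ, hσ.comp hτ, max D (D + B),
      fun l n => x (j.succAbove l) (τ n), fun n y hy => ?_⟩
    obtain ⟨l, hl⟩ := hx (τ n) y hy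
    by_cases hlj : l = j
    · refine ⟨i', le_trans ?_ (le_max_right _ _)⟩
      change d (σ (τ n)) y (x (j.succAbove i') (τ n)) ≤ _
      rw [hi']
      have h1 := hd.triangle (σ (τ n)) y (x j (τ n)) (x i (τ n))
      have h2 := hτB n
      rw [hlj] at hl
      rw [hd.symm] at h2
      exact h1.trans (add_le_add hl h2.le)
    · obtain ⟨l', hl'⟩ := Fin.exists_succAbove_eq hlj
      refine ⟨l', le_trans ?_ (le_max_left _ _)⟩
      change d (σ (τ n)) y (x (j.succAbove l') (τ n)) ≤ _
      rw [hl']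
      exact hl
  have hmeet : ∀ i, ∀ᶠ n in atTop, ∃ y ∈ S (σ n), d (σ n) y (x i n) ≤ D := by
    intro i
    by_contra hcon
    obtain ⟨τ, hτ, hτB⟩ := extraction_of_frequently_atTop (not_eventually.1 hcon)
    refine hmin m (Nat.lt_succ_self m) ⟨σ ∘ τ, hσ.comp hτ, D,
      fun l n => x (i.succAbove l) (τ n), fun n y hy => ?_⟩
    obtain ⟨l, hl⟩ := hx (τ n) y hy
    have hli : l ≠ i := by
      rintro rfl
      exact hτB n ⟨y, hy, hl⟩
    obtain ⟨l', hl'⟩ := Fin.exists_succAbove_eq hli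
    exact ⟨l', by
      change d (σ (τ n)) y (x (i.succAbove l') (τ n)) ≤ _
      rw [hl']; exact hl⟩
  obtain ⟨n₀, hn₀⟩ := eventually_atTop.1 (eventually_all.2 hmeet)
  refine ⟨fun n => σ (n + n₀), fun a c h => hσ (by omega), m + 1, by omega, hM, D,
    fun i n => x i (n + n₀), fun n y hy => hx _ y hy, fun n i => hn₀ _ (by omega) i,
    fun i j hij => (hfar i j hij).comp (tendsto_add_atTop_nat n₀)⟩

end cover

namespace MetricGraph

variable {V E : Type*} {G : MetricGraph V E}

theorem isPseudoDistSeq_mul_dist (hG : G.Connected) {k : ℕ → ℝ} (hk : ∀ n, 0 < k n) :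
    IsPseudoDistSeq fun n (x y : G.Point) => k n * dist x y where
  symm n x y := by rw [pdist_comm]
  triangle n x y z := by
    rw [← mul_add]; exact mul_le_mul_of_nonneg_left (pdist_triangle hG x y z) (hk n).le

/-- Concentration points: local maxima drifting apart at scale `1 / k`, such that `|u|` is
smaller than the level `c` away from them. -/
theorem exists_concentration_points [Finite E] [Nonempty E] (hG : G.Connected) {k : ℕ → ℝ}
    (hk : ∀ n, 0 < k n) {u : ℕ → G.Point → ℝ} (hu : ∀ n, Continuous (u n)) {c : ℕ → ℝ} {L : ℝ}
    {M : ℕ} (hne : ∀ n, ∃ y, c n ≤ |u n y|)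
    (hsep : ∀ n N (x : Fin N → G.Point), (∀ i, c n ≤ |u n (x i)|) →
      (∀ i j, i ≠ j → L < k n * dist (x i) (x j)) → N ≤ M) :
    ∃ σ : ℕ → ℕ, StrictMono σ ∧ ∃ m, 1 ≤ m ∧ m ≤ M ∧
      ∃ (x : Fin m → ℕ → G.Point) (R : ℕ → ℝ) (D : ℝ),
      (∀ n, 0 < R n) ∧ Tendsto R atTop atTop ∧
      (∀ i j, i ≠ j → Tendsto (fun n => k (σ n) * dist (x i n) (x j n)) atTop atTop) ∧
      (∀ i n y, k (σ n) * dist y (x i n) < R n → |u (σ n) y| ≤ |u (σ n) (x i n)|) ∧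
      (∀ i n, c (σ n) ≤ |u (σ n) (x i n)|) ∧
      (∀ n y, c (σ n) ≤ |u (σ n) y| → ∃ i, k (σ n) * dist y (x i n) ≤ D) := by
  have hd := isPseudoDistSeq_mul_dist hG hk
  obtain ⟨σ, hσ, m, hm1, hmM, D, z, hcov, hmeet, hfar⟩ :=
    exists_clusters (S := fun n => {y | c n ≤ |u n y|}) hd hne hsep
  -- The center of each ball is replaced by a maximum point of |u| over it; the value there is at
  -- least c because the ball meets the superlevel set.
  have hmax : ∀ i n, ∃ x, k (σ n) * dist x (z i n) ≤ D ∧ c (σ n) ≤ |u (σ n) x| ∧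
      ∀ y, k (σ n) * dist y (z i n) ≤ D → |u (σ n) y| ≤ |u (σ n) x| := by
    intro i n
    have hset : ∀ y, k (σ n) * dist y (z i n) ≤ D ↔ y ∈ {y | dist y (z i n) ≤ D / k (σ n)} := by
      intro y
      rw [Set.mem_ofPred_eq, le_div_iff₀ (hk _), mul_comm]
    obtain ⟨y₀, hy₀, hy₀D⟩ := hmeet n i
    obtain ⟨x, hx, hxmax⟩ := (isCompact_closedBall hG (z i n) (D / k (σ n))).exists_isMaxOn
      ⟨y₀, (hset y₀).1 hy₀D⟩ (hu (σ n)).abs.continuousOn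
    exact ⟨x, (hset x).2 hx, le_trans hy₀ (hxmax ((hset y₀).1 hy₀D)),
      fun y hy => hxmax ((hset y).1 hy)⟩
  choose x hxD hxc hxmax using hmax
  have hfar' : ∀ i j, i ≠ j →
      Tendsto (fun n => k (σ n) * dist (x i n) (x j n)) atTop atTop := by
    intro i j hij
    refine tendsto_atTop_mono (fun n => ?_) (tendsto_atTop_add_const_right _ (-(2 * D))
      (hfar i j hij))
    have h1 := hd.triangle (σ n) (z i n) (x i n) (z j n)
    have h2 := hd.triangle (σ n) (x i n) (x j n) (z j n)
    have h3 := hxD i n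
    have h4 := hxD j n
    rw [pdist_comm] at h3
    linarith
  have : Nonempty (Fin m) := ⟨⟨0, hm1⟩⟩
  -- Smallest rescaled distance between distinct centers. The diagonal entries n keep the infimum
  -- divergent also when m = 1.
  set F : ℕ → ℝ := fun n => ⨅ q : Fin m × Fin m,
    if q.1 = q.2 then (n : ℝ) else k (σ n) * dist (z q.1 n) (z q.2 n) with hF
  have hFlim : Tendsto F atTop atTop := by
    refine tendsto_iInf_atTop fun q => ?_
    by_cases h : q.1 = q.2
    · simpa only [h, if_true] using tendsto_natCast_atTop_atTop
    · simpa only [h, if_false] using hfar _ _ h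
  have hFle : ∀ n i j, i ≠ j → F n ≤ k (σ n) * dist (z i n) (z j n) := by
    intro n i j hij
    have := ciInf_le (f := fun q : Fin m × Fin m =>
      if q.1 = q.2 then (n : ℝ) else k (σ n) * dist (z q.1 n) (z q.2 n))
      (Set.finite_range _).bddBelow (i, j)
    simpa only [hij, if_false] using this
  have hRlim : Tendsto (fun n => F n - 2 * D) atTop atTop :=
    tendsto_atTop_add_const_right _ _ hFlim
  obtain ⟨n₀, hn₀⟩ := eventually_atTop.1 (hRlim.eventually_gt_atTop 0)
  have hmono : StrictMono fun n => n + n₀ := fun a c h => by simpa using h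
  refine ⟨fun n => σ (n + n₀), hσ.comp hmono, m, hm1, hmM, fun i n => x i (n + n₀),
    fun n => F (n + n₀) - 2 * D, 2 * D, fun n => hn₀ _ (by omega),
    hRlim.comp (tendsto_add_atTop_nat n₀),
    fun i j hij => (hfar' i j hij).comp (tendsto_add_atTop_nat n₀), ?_,
    fun i n => hxc i _, ?_⟩
  · intro i n y hy
    by_cases hyc : c (σ (n + n₀)) ≤ |u (σ (n + n₀)) y|
    · obtain ⟨j, hj⟩ := hcov (n + n₀) y hyc
      by_cases hij : i = j
      · subst hij
        exact hxmax i _ y hj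
      -- A point closer than F - 2D to x_i and within D of another center z_j would put z_i and z_j
      -- closer than F.
      · exfalso
        have h1 := hFle (n + n₀) i j hij
        have h2 := hd.triangle (σ (n + n₀)) (z i (n + n₀)) (x i (n + n₀)) (z j (n + n₀))
        have h3 := hd.triangle (σ (n + n₀)) (x i (n + n₀)) y (z j (n + n₀))
        have h4 := hxD i (n + n₀)
        rw [pdist_comm] at h4 hy
        linarith
    · exact (not_le.1 hyc).le.trans (hxc i _)
  · intro n y hy
    obtain ⟨j, hj⟩ := hcov (n + n₀) y hy
    refine ⟨j, ?_⟩
    have h2 := hd.triangle (σ (n + n₀)) y (z j (n + n₀)) (x j (n + n₀))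
    have h4 := hxD j (n + n₀)
    rw [pdist_comm] at h4
    linarith

end MetricGraph

/-! ### Power integrals: convergence for all exponents and lower bounds. -/

/-- The derivative of a^s in s is a^s log a, and a |log a| ≤ 2 a^(1/2) on (0, 1]. The majorant
a^(1/2) is still integrable for exponentially decaying a and does not depend on q and r. -/
theorem abs_rpow_sub_rpow_le {a q r : ℝ} (h0 : 0 ≤ a) (h1 : a ≤ 1) (hq : 1 ≤ q) (hr : 1 ≤ r) :
    |a ^ q - a ^ r| ≤ 2 * |q - r| * a ^ (1 / 2 : ℝ) := by
  wlog hqr : q ≤ r generalizing q r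
  · rw [abs_sub_comm, abs_sub_comm q]
    exact this hr hq (not_le.1 hqr).le
  rcases h0.eq_or_lt with rfl | h0
  · rw [Real.zero_rpow (by linarith), Real.zero_rpow (by linarith), Real.zero_rpow (by norm_num)]
    simp
  rw [abs_of_nonneg (sub_nonneg.2 (Real.rpow_le_rpow_of_exponent_ge h0 h1 hqr)),
    abs_sub_comm q, abs_of_nonneg (sub_nonneg.2 hqr)]
  have e1 : a ^ r = a ^ q * a ^ (r - q) := by rw [← Real.rpow_add h0]; ring_nf
  have e2 : 1 - (r - q) * (-Real.log a) ≤ a ^ (r - q) := by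
    rw [Real.rpow_def_of_pos h0]
    have := Real.add_one_le_exp (Real.log a * (r - q))
    linarith
  have e3 : a ^ q ≤ a := by
    simpa using Real.rpow_le_rpow_of_exponent_ge h0 h1 hq
  have e4 : -Real.log a ≤ 2 * a ^ (-(1 / 2) : ℝ) := by
    have := Real.log_le_sub_one_of_pos (Real.rpow_pos_of_pos h0 (-(1 / 2)))
    rw [Real.log_rpow h0] at this
    linarith
  have e5 : 0 ≤ -Real.log a := neg_nonneg.2 (Real.log_nonpos h0.le h1)
  have e6 : a * a ^ (-(1 / 2) : ℝ) = a ^ (1 / 2 : ℝ) := by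
    nth_rewrite 1 [← Real.rpow_one a]
    rw [← Real.rpow_add h0]; norm_num
  have hq0 : 0 < a ^ q := Real.rpow_pos_of_pos h0 q
  have hd : 0 ≤ r - q := sub_nonneg.2 hqr
  calc a ^ q - a ^ r = a ^ q * (1 - a ^ (r - q)) := by rw [e1]; ring
    _ ≤ a ^ q * ((r - q) * (-Real.log a)) := mul_le_mul_of_nonneg_left (by linarith) hq0.le
    _ ≤ a * ((r - q) * (2 * a ^ (-(1 / 2) : ℝ))) :=
        mul_le_mul e3 (mul_le_mul_of_nonneg_left e4 hd) (mul_nonneg hd e5) h0.le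
    _ = 2 * (r - q) * (a * a ^ (-(1 / 2) : ℝ)) := by ring
    _ = _ := by rw [e6]

/-- A bounded and uniformly Lipschitz sequence of functions has a pointwise convergent
subsequence. -/
theorem exists_subseq_tendsto_of_lipschitz {s : Set ℝ} {J : ℕ → ℝ → ℝ} {B K : ℝ}
    (hB : ∀ n, ∀ q ∈ s, |J n q| ≤ B)
    (hK : ∀ n, ∀ q ∈ s, ∀ r ∈ s, |J n q - J n r| ≤ K * |q - r|) :
    ∃ τ : ℕ → ℕ, StrictMono τ ∧ ∀ q ∈ s, ∃ ℓ, Tendsto (fun n => J (τ n) q) atTop (𝓝 ℓ) := by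
  obtain ⟨T, hTc, hTd⟩ := TopologicalSpace.exists_countable_dense s
  have := hTc.to_subtype
  -- Compactness of the product gives convergence on a countable dense set of exponents; the uniform
  -- Lipschitz bound then makes the sequence Cauchy at every exponent.
  obtain ⟨g, -, τ, hτ, hlim⟩ := (isCompact_univ_pi fun _ : T => isCompact_Icc).tendsto_subseq
    (x := fun n (r : T) => J n r.1.1) fun n r _ => abs_le.1 (hB n r.1.1 r.1.2)
  rw [tendsto_pi_nhds] at hlim
  refine ⟨τ, hτ, fun q hq => cauchySeq_tendsto_of_complete (Metric.cauchySeq_iff'.2 fun ε hε => ?_)⟩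
  obtain ⟨r, hrT, hr⟩ := hTd.exists_dist_lt (⟨q, hq⟩ : s) (ε := ε / (3 * (|K| + 1)))
    (by positivity)
  have hr' : K * |q - r.1| < ε / 3 := by
    have h1 : |q - r.1| < ε / (3 * (|K| + 1)) := hr
    rw [lt_div_iff₀ (by positivity)] at h1
    have h2 : K * |q - r.1| ≤ |K| * |q - r.1| :=
      mul_le_mul_of_nonneg_right (le_abs_self K) (abs_nonneg _)
    linarith [abs_nonneg (q - r.1)]
  obtain ⟨N, hN⟩ := Metric.cauchySeq_iff'.1 (hlim ⟨r, hrT⟩).cauchySeq (ε / 3) (by positivity)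
  refine ⟨N, fun n hn => ?_⟩
  have h1 := hN n hn
  have h2 := (hK (τ n) q hq r.1 r.2).trans_lt hr'
  have h3 := (hK (τ N) q hq r.1 r.2).trans_lt hr'
  simp only [Real.dist_eq, Function.comp_apply] at h1 ⊢
  rw [abs_lt] at h1 h2 h3 ⊢
  constructor <;> linarith

namespace MetricGraph

variable {V E : Type*} {G : MetricGraph V E}

theorem exp_neg_iInf_le {m : ℕ} (hm : 1 ≤ m) (x : Fin m → G.Point) {κ : ℝ} (y : G.Point) :
    Real.exp (-κ * ⨅ i, dist y (x i)) ≤ ∑ i, Real.exp (-κ * dist y (x i)) := by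
  have : Nonempty (Fin m) := ⟨⟨0, hm⟩⟩
  obtain ⟨i, hi⟩ := exists_eq_ciInf_of_finite (f := fun i => dist y (x i))
  rw [← hi]
  exact Finset.single_le_sum (f := fun i => Real.exp (-κ * dist y (x i)))
    (fun i _ => (Real.exp_pos _).le) (Finset.mem_univ i)

/-- Integrability of powers of exponentially decaying functions. -/
theorem integral_rpow_le [Fintype E] (hG : G.Connected) {v : G.Point → ℝ} (hv : Continuous v)
    (h0 : ∀ y, 0 ≤ v y) {m : ℕ} (hm : 1 ≤ m) {x : Fin m → G.Point} {C k q : ℝ} (hC : 0 ≤ C)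
    (hk : 0 < k) (hq : 0 < q)
    (h : ∀ y, v y ≤ C * Real.exp (-(1 / 2) * k * ⨅ i, dist y (x i))) :
    G.EdgeIntegrable (fun e t => (G.restr v e t) ^ q) ∧
    k * G.integral (fun e t => (G.restr v e t) ^ q) ≤
      C ^ q * (m * (Fintype.card E * (12 / q))) := by
  have hκ : 0 < q / 2 * k := by positivity
  have hexpint : ∀ i, G.EdgeIntegrable
      fun e t => Real.exp (-(q / 2 * k) * dist (G.coord e t) (x i)) :=
    fun i => edgeIntegrable_exp_dist hG (x i) hκ
  have hdom : G.EdgeIntegrable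
      fun e t => C ^ q * ∑ i, Real.exp (-(q / 2 * k) * dist (G.coord e t) (x i)) :=
    fun e => (integrable_finsetSum _ fun i _ => hexpint i e).const_mul _
  have hle : ∀ e t, (G.restr v e t) ^ q ≤
      C ^ q * ∑ i, Real.exp (-(q / 2 * k) * dist (G.coord e t) (x i)) := by
    intro e t
    calc (G.restr v e t) ^ q
        ≤ (C * Real.exp (-(1 / 2) * k * ⨅ i, dist (G.coord e t) (x i))) ^ q :=
          Real.rpow_le_rpow (h0 _) (h _) hq.le
      _ = C ^ q * Real.exp (-(q / 2 * k) * ⨅ i, dist (G.coord e t) (x i)) := by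
          rw [Real.mul_rpow hC (Real.exp_pos _).le, ← Real.exp_mul]; ring_nf
      _ ≤ _ := mul_le_mul_of_nonneg_left (exp_neg_iInf_le hm x _) (Real.rpow_nonneg hC q)
  have hint : G.EdgeIntegrable (fun e t => (G.restr v e t) ^ q) := by
    intro e
    refine (hdom e).mono' ?_ (Eventually.of_forall fun t => ?_)
    · exact ((hv.comp (continuous_coord e)).rpow_const fun _ => Or.inr hq.le).aestronglyMeasurable
    · refine (Real.norm_of_nonneg (Real.rpow_nonneg (h0 _) q)).le.trans ?_
      exact hle e t
  refine ⟨hint, ?_⟩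
  calc _ ≤ k * G.integral
        fun e t => C ^ q * ∑ i, Real.exp (-(q / 2 * k) * dist (G.coord e t) (x i)) :=
        mul_le_mul_of_nonneg_left (integral_mono' hint hdom fun e =>
          Eventually.of_forall fun t => hle e t) hk.le
    _ = k * (C ^ q * ∑ i, G.integral
        fun e t => Real.exp (-(q / 2 * k) * dist (G.coord e t) (x i))) := by
        rw [integral_const_mul', integral_finset_sum' _ hexpint]
    _ ≤ k * (C ^ q * ∑ _i : Fin m, (Fintype.card E * (6 / (q / 2 * k)))) := by
        gcongr with i
        exact integral_exp_dist_le hG (x i) hκ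
    _ = _ := by
        simp only [Finset.sum_const, Finset.card_univ, Fintype.card_fin, nsmul_eq_mul]
        field_simp
        ring

namespace SolData

/-- A solution with a large value has a definite amount of `L^q` mass. -/
theorem exists_le_integral_rpow (p b M₀ δ₀ q : ℝ) (hp : 2 < p) (hb : 0 < b) (hM₀ : 0 < M₀)
    (hδ₀ : 0 < δ₀) (hq : 0 < q) (n : ℕ) (hn1 : 1 ≤ n) :
    ∃ c, 0 < c ∧ ∀ {V E : Type*} [Fintype E] [Nonempty E] {G : MetricGraph V E}
      (_ : Fintype.card E = n) (_ : G.Connected) {k Wbar : ℝ} {W ρ u : G.Point → ℝ}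
      (_ : SolData G p k Wbar b W ρ u) (_ : ∀ x, |u x| ≤ M₀ * amp p k)
      (_ : G.EdgeIntegrable fun e t => (|G.restr u e t| / (M₀ * amp p k)) ^ q)
      (x : G.Point), δ₀ * amp p k ≤ |u x| →
        c ≤ k * G.integral fun e t => (|G.restr u e t| / (M₀ * amp p k)) ^ q := by
  set Γ := 1 + b * M₀ ^ (p - 2) with hΓ
  have hΓ0 : 0 < Γ := by positivity
  have hn0 : (0:ℝ) < n := by exact_mod_cast hn1
  -- With this τ² the region v ≤ τ accounts for at most δ₀²/8, half of the δ₀²/4 that the Sobolev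
  -- inequality demands at x; the L^q mass must supply the rest.
  set T := δ₀ ^ 2 / (192 * n * Γ * M₀ ^ 2) with hT
  set τ := √T with hτ
  have hτ0 : 0 < τ := Real.sqrt_pos.2 (by positivity)
  have hτ2 : τ ^ 2 = T := Real.sq_sqrt (by positivity)
  refine ⟨τ ^ q * (δ₀ ^ 2 / (32 * Γ * M₀ ^ 2)), by positivity, ?_⟩
  intro V E _ _ G hn hG k Wbar W ρ u S hM hvint x hx
  have hk := S.k_pos
  have hμ : 0 < amp p k := amp_pos hk
  set μ := amp p k with hμdef
  set P := M₀ * μ with hP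
  have hP0 : 0 < P := by positivity
  set J := G.integral fun e t => (|G.restr u e t| / P) ^ q with hJ
  have hη := cutoff_expCut (c := k) (δ := 1 / 2) (x := x) hG hk (by norm_num)
  set η := expCut k (1 / 2) x with hηdef
  have h1 := S.energy_mul_cutoff_le hη
  have h2 := (hη.mul_memH1 S.memH1).1.sobolev hG hk S.len_le x
  rw [show η x = 1 - 1 / 2 from expCut_self (by norm_num)] at h2
  have hI := edgeIntegrable_exp_dist hG x hk
  have hIle := integral_exp_dist_le hG x hk
  rw [hn] at hIle
  set I := G.integral fun e t => Real.exp (-k * dist (G.coord e t) x)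
  -- Majorant of u² exp(-k dist): the first term serves where v ≤ τ, and the second where v ≥ τ,
  -- since there v² ≤ 1 ≤ (v/τ)^q.
  set F : E → ℝ → ℝ := fun e t => P ^ 2 * τ ^ 2 * Real.exp (-k * dist (G.coord e t) x) +
    P ^ 2 * (τ ^ q)⁻¹ * (|G.restr u e t| / P) ^ q with hF
  have hFint : G.EdgeIntegrable F := fun e => ((hI e).const_mul _).add ((hvint e).const_mul _)
  have hFeq : G.integral F = P ^ 2 * τ ^ 2 * I + P ^ 2 * (τ ^ q)⁻¹ * J := by
    rw [hF, integral_add' (fun e => (hI e).const_mul _) (fun e => (hvint e).const_mul _),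
      integral_const_mul', integral_const_mul']
  have hexp2 : ∀ e t, Real.exp (-k * dist (G.coord e t) x) ^ 2 ≤
      Real.exp (-k * dist (G.coord e t) x) := fun e t => by
    have : Real.exp (-k * dist (G.coord e t) x) ≤ 1 := by
      rw [Real.exp_le_one_iff]; nlinarith [pdist_nonneg (G.coord e t) x]
    nlinarith [Real.exp_pos (-k * dist (G.coord e t) x)]
  have hu2 : ∀ e t, (G.restr u e t) ^ 2 * Real.exp (-k * dist (G.coord e t) x) ≤ F e t := by
    intro e t
    set v := |G.restr u e t| / P with hv
    have hv0 : 0 ≤ v := by positivity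
    have hv1 : v ≤ 1 := (div_le_one hP0).2 (hM _)
    have hX0 := Real.exp_pos (-k * dist (G.coord e t) x)
    have hX1 : Real.exp (-k * dist (G.coord e t) x) ≤ 1 := by
      rw [Real.exp_le_one_iff]; nlinarith [pdist_nonneg (G.coord e t) x]
    have huv : (G.restr u e t) ^ 2 = P ^ 2 * v ^ 2 := by
      rw [hv, div_pow, sq_abs]; field_simp
    rw [huv, hF]
    simp only
    rw [← hv, mul_assoc, mul_assoc (P ^ 2), mul_assoc (P ^ 2), ← mul_add]
    refine mul_le_mul_of_nonneg_left ?_ (sq_nonneg P)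
    have hvq : 0 ≤ (τ ^ q)⁻¹ * v ^ q := by positivity
    rcases le_total v τ with h | h
    · have := mul_le_mul_of_nonneg_right (pow_le_pow_left₀ hv0 h 2) hX0.le
      linarith
    · have g1 : 1 ≤ (τ ^ q)⁻¹ * v ^ q := by
        rw [← div_eq_inv_mul, one_le_div (by positivity)]
        exact Real.rpow_le_rpow hτ0.le h hq.le
      have g2 : v ^ 2 * Real.exp (-k * dist (G.coord e t) x) ≤ 1 :=
        mul_le_one₀ (pow_le_one₀ hv0 hv1) hX0.le hX1
      have g3 : 0 ≤ τ ^ 2 * Real.exp (-k * dist (G.coord e t) x) := by positivity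
      linarith
  have h3 : G.integral (fun e t => (G.restr u e t) ^ 2 * (deriv (G.restr η e) t) ^ 2) ≤
      k ^ 2 * G.integral F := by
    rw [← integral_const_mul']
    refine integral_mono' (hη.integrable_mul_deriv S.memH1) (fun e => (hFint e).const_mul _)
      fun e => Eventually.of_forall fun t => ?_
    have g1 := abs_deriv_expCut_le (c := k) (δ := 1 / 2) (x := x) hG hk.le e t
    have g2 : (deriv (G.restr η e) t) ^ 2 ≤ k ^ 2 * Real.exp (-k * dist (G.coord e t) x) := by
      rw [← sq_abs (deriv _ _)]
      refine (pow_le_pow_left₀ (abs_nonneg _) g1 2).trans ?_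
      rw [mul_pow]
      exact mul_le_mul_of_nonneg_left (hexp2 e t) (sq_nonneg k)
    have g3 := mul_le_mul_of_nonneg_left g2 (sq_nonneg (G.restr u e t))
    have g4 := mul_le_mul_of_nonneg_left (hu2 e t) (sq_nonneg k)
    linarith
  have h4 : (S.nl fun x => u x * η x) ≤ b * M₀ ^ (p - 2) * k ^ 2 * G.integral F := by
    rw [nl, ← integral_const_mul']
    refine integral_mono' (S.integrable_nl hG (hη.mul_memH1 S.memH1).1)
      (fun e => (hFint e).const_mul _) fun e => ?_
    filter_upwards [S.coeff_le e] with t g1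
    have g2 : S.coeff e t ≤ b * M₀ ^ (p - 2) * k ^ 2 := by
      refine g1.trans ?_
      rw [mul_assoc]
      refine mul_le_mul_of_nonneg_left ?_ hb.le
      rw [← amp_rpow (k := k) hp, ← Real.mul_rpow hM₀.le hμ.le]
      exact Real.rpow_le_rpow (abs_nonneg _) (hM _) (by linarith)
    have g3 : (G.restr (fun x => u x * η x) e t) ^ 2 ≤ F e t := by
      refine le_trans ?_ (hu2 e t)
      have : (G.restr (fun x => u x * η x) e t) ^ 2 =
        (G.restr u e t) ^ 2 * (G.restr η e t) ^ 2 := by simp only [restr]; ring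
      rw [this]
      refine mul_le_mul_of_nonneg_left ?_ (sq_nonneg _)
      exact (pow_le_pow_left₀ (expCut_nonneg _) (expCut_le (by norm_num) _) 2).trans (hexp2 e t)
    exact mul_le_mul g2 g3 (sq_nonneg _) (by positivity)
  have h5 : P ^ 2 * τ ^ 2 * I ≤ P ^ 2 * τ ^ 2 * (n * (6 / k)) :=
    mul_le_mul_of_nonneg_left hIle (by positivity)
  have h6 : δ₀ ^ 2 * μ ^ 2 ≤ u x ^ 2 := by
    rw [← mul_pow, ← sq_abs (u x)]; exact pow_le_pow_left₀ (by positivity) hx 2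
  have h7 : k * (δ₀ ^ 2 * μ ^ 2 / 4) ≤ 4 * (Γ * k ^ 2 *
      (P ^ 2 * τ ^ 2 * (n * (6 / k)) + P ^ 2 * (τ ^ q)⁻¹ * J)) := by
    have g1 : k * (δ₀ ^ 2 * μ ^ 2 / 4) ≤ k * (u x * (1 - 1 / 2)) ^ 2 :=
      mul_le_mul_of_nonneg_left (by linarith) hk.le
    have g2 : 0 ≤ G.integral F := integral_nonneg' fun e => Eventually.of_forall fun t =>
      le_trans (by positivity) (hu2 e t)
    have g3 : Γ * k ^ 2 * G.integral F =
      k ^ 2 * G.integral F + b * M₀ ^ (p - 2) * k ^ 2 * G.integral F := by rw [hΓ]; ring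
    have g4 : Γ * k ^ 2 * G.integral F ≤ Γ * k ^ 2 *
        (P ^ 2 * τ ^ 2 * (n * (6 / k)) + P ^ 2 * (τ ^ q)⁻¹ * J) := by
      rw [hFeq]; exact mul_le_mul_of_nonneg_left (by linarith) (by positivity)
    have g5 : 0 ≤ Γ * k ^ 2 * G.integral F := by positivity
    linarith
  have h8 : 4 * (Γ * k ^ 2 * (P ^ 2 * τ ^ 2 * (n * (6 / k)) + P ^ 2 * (τ ^ q)⁻¹ * J)) =
      k * μ ^ 2 * (δ₀ ^ 2 / 8 + 4 * Γ * M₀ ^ 2 * (τ ^ q)⁻¹ * (k * J)) := by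
    rw [hτ2, hT, hP]; field_simp; ring
  rw [h8] at h7
  have h9 : k * μ ^ 2 * (δ₀ ^ 2 / 4) ≤
      k * μ ^ 2 * (δ₀ ^ 2 / 8 + 4 * Γ * M₀ ^ 2 * (τ ^ q)⁻¹ * (k * J)) := by linarith
  have h10 := le_of_mul_le_mul_left h9 (by positivity)
  have h11 : δ₀ ^ 2 / 8 ≤ 4 * Γ * M₀ ^ 2 * (τ ^ q)⁻¹ * (k * J) := by linarith
  calc τ ^ q * (δ₀ ^ 2 / (32 * Γ * M₀ ^ 2)) = τ ^ q / (4 * Γ * M₀ ^ 2) * (δ₀ ^ 2 / 8) := by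
        field_simp; norm_num
    _ ≤ τ ^ q / (4 * Γ * M₀ ^ 2) * (4 * Γ * M₀ ^ 2 * (τ ^ q)⁻¹ * (k * J)) :=
        mul_le_mul_of_nonneg_left h11 (by positivity)
    _ = k * J := by field_simp

end SolData

/-! ### Concentration, decay and integrals for a sequence of solutions. -/

theorem tendsto_amp {p : ℝ} (hp : 2 < p) {k : ℕ → ℝ} (hk : Tendsto k atTop atTop) :
    Tendsto (fun n => amp p (k n)) atTop atTop :=
  (tendsto_rpow_atTop (one_div_pos.2 (sub_pos.2 hp))).comp
    ((tendsto_pow_atTop two_ne_zero).comp hk)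

namespace SolData

/-- If |u| stayed below δ₀ μ, the decay estimate would apply with no centers at all; its right-hand
side is then 0 and u vanishes. -/
theorem exists_large_value [Fintype E] [Nonempty E] (hG : G.Connected) {p k Wbar b : ℝ}
    {W ρ u : G.Point → ℝ} (S : SolData G p k Wbar b W ρ u) (hu : u ≠ 0)
    {M₀ δ₀ : ℝ} (hM₀ : 0 < M₀) (hM : ∀ y, |u y| ≤ M₀ * amp p k) (hδ₀ : 0 < δ₀)
    (hb : b * δ₀ ^ (p - 2) ≤ 1 / 8) : ∃ y, δ₀ * amp p k ≤ |u y| := by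
  by_contra! hcon
  refine hu (funext fun z => ?_)
  have h := S.sq_mul_exp_le hG hM₀ hM hδ₀ hb (m := 0) (x := Fin.elim0) (D := 0)
    (fun y hy => absurd hy (not_le.2 (hcon y))) z
  rw [Nat.cast_zero, mul_zero, zero_mul] at h
  have h1 := Real.exp_pos (k * ⨅ i : Fin 0, dist z (Fin.elim0 i))
  have h2 : u z ^ 2 ≤ 0 := by
    by_contra h3
    exact absurd h (not_le.2 (mul_pos (not_le.1 h3) h1))
  exact pow_eq_zero_iff two_ne_zero |>.1 (le_antisymm h2 (sq_nonneg _))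

theorem abs_le_mul_exp [Fintype E] [Nonempty E] (hG : G.Connected) {p k Wbar b : ℝ}
    {W ρ u : G.Point → ℝ} (S : SolData G p k Wbar b W ρ u)
    {M₀ δ₀ D : ℝ} (hM₀ : 0 < M₀) (hM : ∀ y, |u y| ≤ M₀ * amp p k) (hδ₀ : 0 < δ₀)
    (hb : b * δ₀ ^ (p - 2) ≤ 1 / 8) {m : ℕ} {x : Fin m → G.Point}
    (hcov : ∀ y, δ₀ * amp p k ≤ |u y| → ∃ i, k * dist y (x i) ≤ D) (z : G.Point) :
    |u z| ≤ √(48 * b * M₀ ^ p * Real.exp (2 * D) * Fintype.card E * m) * amp p k *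
      Real.exp (-(1 / 2) * k * ⨅ i, dist z (x i)) := by
  have h := S.sq_mul_exp_le hG hM₀ hM hδ₀ hb hcov z
  have hμ : 0 < amp p k := amp_pos S.k_pos
  have hb := S.b_pos
  set d := ⨅ i, dist z (x i)
  refine le_of_sq_le_sq (a := |u z|) ?_ (by positivity)
  rw [mul_pow, mul_pow, Real.sq_sqrt (by positivity), ← Real.exp_nat_mul, sq_abs]
  have e1 : Real.exp ((2 : ℕ) * (-(1 / 2) * k * d)) = (Real.exp (k * d))⁻¹ := by
    rw [← Real.exp_neg]; congr 1; push_cast; ring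
  rw [e1, ← div_eq_mul_inv, le_div_iff₀ (Real.exp_pos _)]
  exact h

end SolData

/-- Concentration of a sequence of solutions of bounded Morse index, after rescaling. -/
theorem exists_concentration [Fintype E] [Nonempty E] (hG : G.Connected) {p Wbar b M₀ : ℝ}
    {k : ℕ → ℝ} {W ρ u : ℕ → G.Point → ℝ}
    (S : ∀ n, SolData G p (k n) Wbar b (W n) (ρ n) (u n)) (hk : Tendsto k atTop atTop)
    (hu0 : ∀ n, u n ≠ 0) (hM₀ : 0 < M₀) (hM : ∀ n y, |u n y| ≤ M₀ * amp p (k n)) {M : ℕ}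
    (hmorse : ∀ n, G.morseIndex p (fun x => W n x + k n ^ 2) (ρ n) (u n) ≤ M) :
    ∃ σ : ℕ → ℕ, StrictMono σ ∧ ∃ m, 1 ≤ m ∧ m ≤ M ∧
    ∃ (x : Fin m → ℕ → G.Point) (R : ℕ → ℝ),
      (∀ n, 0 < R n) ∧ Tendsto R atTop atTop ∧
      (∀ i j, i ≠ j → Tendsto (fun n => k (σ n) * dist (x i n) (x j n)) atTop atTop) ∧
      (∀ i n y, k (σ n) * dist y (x i n) < R n → |u (σ n) y| ≤ |u (σ n) (x i n)|) ∧
      (∀ i, Tendsto (fun n => |u (σ n) (x i n)|) atTop atTop) ∧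
      (∃ C, 0 < C ∧ ∀ n y, |u (σ n) y| ≤ C * amp p (k (σ n)) *
          Real.exp (-(1 / 2) * k (σ n) * ⨅ i, dist y (x i n))) ∧
      ∀ q : ℝ, 1 ≤ q → (∀ n, G.EdgeIntegrable fun e t => |G.restr (u (σ n)) e t| ^ q) ∧
        ∃ ℓ, 0 < ℓ ∧ Tendsto (fun n => k (σ n) / amp p (k (σ n)) ^ q *
          G.integral fun e t => |G.restr (u (σ n)) e t| ^ q) atTop (𝓝 ℓ) := by
  have hp := (S 0).two_lt
  have hb := (S 0).b_pos
  have hk0 : ∀ n, 0 < k n := fun n => (S n).k_pos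
  have hcard : 1 ≤ Fintype.card E := Fintype.card_pos
  -- Level at which the nonlinear coefficient b|u|^(p-2) equals k²/8, the amount the decay estimate
  -- can absorb.
  set δ₀ := (1 / (8 * b)) ^ (1 / (p - 2)) with hδ₀def
  have hδ₀ : 0 < δ₀ := by positivity
  have hbδ : b * δ₀ ^ (p - 2) ≤ 1 / 8 := by
    rw [hδ₀def, ← Real.rpow_mul (by positivity), one_div_mul_cancel (by linarith), Real.rpow_one]
    field_simp
    norm_num
  obtain ⟨α, δ, hα, hδ, -, hunst⟩ :=
    SolData.exists_unstable p b M₀ δ₀ hp hM₀ hδ₀ (Fintype.card E) hcard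
  obtain ⟨σ, hσ, m, hm1, hmM, x, R, D, hR0, hR, hfar, hmax, hlarge, hcov⟩ :=
    exists_concentration_points (c := fun n => δ₀ * amp p (k n)) (L := 2 * (-Real.log δ / α))
      (M := M) hG hk0 (fun n => (S n).memH1.1)
      (fun n => (S n).exists_large_value hG (hu0 n) hM₀ (hM n) hδ₀ hbδ)
      (fun n N x hx hsep => by
        have h := ((S n).le_morseIndex_of_separated hG hα hδ
          (fun i => hunst rfl hG (S n) (hM n) (x i) (hx i)) hsep).trans (hmorse n)
        exact_mod_cast h)
  set C := √(48 * b * M₀ ^ p * Real.exp (2 * D) * Fintype.card E * m) + 1 with hC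
  have hC0 : 0 < C := by positivity
  have hdecay : ∀ n y, |u (σ n) y| ≤ C * amp p (k (σ n)) *
      Real.exp (-(1 / 2) * k (σ n) * ⨅ i, dist y (x i n)) := by
    intro n y
    refine ((S (σ n)).abs_le_mul_exp hG hM₀ (hM _) hδ₀ hbδ (hcov n) y).trans ?_
    have hμ : 0 < amp p (k (σ n)) := amp_pos (hk0 _)
    gcongr
    rw [hC]; linarith
  set v : ℕ → G.Point → ℝ := fun n y => |u (σ n) y| / (M₀ * amp p (k (σ n))) with hv
  have hP0 : ∀ n, 0 < M₀ * amp p (k (σ n)) := fun n => mul_pos hM₀ (amp_pos (hk0 _))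
  have hv0 : ∀ n y, 0 ≤ v n y := fun n y => div_nonneg (abs_nonneg _) (hP0 n).le
  have hv1 : ∀ n y, v n y ≤ 1 := fun n y => (div_le_one (hP0 n)).2 (hM _ y)
  have hvint : ∀ n {q : ℝ}, 0 < q → G.EdgeIntegrable (fun e t => (G.restr (v n) e t) ^ q) ∧
      k (σ n) * G.integral (fun e t => (G.restr (v n) e t) ^ q) ≤
        (C / M₀) ^ q * (m * (Fintype.card E * (12 / q))) := fun n q hq =>
    integral_rpow_le (x := fun i => x i n) hG ((S (σ n)).memH1.1.abs.div_const _) (hv0 n) hm1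
      (by positivity)
      (hk0 (σ n)) hq fun y => by
        rw [div_le_iff₀ (hP0 n)]
        refine (hdecay n y).trans (le_of_eq ?_)
        field_simp
  -- Since 0 ≤ v ≤ 1, the integral with exponent 1/2 dominates those with q ≥ 1 and also controls
  -- their differences.
  set B := (C / M₀) ^ (1 / 2 : ℝ) * (m * (Fintype.card E * (12 / (1 / 2)))) with hB
  set J : ℕ → ℝ → ℝ := fun n q => k (σ n) * G.integral (fun e t => (G.restr (v n) e t) ^ q)
    with hJ
  have hJ0 : ∀ n q, 0 ≤ J n q := fun n q => mul_nonneg (hk0 _).le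
    (integral_nonneg' fun e => Eventually.of_forall fun t => Real.rpow_nonneg (hv0 n _) q)
  have hJB : ∀ n, ∀ q ∈ Set.Ici (1:ℝ), |J n q| ≤ B := by
    intro n q hq
    have hq : 1 ≤ q := hq
    rw [abs_of_nonneg (hJ0 n q)]
    refine le_trans ?_ (hvint n (q := 1 / 2) (by norm_num)).2
    refine mul_le_mul_of_nonneg_left (integral_mono' (hvint n (by linarith)).1
      (hvint n (by norm_num)).1 fun e => Eventually.of_forall fun t => ?_) (hk0 _).le
    exact Real.rpow_le_rpow_of_exponent_ge_of_imp (hv0 n _) (hv1 n _) (by linarith)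
      (fun _ h => by linarith)
  have hJK : ∀ n, ∀ q ∈ Set.Ici (1:ℝ), ∀ r ∈ Set.Ici (1:ℝ),
      |J n q - J n r| ≤ 2 * B * |q - r| := by
    intro n q hq r hr
    have hq : 1 ≤ q := hq
    have hr : 1 ≤ r := hr
    have key : ∀ q r : ℝ, 1 ≤ q → 1 ≤ r → J n q - J n r ≤ 2 * B * |q - r| := by
      intro q r hq hr
      have h1 := (hvint n (show 0 < q by linarith)).1
      have h2 := (hvint n (show 0 < r by linarith)).1
      have h3 := hvint n (show (0:ℝ) < 1 / 2 by norm_num)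
      have h4 : G.integral (fun e t => (G.restr (v n) e t) ^ q) -
          G.integral (fun e t => (G.restr (v n) e t) ^ r) ≤
          2 * |q - r| * G.integral (fun e t => (G.restr (v n) e t) ^ (1 / 2 : ℝ)) := by
        rw [← integral_sub' h1 h2, ← integral_const_mul']
        refine integral_mono' (fun e => (h1 e).sub (h2 e)) (fun e => (h3.1 e).const_mul _)
          fun e => Eventually.of_forall fun t => ?_
        exact (le_abs_self _).trans (abs_rpow_sub_rpow_le (hv0 n _) (hv1 n _) hq hr)
      calc J n q - J n r = k (σ n) * (G.integral (fun e t => (G.restr (v n) e t) ^ q) -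
            G.integral (fun e t => (G.restr (v n) e t) ^ r)) := by rw [hJ]; ring
        _ ≤ _ := mul_le_mul_of_nonneg_left h4 (hk0 _).le
        _ = 2 * |q - r| *
            (k (σ n) * G.integral (fun e t => (G.restr (v n) e t) ^ (1 / 2 : ℝ))) := by ring
        _ ≤ 2 * |q - r| * B := mul_le_mul_of_nonneg_left h3.2 (by positivity)
        _ = _ := by ring
    rw [abs_le]
    constructor
    · have := key r q hr hq
      rw [abs_sub_comm] at this
      linarith
    · exact key q r hq hr
  obtain ⟨τ, hτ, hτlim⟩ := exists_subseq_tendsto_of_lipschitz hJB hJK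
  have hpow : ∀ n (q : ℝ) e t, |G.restr (u (σ n)) e t| ^ q =
      (M₀ * amp p (k (σ n))) ^ q * (G.restr (v n) e t) ^ q := by
    intro n q e t
    simp only [restr]
    rw [← Real.mul_rpow (hP0 n).le (hv0 n _)]
    congr 1
    simp only [hv]
    rw [mul_div_cancel₀ _ (hP0 n).ne']
  refine ⟨σ ∘ τ, hσ.comp hτ, m, hm1, hmM, fun i n => x i (τ n), fun n => R (τ n),
    fun n => hR0 _, hR.comp hτ.tendsto_atTop, fun i j hij => (hfar i j hij).comp hτ.tendsto_atTop,
    fun i n y hy => hmax i (τ n) y hy, fun i => ?_, ⟨C, hC0, fun n y => hdecay (τ n) y⟩,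
    fun q hq => ⟨fun n e => ?_, ?_⟩⟩
  · refine tendsto_atTop_mono (fun n => hlarge i (τ n)) ?_
    exact Tendsto.const_mul_atTop hδ₀ ((tendsto_amp hp hk).comp
      (hσ.tendsto_atTop.comp hτ.tendsto_atTop))
  · simp only [Function.comp_apply, hpow]
    exact ((hvint (τ n) (by linarith)).1 e).const_mul _
  · obtain ⟨ℓ, hℓ⟩ := hτlim q hq
    obtain ⟨c, hc0, hc⟩ := SolData.exists_le_integral_rpow p b M₀ δ₀ q hp hb hM₀ hδ₀
      (by linarith) (Fintype.card E) hcard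
    -- The constant c does not depend on n, so the mass near one concentration point survives in the
    -- limit.
    have hcℓ : c ≤ ℓ := ge_of_tendsto' hℓ fun n =>
      hc rfl hG (S (σ (τ n))) (hM _) (hvint (τ n) (by linarith)).1 (x ⟨0, hm1⟩ (τ n))
        (hlarge _ _)
    refine ⟨M₀ ^ q * ℓ, mul_pos (Real.rpow_pos_of_pos hM₀ q) (hc0.trans_le hcℓ), ?_⟩
    refine (hℓ.const_mul (M₀ ^ q)).congr fun n => ?_
    simp only [Function.comp_apply, hpow]
    rw [integral_const_mul', Real.mul_rpow hM₀.le (amp_pos (hk0 _)).le, hJ]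
    have : 0 < amp p (k (σ (τ n))) ^ q := Real.rpow_pos_of_pos (amp_pos (hk0 _)) q
    field_simp

/-- For large `n`, the rescaled problems satisfy all the hypotheses of `SolData`. -/
theorem eventually_solData [Fintype E] {p Wbar b : ℝ} (hp : 2 < p) (hb : 0 < b)
    {W ρ : ℕ → G.Point → ℝ}
    (hWm : ∀ n e, AEMeasurable (G.restr (W n) e) (volume.restrict (G.openEdge e)))
    (hρm : ∀ n e, AEMeasurable (G.restr (ρ n) e) (volume.restrict (G.openEdge e)))
    (hW : ∀ n e, ∀ᵐ t ∂volume.restrict (G.openEdge e), |G.restr (W n) e t| ≤ Wbar)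
    (hρ : ∀ n e, ∀ᵐ t ∂volume.restrict (G.openEdge e),
      0 ≤ G.restr (ρ n) e t ∧ G.restr (ρ n) e t ≤ b)
    {lam : ℕ → ℝ} (hlam : Tendsto lam atTop atTop) {u : ℕ → G.Point → ℝ}
    (hu : ∀ n, G.IsSolution p (fun x => W n x + lam n) (ρ n) (u n)) {c : ℝ} (hc : 1 ≤ c) :
    ∀ᶠ n in atTop, 0 < lam n ∧ SolData G p √(lam n) Wbar b (W n) (ρ n) (u n) ∧
      ∀ e, ENNReal.ofReal (c / √(lam n)) ≤ G.len e := by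
  have hsqrt : Tendsto (fun n => √(lam n)) atTop atTop := Real.tendsto_sqrt_atTop.comp hlam
  have hlen : ∀ e, ∀ᶠ n in atTop, ENNReal.ofReal (c / √(lam n)) ≤ G.len e := by
    intro e
    have h1 : Tendsto (fun n => ENNReal.ofReal (c / √(lam n))) atTop (𝓝 (ENNReal.ofReal 0)) :=
      ENNReal.tendsto_ofReal (hsqrt.const_div_atTop c)
    rw [ENNReal.ofReal_zero] at h1
    exact (h1.eventually_lt_const (G.len_pos e)).mono fun n => le_of_lt
  filter_upwards [hlam.eventually_gt_atTop 0, hlam.eventually_ge_atTop (8 * Wbar),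
    eventually_all.2 hlen] with n h1 h2 h3
  have hk : 0 < √(lam n) := Real.sqrt_pos.2 h1
  refine ⟨h1, ⟨hp, hk, fun e => (ENNReal.ofReal_le_ofReal ?_).trans (h3 e), ?_, hb, hWm n, hρm n,
    hW n, hρ n, ?_⟩, h3⟩
  · exact div_le_div_of_nonneg_right hc hk.le
  · rwa [Real.sq_sqrt h1.le]
  · rw [Real.sq_sqrt h1.le]; exact hu n

end MetricGraph

end

/-! ### The theorem, expressed through `λ`. -/

theorem theorem1p1 {V E : Type*} [Finite V] [Fintype E] [Nonempty E]
    (G : MetricGraph V E) (hG : G.Connected)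
    (p : ℝ) (hp : 2 < p)
    (W ρ : ℕ → G.Point → ℝ) (hH : G.HypH W ρ)
    (lam : ℕ → ℝ) (hlam : Tendsto lam atTop atTop)
    (u : ℕ → G.Point → ℝ) (hu0 : ∀ n, u n ≠ 0)
    (hu : ∀ n, G.IsSolution p (fun x => W n x + lam n) (ρ n) (u n))
    (mstar : ℕ)
    (hmorse : ∀ n, G.morseIndex p (fun x => W n x + lam n) (ρ n) (u n) ≤ mstar) :
    ∃ σ : ℕ → ℕ, StrictMono σ ∧ (∀ n, 0 < lam (σ n)) ∧
    ∃ m : ℕ, 1 ≤ m ∧ m ≤ mstar ∧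
    ∃ (x : Fin m → ℕ → G.Point) (R : Fin m → ℕ → ℝ),
      (∀ i n, 0 < R i n) ∧
      (∀ i, Tendsto (R i) atTop atTop) ∧
      (∀ i j, i ≠ j →
        Tendsto (fun n => lam (σ n) ^ (1 / 2 : ℝ) * dist (x i n) (x j n)) atTop atTop) ∧
      (∀ i n, ∀ y : G.Point, dist y (x i n) < R i n * lam (σ n) ^ (-(1 / 2) : ℝ) →
        |u (σ n) y| ≤ |u (σ n) (x i n)|) ∧
      (∀ i, Tendsto (fun n => |u (σ n) (x i n)|) atTop atTop) ∧
      (∃ C : ℝ, 0 < C ∧ ∀ n, ∀ y : G.Point,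
        |u (σ n) y| ≤ C * lam (σ n) ^ (1 / (p - 2)) *
          Real.exp (-(1 / 2) * lam (σ n) ^ (1 / 2 : ℝ) * ⨅ i, dist y (x i n))) ∧
      (∀ q : ℝ, 1 ≤ q →
        (∀ n e, IntegrableOn (fun t => |G.restr (u (σ n)) e t| ^ q) (G.openEdge e)) ∧
        ∃ ℓ : ℝ, 0 < ℓ ∧
          Tendsto (fun n => lam (σ n) ^ (1 / 2 - q / (p - 2)) *
            G.integral (fun e t => |G.restr (u (σ n)) e t| ^ q)) atTop (𝓝 ℓ)) := by
  obtain ⟨hWm, hρm, ⟨Wbar, hW⟩, b, hb, hρ, a, ha, -, hdich⟩ := hH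
  obtain ⟨A, -, hA⟩ := MetricGraph.SolData.exists_bound_of_morseIndex_le p a b hp ha hb mstar
  obtain ⟨M₀, hM₀, hM₀'⟩ := MetricGraph.SolData.exists_amplitude_bound p A b hb (Fintype.card E)
  have hms : (0:ℝ) ≤ mstar := Nat.cast_nonneg _
  -- Beyond n₀, λ is positive and dominates the potential, and every edge is at least 16(m* + 2)/√λ
  -- long, as the oscillation argument requires.
  obtain ⟨n₀, hn₀⟩ := eventually_atTop.1
    (MetricGraph.eventually_solData hp hb hWm hρm hW hρ hlam hu (c := 16 * (mstar + 2))
      (by linarith))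
  have hpos : ∀ n, 0 < lam (n + n₀) := fun n => (hn₀ _ (by omega)).1
  have hS : ∀ n, MetricGraph.SolData G p √(lam (n + n₀)) Wbar b (W (n + n₀)) (ρ (n + n₀))
      (u (n + n₀)) := fun n => (hn₀ _ (by omega)).2.1
  have hm : ∀ n, G.morseIndex p (fun x => W (n + n₀) x + √(lam (n + n₀)) ^ 2) (ρ (n + n₀))
      (u (n + n₀)) ≤ mstar := fun n => by
    rw [Real.sq_sqrt (hpos n).le]; exact hmorse _
  have hk : Tendsto (fun n => √(lam (n + n₀))) atTop atTop :=
    (Real.tendsto_sqrt_atTop.comp hlam).comp (tendsto_add_atTop_nat n₀)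
  obtain ⟨σ, hσ, m, hm1, hmM, x, R, hR0, hR, hfar, hmax, hlarge, ⟨C, hC0, hC⟩, hint⟩ :=
    MetricGraph.exists_concentration hG hS hk (fun n => hu0 _) hM₀
      (fun n => hM₀' rfl hG (hS n) fun e =>
      (hdich e).imp (fun h => hA hG (hS n) (hm n) e (h _) ((hn₀ _ (by omega)).2.2 e))
        fun h => h _) hm
  have hhalf : ∀ n, lam (σ n + n₀) ^ (1 / 2 : ℝ) = √(lam (σ n + n₀)) := fun n =>
    (Real.sqrt_eq_rpow _).symm
  have hamp : ∀ n, lam (σ n + n₀) ^ (1 / (p - 2)) = MetricGraph.amp p √(lam (σ n + n₀)) :=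
      fun n => by
    rw [MetricGraph.amp, Real.sq_sqrt (hpos _).le]
  refine ⟨fun n => σ n + n₀, fun i j h => Nat.add_lt_add_right (hσ h) n₀, fun n => hpos _, m, hm1,
    hmM, x, fun _ => R, fun _ => hR0, fun _ => hR, fun i j hij => ?_, fun i n y hy => ?_, hlarge,
    ⟨C, hC0, fun n y => ?_⟩, fun q hq => ⟨fun n => (hint q hq).1 n, ?_⟩⟩
  · simp only [hhalf]
    exact hfar i j hij
  · refine hmax i n y ?_
    rw [Real.rpow_neg (hpos _).le, hhalf, ← div_eq_mul_inv,
      lt_div_iff₀ (Real.sqrt_pos.2 (hpos _))] at hy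
    rwa [mul_comm]
  · rw [hhalf, hamp]
    exact hC n y
  · obtain ⟨ℓ, hℓ0, hℓ⟩ := (hint q hq).2
    -- The normalizations agree: λ^(1/2 - q/(p-2)) = k / μ^q.
    refine ⟨ℓ, hℓ0, hℓ.congr fun n => ?_⟩
    rw [Real.rpow_sub (hpos _), hhalf, ← hamp, ← Real.rpow_mul (hpos _).le, one_div_mul_eq_div]
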